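/- Let $\mathbb H=\mathbb R^3$ be the Heisenberg group with product $(p,q,t)(p',q',t')=(p+p',\,q+q',\,t+t'+\tfrac12(pq'-qp'))$ and Lebesgue measure as Haar measure, and let $\lambda$ be the left regular representation $(\lambda(x)f)(y)=f(x^{-1}y)$ on $L^2(\mathbb H)$. For $h\in\mathbb R\setminus\{0\}$ let $\rho_h$ be the Schrödinger representation on $L^2(\mathbb R)$, $[\rho_h(p,q,t)\varphi](y)=e^{2\pi i ht}e^{2\pi i qy}e^{\pi i hpq}\varphi(y+hp)$. Let $f\mapsto(\widehat f(h))_h$ be the Plancherel transform, that is, the continuous extension to $L^2(\mathbb H)$ of $f\mapsto\big(\int_{\mathbb H} f(x)\rho_h(x)\,dx\big)_{h}$, $f\in L^1(\mathbb H)\cap L^2(\mathbb H)$, with values in the direct integral of the Hilbert–Schmidt operators on $L^2(\mathbb R)$ over $\mathbb R\setminus\{0\}$ with respect to $|h|\,dh$. Let $\mathcal H\subset L^2(\mathbb H)$ be a closed subspace with $\lambda(x)\mathcal H\subset\mathcal H$ for all $x\in\mathbb H$. Then there is a measurable field $(\widehat P_h)_h$ of orthogonal projections on $L^2(\mathbb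 R)$ associated with $\mathcal H$, i.e. such that the orthogonal projection $P$ onto $\mathcal H$ satisfies $\widehat{Pf}(h)=\widehat f(h)\circ\widehat P_h$ for every $f\in L^2(\mathbb H)$ and almost every $h$. For any such field, suppose that the multiplicity function $m(h)=\operatorname{rank}\widehat P_h$ is bounded (up to a null set). Then the following are equivalent: (a) there exist a lattice $\Gamma<\mathbb H$ (a discrete subgroup of finite covolume) and a vector $\Phi\in\mathcal H$ such that $(\lambda(\gamma)\Phi)_{\gamma\in\Gamma}$ is a tight frame of $\mathcal H$, i.e. for some $c>0$, $\sum_{\gamma\in\Gamma}|\langle f,\lambda(\gamma)\Phi\rangle|^2=c\,\|f\|^2$ for all $f\in\mathcal H$; (b) $\mathcal H$ is bandlimited, i.e. the set $\{h:\widehat P_h\neq0\}$ is bounded up to a null set. -/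

import Mathlib

open MeasureTheory Filter Topology
open scoped ENNReal InnerProductSpace

noncomputable section

namespace Heisenberg

/-! ### The Heisenberg group -/

/-- The Heisenberg group: `ℝ³` with coordinates `(p, q, t)`, Euclidean topology, Borel
`σ`-algebra and Lebesgue measure (which is a Haar measure). -/
def Heis : Type := ℝ × ℝ × ℝ

namespace Heis

instance : TopologicalSpace Heis := inferInstanceAs (TopologicalSpace (ℝ × ℝ × ℝ))
instance : MeasureSpace Heis := inferInstanceAs (MeasureSpace (ℝ × ℝ × ℝ))
instance : BorelSpace Heis := inferInstanceAs (BorelSpace (ℝ × ℝ × ℝ))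

/-- The first coordinate. -/
def p (x : Heis) : ℝ := x.1
/-- The second coordinate. -/
def q (x : Heis) : ℝ := x.2.1
/-- The third (central) coordinate. -/
def t (x : Heis) : ℝ := x.2.2
/-- The element with coordinates `(p, q, t)`. -/
def mk (p q t : ℝ) : Heis := (p, q, t)

theorem ext' {x y : Heis} (h₁ : x.p = y.p) (h₂ : x.q = y.q) (h₃ : x.t = y.t) : x = y :=
  Prod.ext h₁ (Prod.ext h₂ h₃)

theorem measurable_p : Measurable Heis.p := measurable_fst
theorem measurable_q : Measurable Heis.q := measurable_fst.comp measurable_snd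
theorem measurable_t : Measurable Heis.t := measurable_snd.comp measurable_snd

/-- `(p,q,t)(p',q',t') = (p + p', q + q', t + t' + (p q' - q p') / 2)`. -/
instance : Mul Heis :=
  ⟨fun x y => mk (x.p + y.p) (x.q + y.q) (x.t + y.t + (x.p * y.q - x.q * y.p) / 2)⟩
instance : One Heis := ⟨mk 0 0 0⟩
instance : Inv Heis := ⟨fun x => mk (-x.p) (-x.q) (-x.t)⟩

@[simp] theorem mul_p (x y : Heis) : (x * y).p = x.p + y.p := rfl
@[simp] theorem mul_q (x y : Heis) : (x * y).q = x.q + y.q := rfl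
@[simp] theorem mul_t (x y : Heis) :
    (x * y).t = x.t + y.t + (x.p * y.q - x.q * y.p) / 2 := rfl
@[simp] theorem one_p : (1 : Heis).p = 0 := rfl
@[simp] theorem one_q : (1 : Heis).q = 0 := rfl
@[simp] theorem one_t : (1 : Heis).t = 0 := rfl
@[simp] theorem inv_p (x : Heis) : x⁻¹.p = -x.p := rfl
@[simp] theorem inv_q (x : Heis) : x⁻¹.q = -x.q := rfl
@[simp] theorem inv_t (x : Heis) : x⁻¹.t = -x.t := rfl

instance : Group Heis :=
  Group.ofLeftAxioms
    (fun x y z => ext' (by simp; ring) (by simp; ring) (by simp; ring))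
    (fun x => ext' (by simp) (by simp) (by simp))
    (fun x => ext' (by simp) (by simp) (by simp; ring))

theorem measurePreserving_mul_left (a : Heis) :
    MeasurePreserving (fun x : Heis => a * x) volume volume := by
  have h3 : ∀ y : ℝ, MeasurePreserving (fun z : ℝ × ℝ =>
      (a.q + z.1, a.t + z.2 + (a.p * z.1 - a.q * y) / 2)) volume volume := by
    intro y
    refine MeasurePreserving.skew_product (f := fun u : ℝ => a.q + u)
      (g := fun (u v : ℝ) => a.t + v + (a.p * u - a.q * y) / 2)
      (measurePreserving_add_left volume a.q) (by unfold Function.uncurry; fun_prop) ?_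
    refine Eventually.of_forall fun u => ?_
    have : (fun v : ℝ => a.t + v + (a.p * u - a.q * y) / 2)
        = fun v : ℝ => (a.t + (a.p * u - a.q * y) / 2) + v := by
      funext v; ring
    rw [this]
    exact (measurePreserving_add_left volume _).map_eq
  exact MeasurePreserving.skew_product (f := fun u : ℝ => a.p + u)
      (g := fun (y : ℝ) (z : ℝ × ℝ) => (a.q + z.1, a.t + z.2 + (a.p * z.1 - a.q * y) / 2))
      (measurePreserving_add_left volume a.p) (by unfold Function.uncurry; fun_prop)
      (Eventually.of_forall fun y => (h3 y).map_eq)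

end Heis

/-! ### `L²` spaces, the left regular representation and the Schrödinger representations -/

/-- The Hilbert space `L²(ℍ)`. -/
abbrev L2H : Type := Lp ℂ 2 (volume : Measure Heis)

/-- The Hilbert space `L²(ℝ)`. -/
abbrev L2R : Type := Lp ℂ 2 (volume : Measure ℝ)

/-- The left regular representation `(λ(x) f)(y) = f(x⁻¹ y)`. -/
def leftReg (x : Heis) : L2H →ₗᵢ[ℂ] L2H :=
  Lp.compMeasurePreservingₗᵢ ℂ (fun y => x⁻¹ * y) (Heis.measurePreserving_mul_left x⁻¹)

/-- `H` is invariant under all left translations. -/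
def LeftInvariant (H : Submodule ℂ L2H) : Prop :=
  ∀ x : Heis, ∀ f ∈ H, leftReg x f ∈ H

/-- The phase `exp(2πi h t) exp(2πi q y) exp(πi h p q)`. -/
def phase (h : ℝ) (x : Heis) (y : ℝ) : ℂ :=
  Complex.exp (2 * Real.pi * Complex.I * h * x.t) *
    Complex.exp (2 * Real.pi * Complex.I * x.q * y) *
    Complex.exp (Real.pi * Complex.I * h * x.p * x.q)

theorem norm_phase (h : ℝ) (x : Heis) (y : ℝ) : ‖phase h x y‖ = 1 := by
  simp [phase, Complex.norm_exp]

theorem measurable_phase (h : ℝ) :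
    Measurable (fun z : Heis × ℝ => phase h z.1 z.2) := by
  have hp := Heis.measurable_p
  have hq := Heis.measurable_q
  have ht := Heis.measurable_t
  unfold phase
  fun_prop

theorem memLp_schrodinger (h : ℝ) (x : Heis) (φ : L2R) :
    MemLp (fun y : ℝ => phase h x y * φ (y + h * x.p)) 2 volume := by
  have h1 : MemLp (fun y : ℝ => φ (y + h * x.p)) 2 volume :=
    (Lp.memLp φ).comp_measurePreserving (measurePreserving_add_right volume (h * x.p))
  have hm : Measurable (fun y : ℝ => phase h x y) := by
    unfold phase
    fun_prop
  refine h1.of_le (hm.aestronglyMeasurable.mul h1.1) (Eventually.of_forall fun y => ?_)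
  rw [norm_mul, norm_phase, one_mul]

/-- The Schrödinger representation
`(ρ_h(p,q,t) φ)(y) = exp(2πi h t) exp(2πi q y) exp(πi h p q) φ(y + h p)` on `L²(ℝ)`. -/
def schrodinger (h : ℝ) (x : Heis) : L2R →ₗᵢ[ℂ] L2R where
  toFun φ := (memLp_schrodinger h x φ).toLp _
  map_add' φ ψ := by
    rw [← MemLp.toLp_add]
    refine MemLp.toLp_congr _ _ ?_
    have := (measurePreserving_add_right volume (h * x.p)).quasiMeasurePreserving.ae_eq_comp
      (Lp.coeFn_add φ ψ)
    filter_upwards [this] with y hy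
    simp only [Function.comp_apply, Pi.add_apply] at hy ⊢
    rw [hy, mul_add]
  map_smul' c φ := by
    rw [RingHom.id_apply, ← MemLp.toLp_const_smul]
    refine MemLp.toLp_congr _ _ ?_
    have := (measurePreserving_add_right volume (h * x.p)).quasiMeasurePreserving.ae_eq_comp
      (Lp.coeFn_smul c φ)
    filter_upwards [this] with y hy
    simp only [Function.comp_apply, Pi.smul_apply, smul_eq_mul] at hy ⊢
    rw [hy]; ring
  norm_map' φ := by
    change ‖(memLp_schrodinger h x φ).toLp _‖ = ‖φ‖
    rw [Lp.norm_toLp, Lp.norm_def]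
    congr 1
    rw [← eLpNorm_comp_measurePreserving (Lp.aestronglyMeasurable φ)
      (measurePreserving_add_right volume (h * x.p))]
    refine eLpNorm_congr_norm_ae (Eventually.of_forall fun y => ?_)
    simp [norm_phase]

theorem stronglyMeasurable_schrodinger_coeff (h : ℝ) (ψ φ : L2R) :
    StronglyMeasurable (fun x : Heis => ⟪ψ, schrodinger h x φ⟫_ℂ) := by
  have hrw : (fun x : Heis => ⟪ψ, schrodinger h x φ⟫_ℂ)
      = fun x : Heis => ∫ y : ℝ, ⟪ψ y, phase h x y * φ (y + h * x.p)⟫_ℂ := by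
    funext x
    rw [L2.inner_def]
    refine integral_congr_ae ?_
    filter_upwards [(memLp_schrodinger h x φ).coeFn_toLp] with y hy
    change ⟪ψ y, (memLp_schrodinger h x φ).toLp _ y⟫_ℂ = _
    rw [hy]
  rw [hrw]
  refine StronglyMeasurable.integral_prod_right (f := fun (x : Heis) (y : ℝ) =>
    ⟪ψ y, phase h x y * φ (y + h * x.p)⟫_ℂ) ?_
  refine StronglyMeasurable.inner
    ((Lp.stronglyMeasurable ψ).comp_measurable measurable_snd) ?_
  refine (measurable_phase h).stronglyMeasurable.mul ?_
  refine (Lp.stronglyMeasurable φ).comp_measurable (g := fun z : Heis × ℝ => z.2 + h * z.1.p) ?_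
  have := Heis.measurable_p
  fun_prop

theorem norm_schrodinger_coeff_le (h : ℝ) (x : Heis) (ψ φ : L2R) :
    ‖⟪ψ, schrodinger h x φ⟫_ℂ‖ ≤ ‖ψ‖ * ‖φ‖ := by
  simpa using norm_inner_le_norm (𝕜 := ℂ) ψ (schrodinger h x φ)

theorem integrable_schrodinger_coeff (h : ℝ) {f : Heis → ℂ} (hf : Integrable f) (ψ φ : L2R) :
    Integrable (fun x : Heis => f x * ⟪ψ, schrodinger h x φ⟫_ℂ) :=
  hf.mul_bdd (c := ‖ψ‖ * ‖φ‖) (stronglyMeasurable_schrodinger_coeff h ψ φ).aestronglyMeasurable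
    (Eventually.of_forall fun x => norm_schrodinger_coeff_le h x ψ φ)

/-- The sesquilinear form `(ψ, φ) ↦ ∫ f(x) ⟨ψ, ρ_h(x) φ⟩ dx`. -/
def fourierForm (h : ℝ) (f : Heis → ℂ) (hf : Integrable f) : L2R →L⋆[ℂ] L2R →L[ℂ] ℂ :=
  LinearMap.mkContinuous₂
    (LinearMap.mk₂'ₛₗ (starRingEnd ℂ) (RingHom.id ℂ)
      (fun ψ φ => ∫ x : Heis, f x * ⟪ψ, schrodinger h x φ⟫_ℂ)
      (fun ψ₁ ψ₂ φ => by
        rw [← integral_add (integrable_schrodinger_coeff h hf ψ₁ φ)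
          (integrable_schrodinger_coeff h hf ψ₂ φ)]
        simp only [inner_add_left, mul_add])
      (fun c ψ φ => by
        rw [smul_eq_mul, ← integral_const_mul]
        congr 1; funext x; rw [inner_smul_left]; ring)
      (fun ψ φ₁ φ₂ => by
        rw [← integral_add (integrable_schrodinger_coeff h hf ψ φ₁)
          (integrable_schrodinger_coeff h hf ψ φ₂)]
        simp only [map_add, inner_add_right, mul_add])
      (fun c ψ φ => by
        rw [smul_eq_mul, ← integral_const_mul]
        congr 1; funext x
        rw [map_smul, inner_smul_right, RingHom.id_apply]; ring))
    (∫ x : Heis, ‖f x‖)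
    (fun ψ φ => by
      simp only [LinearMap.mk₂'ₛₗ_apply]
      refine (norm_integral_le_integral_norm _).trans ?_
      rw [mul_assoc, ← integral_mul_const]
      refine integral_mono (integrable_schrodinger_coeff h hf ψ φ).norm
        (hf.norm.mul_const _) fun x => ?_
      simp only [norm_mul]
      exact mul_le_mul_of_nonneg_left (norm_schrodinger_coeff_le h x ψ φ) (norm_nonneg _))

/-- The group Fourier transform `ρ_h(f) = ∫ f(x) ρ_h(x) dx` (weak operator integral) of an
integrable function; see `inner_fourierOp`. -/
def fourierOp (h : ℝ) (f : Heis → ℂ) (hf : Integrable f) : L2R →L[ℂ] L2R :=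
  ContinuousLinearMap.adjoint
    (InnerProductSpace.continuousLinearMapOfBilin (fourierForm h f hf))

theorem inner_fourierOp (h : ℝ) (f : Heis → ℂ) (hf : Integrable f) (ψ φ : L2R) :
    ⟪ψ, fourierOp h f hf φ⟫_ℂ = ∫ x : Heis, f x * ⟪ψ, schrodinger h x φ⟫_ℂ := by
  rw [fourierOp, ContinuousLinearMap.adjoint_inner_right,
    InnerProductSpace.continuousLinearMapOfBilin_apply]
  rfl

/-! ### The Plancherel transform and the field of projections of an invariant subspace -/

/-- An orthonormal basis of `L²(ℝ)` (as a set of vectors). -/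
def basisSet : Set L2R := (exists_hilbertBasis ℂ L2R).choose

/-- The squared Hilbert-Schmidt norm `∑ᵢ ‖T eᵢ‖²` in `[0, ∞]`, for an orthonormal basis `(eᵢ)` of
`L²(ℝ)` (the value does not depend on the basis). -/
def hsNormSq (T : L2R →L[ℂ] L2R) : ℝ≥0∞ := ∑' e : basisSet, ‖T (e : L2R)‖ₑ ^ 2

/-- Measurability (almost everywhere) of a field of bounded operators on `L²(ℝ)`. -/
def MeasurableField (F : ℝ → L2R →L[ℂ] L2R) : Prop :=
  ∀ ψ φ : L2R, AEMeasurable (fun h : ℝ => ⟪ψ, F h φ⟫_ℂ) volume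

/-- `F` is (a representative of) the Plancherel transform of `f ∈ L²(ℍ)`: the Plancherel transform
is the continuous extension of `g ↦ (ρ_h(g))_h` from `L¹ ∩ L²` to `L²(ℍ)`, with values in the
direct integral of the Hilbert-Schmidt operators over `ℝ \ {0}` with the measure `|h| dh`. -/
def IsPlancherelTransform (f : L2H) (F : ℝ → L2R →L[ℂ] L2R) : Prop :=
  MeasurableField F ∧
    ∃ (g : ℕ → L2H) (hg : ∀ n, Integrable (g n) volume),
      Tendsto g atTop (𝓝 f) ∧
      Tendsto (fun n => ∫⁻ h : ℝ, hsNormSq (fourierOp h (g n) (hg n) - F h) * ‖h‖ₑ)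
        atTop (𝓝 0)

/-- The orthogonal projection of `L²(ℍ)` onto a closed subspace. -/
def proj (H : ClosedSubmodule ℂ L2H) : L2H →L[ℂ] L2H :=
  haveI : CompleteSpace H.toSubmodule := H.isClosed.completeSpace_coe
  H.toSubmodule.starProjection

/-- `P` is the field of projections associated with `H`: a measurable field of orthogonal
projections on `L²(ℝ)` such that the orthogonal projection onto `H` acts on the Plancherel
transform side as `F(h) ↦ F(h) ∘ P(h)`. -/
structure IsProjectionField (H : ClosedSubmodule ℂ L2H) (P : ℝ → L2R →L[ℂ] L2R) : Prop where
  measurable : MeasurableField P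
  isProj : ∀ᵐ h : ℝ, IsStarProjection (P h)
  decomp : ∀ (f : L2H) (F : ℝ → L2R →L[ℂ] L2R), IsPlancherelTransform f F →
    IsPlancherelTransform (proj H f) (fun h => F h ∘L P h)

/-- The multiplicity function `m(h) = rank P(h)`, with values in `ℕ ∪ {∞}`. -/
def multiplicity (P : ℝ → L2R →L[ℂ] L2R) (h : ℝ) : ℕ∞ :=
  Cardinal.toENat (P h).toLinearMap.rank

/-- The multiplicity function is bounded (it is defined up to null sets only). -/
def BoundedMultiplicity (P : ℝ → L2R →L[ℂ] L2R) : Prop :=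
  ∃ C : ℕ, ∀ᵐ h : ℝ, multiplicity P h ≤ C

/-- The support `{h : P(h) ≠ 0}` is bounded (it is defined up to null sets only). -/
def Bandlimited (P : ℝ → L2R →L[ℂ] L2R) : Prop :=
  ∃ R : ℝ, ∀ᵐ h : ℝ, P h ≠ 0 → |h| ≤ R

/-! ### Lattices and tight frames -/

/-- A lattice: a discrete subgroup of finite covolume, i.e. with a measurable set of
representatives of the cosets `xΓ` that has finite measure. -/
structure IsLattice (Γ : Subgroup Heis) : Prop where
  discrete : DiscreteTopology Γ
  finite_covolume : ∃ A : Set Heis, MeasurableSet A ∧ (∀ x : Heis, ∃! γ : Γ, x * γ ∈ A) ∧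
    volume A < ∞

/-- `(η i)` is a tight frame of the subspace `K`: its members lie in `K` and the coefficient
operator is isometric on `K` up to a constant. -/
def IsTightFrame {ι E : Type*} [NormedAddCommGroup E] [InnerProductSpace ℂ E]
    (K : Submodule ℂ E) (η : ι → E) : Prop :=
  (∀ i, η i ∈ K) ∧
    ∃ c : ℝ, 0 < c ∧ ∀ f ∈ K, HasSum (fun i => ‖⟪η i, f⟫_ℂ‖ ^ 2) (c * ‖f‖ ^ 2)

end Heisenberg

end

open MeasureTheory Filter Topology
open scoped ENNReal InnerProductSpace

noncomputable section

/-! ### The Fourier transform on `L¹ ∩ L²` -/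

section Fourier

open FourierTransform SchwartzMap
open scoped ContDiff

variable {V : Type*} [NormedAddCommGroup V] [InnerProductSpace ℝ V] [FiniteDimensional ℝ V]
  [MeasurableSpace V] [BorelSpace V]

/-! Everything is carried over to kernels. For `f ∈ L¹ ∩ L²` the operator `∫ f(x) ρ_h(x) dx` is an
integral operator; after normalization by `|h|^{1/2}` and conjugation its kernel is a field `K_f(h,
y) ∈ L²(ℝ)`, and the operator is `φ ↦ |h|^{-1/2} ⟨K_f(h, y), φ⟩`. Plancherel in the variables `(q,
t)` shows that `f ↦ K_f` is isometric, hence extends to an antilinear isometry of `L²(ℍ)` onto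
`L²(ℝ²; L²(ℝ))` (`norm_kernel`, `kernel_surjective`), and any Plancherel transform of `f` is a.e.
the field of operators of `K_f` (`IsPlancherelTransform.ae_eq`). In this picture `λ(p,q,t)`
multiplies by a unimodular phase and shifts `y` to `y + hp` (`kernel_leftReg`), while the projection
onto an invariant subspace `H` acts pointwise, `K ↦ P_h K(h, y)`.

Existence of the field: let `P_h` be the projection onto the closed span of the rows of the kernels
of a dense sequence in `H`. For fixed `p` the coefficient `⟨λ(p,q,t)f, g⟩` is, in `(q, t)`, the
Fourier transform of an overlap of `K_g` with a shift of `K_f`. If `g ⊥ H`, all these overlaps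
vanish, so `P_h K_g = 0`; this identifies `H` with the fields fixed by `P`
(`exists_isProjectionField`).

A tight frame forces bandlimitation: put `Θ(h) = ∫ ‖K_Φ(h, y)‖² dy`. Integrating the frame identity
over a fundamental domain `A` gives `∫ |⟨λ(x)Φ, f⟩|² dx = c vol(A) ‖f‖²` for `f ∈ H`; with the
orthogonality relations this yields `c vol(A) |h| ≤ Θ(h)` wherever `P_h ≠ 0` (`ae_lower_bound`). On
the other hand a lattice contains a central element `(0, 0, α)` with `α > 0`, and its powers produce
Fourier coefficients with respect to `h` of period `1/α`. Applied to frequency cut-offs of `Φ`, the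
frame identity and Parseval give `Θ ≤ αc` a.e. (`ae_upper_bound`). Hence `|h| ≤ α / vol(A)` on the
support.

Conversely, let `P` live on `|h| ≤ R` with rank at most `C`. Choose measurable vectors `e_0(h), …,
e_{C-1}(h)` whose nonzero members are an orthonormal basis of the range of `P_h`, and place `e_j(h)`
on the interval `j|h| < y ≤ (j+1)|h|`. This step kernel lives in a rectangle of sides `2N` and `N`
once `N` exceeds `R` and `CR`. For the lattice of all `(k, l/N, m/(2N))`, the sum over `l, m` is
Parseval on that rectangle, and the shifts `y + hk` meet each `e_j(h)` exactly once, so the sum over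
`k` is Parseval in the fibre (`tsum_coeff_standardLattice`). -/

theorem integral_fourier_mul_schwartz {f : V → ℂ} (hf : Integrable f) (φ : 𝓢(V, ℂ)) :
    ∫ w, φ w • 𝓕 f w = ∫ x, (𝓕 φ) x • f x := by
  have := VectorFourier.integral_fourierIntegral_smul_eq_flip (μ := (volume : Measure V))
    (ν := (volume : Measure V)) (L := innerₗ V) Real.continuous_fourierChar
    (by simpa using continuous_inner) φ.integrable hf
  rw [flip_innerₗ] at this
  exact this.symm

theorem ae_eq_zero_of_integral_schwartz {f : V → ℂ} (hf : LocallyIntegrable f)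
    (h : ∀ φ : 𝓢(V, ℂ), ∫ x, φ x • f x = 0) : f =ᵐ[volume] 0 := by
  refine ae_eq_zero_of_integral_contDiff_smul_eq_zero hf fun g hg hc => ?_
  have h₂ : HasCompactSupport (fun x => (g x : ℂ)) := hc.comp_left (g := fun r : ℝ => (r : ℂ)) rfl
  have h₃ : ContDiff ℝ ∞ (fun x => (g x : ℂ)) := Complex.ofRealCLM.contDiff.comp hg
  simpa using h (h₂.toSchwartzMap h₃)

/-- The Fourier transform is injective on integrable functions. -/
theorem ae_eq_zero_of_fourier_eq_zero {f : V → ℂ} (hf : Integrable f) (h : ∀ w, 𝓕 f w = 0) :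
    f =ᵐ[volume] 0 := by
  refine ae_eq_zero_of_integral_schwartz hf.locallyIntegrable fun φ => ?_
  have := integral_fourier_mul_schwartz hf (𝓕⁻ φ)
  rw [fourier_fourierInv_eq] at this
  rw [← this]
  simp [h]

/-- Tested against Schwartz functions, both transforms move onto the test function: the `L²`
transform by its description as a tempered distribution, the integral by the multiplication formula.
-/
theorem coeFn_fourier_toLp {f : V → ℂ} (hf : Integrable f) (hf₂ : MemLp f 2) :
    (𝓕 (hf₂.toLp f) : Lp ℂ 2 (volume : Measure V)) =ᵐ[volume] 𝓕 f := by
  have hc : Continuous (𝓕 f) := VectorFourier.fourierIntegral_continuous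
    Real.continuous_fourierChar (by simpa using continuous_inner) hf
  have hl : LocallyIntegrable (𝓕 (hf₂.toLp f) : Lp ℂ 2 (volume : Measure V)) :=
    (Lp.memLp _).locallyIntegrable (by norm_num)
  have : (fun x => (𝓕 (hf₂.toLp f) : Lp ℂ 2 (volume : Measure V)) x - 𝓕 f x) =ᵐ[volume] 0 := by
    refine ae_eq_zero_of_integral_schwartz (hl.sub hc.locallyIntegrable) fun φ => ?_
    have h₁ : ∫ x, φ x • (𝓕 (hf₂.toLp f) : Lp ℂ 2 (volume : Measure V)) x
        = ∫ x, (𝓕 φ) x • f x := by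
      rw [← Lp.toTemperedDistribution_apply, ← Lp.fourier_toTemperedDistribution_eq,
        TemperedDistribution.fourier_apply, Lp.toTemperedDistribution_apply]
      refine integral_congr_ae ?_
      filter_upwards [hf₂.coeFn_toLp] with x hx
      rw [hx]
    have i₁ : Integrable fun x => φ x • (𝓕 (hf₂.toLp f) : Lp ℂ 2 (volume : Measure V)) x :=
      MemLp.integrable_mul (p := 2) (q := 2) (φ.memLp 2 volume) (Lp.memLp _)
    have i₂ : Integrable fun x => φ x • 𝓕 f x := by
      refine φ.integrable.mul_bdd (c := ∫ v, ‖f v‖) hc.aestronglyMeasurable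
        (Eventually.of_forall fun w => ?_)
      exact VectorFourier.norm_fourierIntegral_le_integral_norm _ _ _ _ _
    simp only [smul_sub]
    rw [integral_sub i₁ i₂, h₁, integral_fourier_mul_schwartz hf, sub_self]
  filter_upwards [this] with x hx using sub_eq_zero.1 hx

theorem eLpNorm_fourier_eq {f : V → ℂ} (hf : Integrable f) (hf₂ : MemLp f 2) :
    eLpNorm (𝓕 f) 2 volume = eLpNorm f 2 volume := by
  rw [← eLpNorm_congr_ae (coeFn_fourier_toLp hf hf₂), ← eLpNorm_congr_ae hf₂.coeFn_toLp,
    ← Lp.enorm_def, ← Lp.enorm_def, enorm_eq_iff_norm_eq]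
  exact Lp.norm_fourier_eq _

/-- The Fourier transform of a function on the plane. -/
def planeFourier (b : ℝ × ℝ → ℂ) (w : ℝ × ℝ) : ℂ :=
  ∫ z : ℝ × ℝ, Complex.exp (-(2 * Real.pi * (z.1 * w.1 + z.2 * w.2) : ℝ) * Complex.I) * b z

/-- The product `ℝ × ℝ` carries the sup norm, so the Fourier theory of inner product spaces is
reached through the measure-preserving identification with `WithLp 2 (ℝ × ℝ)`. -/
theorem planeFourier_eq (b : ℝ × ℝ → ℂ) (w : ℝ × ℝ) :
    planeFourier b w = 𝓕 (fun z : WithLp 2 (ℝ × ℝ) => b z.ofLp) (WithLp.toLp 2 w) := by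
  rw [Real.fourier_eq', planeFourier,
    ← (WithLp.volume_preserving_ofLp ℝ ℝ).integral_comp (MeasurableEquiv.toLp 2 (ℝ × ℝ)).symm.measurableEmbedding]
  refine integral_congr_ae (Eventually.of_forall fun z => ?_)
  simp only [smul_eq_mul, WithLp.prod_inner_apply]
  congr 2
  simp
  ring

theorem integrable_comp_ofLp {b : ℝ × ℝ → ℂ} (hb : Integrable b) :
    Integrable (fun z : WithLp 2 (ℝ × ℝ) => b z.ofLp) :=
  (WithLp.volume_preserving_ofLp ℝ ℝ).integrable_comp_of_integrable hb

theorem lintegral_planeFourier {b : ℝ × ℝ → ℂ} (hb : Integrable b) (hb₂ : MemLp b 2) :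
    ∫⁻ w, ‖planeFourier b w‖ₑ ^ 2 = ∫⁻ z, ‖b z‖ₑ ^ 2 := by
  have h := eLpNorm_fourier_eq (integrable_comp_ofLp hb)
    (hb₂.comp_measurePreserving (WithLp.volume_preserving_ofLp ℝ ℝ))
  have e : ∀ (g : WithLp 2 (ℝ × ℝ) → ℂ), eLpNorm g 2 volume ^ 2 = ∫⁻ x, ‖g x‖ₑ ^ 2 := by
    intro g
    rw [eLpNorm_eq_lintegral_rpow_enorm_toReal (by norm_num) (by norm_num), ← ENNReal.rpow_natCast,
      ← ENNReal.rpow_mul]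
    simp
  have h2 := congrArg (· ^ 2) h
  simp only [e] at h2
  rw [← (WithLp.volume_preserving_ofLp ℝ ℝ).lintegral_comp_emb
      (MeasurableEquiv.toLp 2 (ℝ × ℝ)).symm.measurableEmbedding,
    ← (WithLp.volume_preserving_ofLp ℝ ℝ).lintegral_comp_emb
      (MeasurableEquiv.toLp 2 (ℝ × ℝ)).symm.measurableEmbedding]
  simp only [planeFourier_eq]
  exact h2

theorem ae_eq_zero_of_planeFourier_eq_zero {b : ℝ × ℝ → ℂ} (hb : Integrable b)
    (h : ∀ w, planeFourier b w = 0) : b =ᵐ[volume] 0 := by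
  have := ae_eq_zero_of_fourier_eq_zero (integrable_comp_ofLp hb) fun w => by
    have := h w.ofLp
    rwa [planeFourier_eq, WithLp.toLp_ofLp] at this
  exact (WithLp.volume_preserving_toLp ℝ ℝ).quasiMeasurePreserving.ae_eq_comp this

/-- Fourier transforms of functions in `L¹ ∩ L²` are total in `L²` of the plane. -/
theorem ae_eq_zero_of_integral_planeFourier_mul {c : ℝ × ℝ → ℂ} (hc : MemLp c 2)
    (h : ∀ b : ℝ × ℝ → ℂ, Continuous b → Integrable b → MemLp b 2 →
      ∫ w, planeFourier b w * c w = 0) : c =ᵐ[volume] 0 := by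
  have hc' := hc.comp_measurePreserving (WithLp.volume_preserving_ofLp ℝ ℝ)
  have : (fun z : WithLp 2 (ℝ × ℝ) => c z.ofLp) =ᵐ[volume] 0 := by
    refine ae_eq_zero_of_integral_schwartz (hc'.locallyIntegrable (by norm_num)) fun φ => ?_
    have mp := WithLp.volume_preserving_toLp ℝ ℝ
    -- As `b` one takes the inverse transform of the test function, so that its transform is the
    -- test function itself.
    have key := h (fun z => (𝓕⁻ φ) (WithLp.toLp 2 z))
      ((𝓕⁻ φ).continuous.comp (WithLp.prod_continuous_toLp 2 ℝ ℝ))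
      (mp.integrable_comp_of_integrable (𝓕⁻ φ).integrable)
      (((𝓕⁻ φ).memLp 2 volume).comp_measurePreserving mp)
    rw [← (WithLp.volume_preserving_ofLp ℝ ℝ).integral_comp
      (MeasurableEquiv.toLp 2 (ℝ × ℝ)).symm.measurableEmbedding] at key
    rw [← key]
    refine integral_congr_ae (Eventually.of_forall fun z => ?_)
    simp only [smul_eq_mul, planeFourier_eq, WithLp.toLp_ofLp]
    congr 1
    change φ z = (𝓕 (𝓕⁻ φ)) z
    rw [fourier_fourierInv_eq]
  exact (WithLp.volume_preserving_toLp ℝ ℝ).quasiMeasurePreserving.ae_eq_comp this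

end Fourier

/-! ### Measurability in separable Hilbert spaces -/

section HilbertMeasurability

open InnerProductSpace

variable {E : Type*} [NormedAddCommGroup E] [InnerProductSpace ℂ E] [CompleteSpace E]

/-- The closed linear span of a sequence. -/
abbrev closedSpan (v : ℕ → E) : Submodule ℂ E := (Submodule.span ℂ (Set.range v)).topologicalClosure

/-- The nonzero vectors of the normalized Gram-Schmidt sequence are a Hilbert basis of the closed
span, and the zero vectors contribute nothing. Linear independence is not needed, so the formula
stays uniform, hence measurable, when the sequence depends on a parameter. -/
theorem hasSum_gramSchmidtNormed (v : ℕ → E) (u : E) :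
    HasSum (fun n => ⟪gramSchmidtNormed ℂ v n, u⟫_ℂ • gramSchmidtNormed ℂ v n)
      ((closedSpan v).starProjection u) := by
  set w := gramSchmidtNormed ℂ v with hw
  have hspan : Submodule.span ℂ (Set.range w) = Submodule.span ℂ (Set.range v) := by
    rw [hw, span_gramSchmidtNormed_range, span_gramSchmidt]
  have hmem : ∀ n, w n ∈ closedSpan v := fun n =>
    Submodule.le_topologicalClosure _ (hspan ▸ Submodule.subset_span ⟨n, rfl⟩)
  let b' : {n | w n ≠ 0} → closedSpan v := fun n => ⟨w n, hmem n⟩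
  have hb' : Orthonormal ℂ b' := by
    have := gramSchmidtNormed_orthonormal' (𝕜 := ℂ) v
    exact ⟨fun i => this.1 i, fun i j hij => this.2 hij⟩
  have hbot : (Submodule.span ℂ (Set.range b'))ᗮ = ⊥ := by
    rw [Submodule.eq_bot_iff]
    intro x hx
    have hx' : ∀ n, ⟪w n, (x : E)⟫_ℂ = 0 := by
      intro n
      by_cases hn : w n = 0
      · simp [hn]
      · exact (Submodule.mem_orthogonal _ x).1 hx (b' ⟨n, hn⟩) (Submodule.subset_span ⟨_, rfl⟩)
    have h1 : (x : E) ∈ (Submodule.span ℂ (Set.range w))ᗮ := by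
      rw [Submodule.mem_orthogonal]
      intro z hz
      induction hz using Submodule.span_induction with
      | mem z hz => obtain ⟨n, rfl⟩ := hz; exact hx' n
      | zero => simp
      | add a b _ _ ha hb => rw [inner_add_left, ha, hb, add_zero]
      | smul c a _ ha => rw [inner_smul_left, ha, mul_zero]
    rw [hspan, ← Submodule.orthogonal_closure] at h1
    have := (Submodule.mem_orthogonal _ _).1 h1 x x.2
    rw [inner_self_eq_zero] at this
    exact Subtype.ext this
  let b : HilbertBasis {n | w n ≠ 0} ℂ (closedSpan v) := HilbertBasis.mkOfOrthogonalEqBot hb' hbot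
  have hb : ∀ n, (b n : E) = w n := fun n => by
    simp [b, HilbertBasis.coe_mkOfOrthogonalEqBot, b']
  have key := (closedSpan v).subtypeL.hasSum (b.hasSum_orthogonalProjectionOnto u)
  have key2 : HasSum ((fun n => ⟪w n, u⟫_ℂ • w n) ∘ ((↑) : {n | w n ≠ 0} → ℕ))
      ((closedSpan v).starProjection u) := by
    refine key.congr_fun ?_
    intro n
    simp [hb]
  rwa [hasSum_subtype_iff_of_support_subset] at key2
  intro n hn
  simp only [Function.mem_support] at hn
  intro h0
  exact hn (by rw [h0, smul_zero])

theorem hasSum_sq_gramSchmidtNormed (v : ℕ → E) (u : E) :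
    HasSum (fun n => ‖⟪gramSchmidtNormed ℂ v n, u⟫_ℂ‖ ^ 2)
      (‖(closedSpan v).starProjection u‖ ^ 2) := by
  have h := Complex.reCLM.hasSum ((innerSL ℂ u).hasSum (hasSum_gramSchmidtNormed v u))
  have e : Complex.reCLM (innerSL ℂ u ((closedSpan v).starProjection u))
      = ‖(closedSpan v).starProjection u‖ ^ 2 := by
    change _ = ‖(closedSpan v).orthogonalProjectionOnto u‖ ^ 2
    rw [← (closedSpan v).re_inner_starProjection_eq_normSq u]
    simp only [innerSL_apply_apply, Complex.reCLM_apply]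
    rw [← inner_conj_symm, Complex.conj_re]
    rfl
  rw [e] at h
  refine h.congr_fun fun n => ?_
  simp only [innerSL_apply_apply, inner_smul_right, Complex.reCLM_apply]
  rw [← inner_conj_symm u, Complex.mul_conj, Complex.ofReal_re, Complex.normSq_eq_norm_sq]

theorem starProjection_closedSpan_denseSeq [TopologicalSpace.SeparableSpace E] (u : E) :
    (closedSpan (TopologicalSpace.denseSeq E)).starProjection u = u := by
  have : closedSpan (TopologicalSpace.denseSeq E) = ⊤ := by
    rw [← Submodule.dense_iff_topologicalClosure_eq_top]
    exact (TopologicalSpace.denseRange_denseSeq E).mono Submodule.subset_span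
  exact Submodule.starProjection_eq_self_iff.2 (this ▸ Submodule.mem_top)

variable {X : Type*} [MeasurableSpace X] {μ : Measure X}

/-- A weakly measurable function with values in a separable Hilbert space is strongly
measurable. -/
theorem aestronglyMeasurable_of_inner [TopologicalSpace.SeparableSpace E] {g : X → E}
    (h : ∀ v : E, AEMeasurable (fun x => ⟪v, g x⟫_ℂ) μ) : AEStronglyMeasurable g μ := by
  set d := TopologicalSpace.denseSeq E
  refine aestronglyMeasurable_of_tendsto_ae (u := atTop) (f := fun (N : ℕ) x =>
    ∑ n ∈ Finset.range N, ⟪gramSchmidtNormed ℂ d n, g x⟫_ℂ • gramSchmidtNormed ℂ d n) ?_ ?_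
  · intro N
    refine Finset.aestronglyMeasurable_fun_sum _ fun n _ => ?_
    exact (h _).aestronglyMeasurable.smul_const _
  · refine Eventually.of_forall fun x => ?_
    have := (hasSum_gramSchmidtNormed d (g x)).tendsto_sum_nat
    rwa [starProjection_closedSpan_denseSeq] at this

/-- The Gram-Schmidt recursion is an algebraic formula in inner products and norms. Where an earlier
vector vanishes, the convention `x / 0 = 0` keeps the formula valid. -/
theorem stronglyMeasurable_gramSchmidtNormed {v : ℕ → X → E} (hv : ∀ n, StronglyMeasurable (v n))
    (n : ℕ) : StronglyMeasurable (fun x => gramSchmidtNormed ℂ (fun k => v k x) n) := by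
  have key : ∀ n, StronglyMeasurable (fun x => gramSchmidt ℂ (fun k => v k x) n) := by
    intro n
    induction n using Nat.strong_induction_on with
    | _ n ih =>
      have e : (fun x => gramSchmidt ℂ (fun k => v k x) n) = fun x => v n x -
          ∑ i ∈ Finset.Iio n, (⟪gramSchmidt ℂ (fun k => v k x) i, v n x⟫_ℂ /
            (‖gramSchmidt ℂ (fun k => v k x) i‖ : ℂ) ^ 2) • gramSchmidt ℂ (fun k => v k x) i := by
        funext x
        rw [gramSchmidt_def]
        simp only [Submodule.starProjection_singleton]
        norm_cast
      rw [e]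
      refine (hv n).sub (Finset.stronglyMeasurable_fun_sum _ fun i hi => ?_)
      have hi := ih i (Finset.mem_Iio.1 hi)
      refine StronglyMeasurable.smul ?_ hi
      exact (hi.inner (hv n)).div
        ((Complex.continuous_ofReal.comp_stronglyMeasurable hi.norm).pow 2)
  unfold gramSchmidtNormed
  exact (Complex.continuous_ofReal.comp_stronglyMeasurable (key n).norm).inv₀.smul (key n)

/-- Applying a weakly measurable field of operators to a measurable field of vectors. -/
theorem aestronglyMeasurable_field_apply [TopologicalSpace.SeparableSpace E]
    {F : X → E →L[ℂ] E} (hF : ∀ ψ φ, AEMeasurable (fun x => ⟪ψ, F x φ⟫_ℂ) μ)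
    {g : X → E} (hg : AEStronglyMeasurable g μ) : AEStronglyMeasurable (fun x => F x (g x)) μ := by
  set d := TopologicalSpace.denseSeq E
  -- Expanding `g x` in a fixed basis leaves only `F x` on constant vectors, where weak
  -- measurability of the field is enough.
  refine aestronglyMeasurable_of_tendsto_ae (u := atTop) (f := fun (N : ℕ) x =>
    ∑ n ∈ Finset.range N, ⟪gramSchmidtNormed ℂ d n, g x⟫_ℂ • F x (gramSchmidtNormed ℂ d n)) ?_ ?_
  · intro N
    refine Finset.aestronglyMeasurable_fun_sum _ fun n _ => ?_
    exact (aestronglyMeasurable_const.inner hg).smul (aestronglyMeasurable_of_inner fun v => hF v _)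
  · refine Eventually.of_forall fun x => ?_
    have := (hasSum_gramSchmidtNormed d (g x)).tendsto_sum_nat
    rw [starProjection_closedSpan_denseSeq] at this
    have h2 := ((F x).continuous.tendsto _).comp this
    simpa [Function.comp_def] using h2

/-- Orthonormal vectors have distance `√2`, so their balls of radius `1/2` are disjoint. -/
theorem Orthonormal.countable_set [TopologicalSpace.SeparableSpace E] {s : Set E}
    (hs : Orthonormal ℂ ((↑) : s → E)) : s.Countable := by
  refine Set.PairwiseDisjoint.countable_of_isOpen (s := fun x => Metric.ball x (1 / 2)) ?_
    (fun _ _ => Metric.isOpen_ball) fun x _ => ⟨x, Metric.mem_ball_self (by norm_num)⟩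
  intro x hx y hy hxy
  refine Metric.ball_disjoint_ball ?_
  have h0 : ⟪x, y⟫_ℂ = 0 := hs.2 (i := ⟨x, hx⟩) (j := ⟨y, hy⟩) (by simpa using hxy)
  have hx1 : ‖x‖ = 1 := hs.1 ⟨x, hx⟩
  have hy1 : ‖y‖ = 1 := hs.1 ⟨y, hy⟩
  have h2 := norm_sub_sq (𝕜 := ℂ) x y
  rw [h0, hx1, hy1] at h2
  rw [dist_eq_norm]
  norm_num at h2 ⊢
  nlinarith [norm_nonneg (x - y)]

end HilbertMeasurability

namespace Heisenberg

instance : Fact ((2 : ℝ≥0∞) ≠ ∞) := ⟨by norm_num⟩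

instance : SecondCountableTopology L2R := inferInstance

/-! ### Square-integrable functions with values in `L²(ℝ)` -/

section Slices

theorem memLp_two_iff {X E : Type*} [MeasurableSpace X] {μ : Measure X} [NormedAddCommGroup E]
    {f : X → E} : MemLp f 2 μ ↔ AEStronglyMeasurable f μ ∧ ∫⁻ x, ‖f x‖ₑ ^ 2 ∂μ < ∞ := by
  rw [MemLp, eLpNorm_lt_top_iff_lintegral_rpow_enorm_lt_top (by norm_num) (by norm_num)]
  simp

theorem eLpNorm_two_sq {X E : Type*} [MeasurableSpace X] {μ : Measure X} [NormedAddCommGroup E]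
    (f : X → E) : eLpNorm f 2 μ ^ 2 = ∫⁻ x, ‖f x‖ₑ ^ 2 ∂μ := by
  rw [eLpNorm_eq_lintegral_rpow_enorm_toReal (by norm_num) (by norm_num), ← ENNReal.rpow_natCast,
    ← ENNReal.rpow_mul]
  simp

theorem enorm_sq_eq_lintegral {X E : Type*} [MeasurableSpace X] {μ : Measure X}
    [NormedAddCommGroup E] (f : Lp E 2 μ) : ‖f‖ₑ ^ 2 = ∫⁻ x, ‖f x‖ₑ ^ 2 ∂μ := by
  rw [Lp.enorm_def, eLpNorm_two_sq]

theorem enorm_toLp_sq {X E : Type*} [MeasurableSpace X] {μ : Measure X}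
    [NormedAddCommGroup E] {f : X → E} (hf : MemLp f 2 μ) :
    ‖hf.toLp f‖ₑ ^ 2 = ∫⁻ x, ‖f x‖ₑ ^ 2 ∂μ := by
  rw [Lp.enorm_toLp, eLpNorm_two_sq]

variable {X Y : Type*} [MeasurableSpace X] {μ : Measure X} [MeasurableSpace Y]
  {ν : Measure Y} [SFinite ν] [SFinite μ]

theorem ae_memLp_slice {E : Type*} [NormedAddCommGroup E] {κ : X × Y → E}
    (h : MemLp κ 2 (μ.prod ν)) : ∀ᵐ x ∂μ, MemLp (fun y => κ (x, y)) 2 ν := by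
  have h2 := (memLp_two_iff.1 h).2
  rw [lintegral_prod _ (h.1.enorm.pow_const 2)] at h2
  filter_upwards [h.1.prodMk_left, ae_lt_top' (h.1.enorm.pow_const 2).lintegral_prod_right' h2.ne]
    with x h1 h2
  exact memLp_two_iff.2 ⟨h1, h2⟩

open Classical in
/-- The slice `κ(x, ·)` of a function of two variables, as an element of `L²(ℝ)`. -/
def slice (κ : X × ℝ → ℂ) (x : X) : L2R :=
  if h : MemLp (fun y => κ (x, y)) 2 volume then h.toLp _ else 0

theorem slice_eq {κ : X × ℝ → ℂ} {x : X} (h : MemLp (fun y => κ (x, y)) 2 volume) :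
    slice κ x = h.toLp _ := dif_pos h

theorem aestronglyMeasurable_slice {κ : X × ℝ → ℂ} (hκ : AEStronglyMeasurable κ (μ.prod volume))
    (h : ∀ᵐ x ∂μ, MemLp (fun y => κ (x, y)) 2 volume) :
    AEStronglyMeasurable (slice κ) μ := by
  refine aestronglyMeasurable_of_inner fun v => ?_
  have hm : AEStronglyMeasurable (fun z : X × ℝ => ⟪v z.2, κ z⟫_ℂ) (μ.prod volume) :=
    (Lp.aestronglyMeasurable v).comp_snd.inner hκ
  refine hm.integral_prod_right'.aemeasurable.congr ?_
  filter_upwards [h] with x hx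
  rw [slice_eq hx, L2.inner_def]
  refine integral_congr_ae ?_
  filter_upwards [hx.coeFn_toLp] with y hy
  rw [hy]

theorem lintegral_slice {κ : X × ℝ → ℂ} (h : MemLp κ 2 (μ.prod volume)) :
    ∫⁻ x, ‖slice κ x‖ₑ ^ 2 ∂μ = ∫⁻ z, ‖κ z‖ₑ ^ 2 ∂(μ.prod volume) := by
  rw [lintegral_prod _ (h.1.enorm.pow_const 2)]
  refine lintegral_congr_ae ?_
  filter_upwards [ae_memLp_slice h] with x hx
  rw [slice_eq hx, enorm_toLp_sq]

theorem memLp_slice {κ : X × ℝ → ℂ} (h : MemLp κ 2 (μ.prod volume)) : MemLp (slice κ) 2 μ :=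
  memLp_two_iff.2 ⟨aestronglyMeasurable_slice h.1 (ae_memLp_slice h), by
    rw [lintegral_slice h]; exact (memLp_two_iff.1 h).2⟩

end Slices

/-! ### Hilbert-Schmidt operators given by kernels -/

section KernelOp

open Classical in
/-- The operator `φ ↦ (y ↦ ⟨k(y), φ⟩)` on `L²(ℝ)`, for square-integrable `k : ℝ → L²(ℝ)`. -/
def kernelOp (k : ℝ → L2R) : L2R →L[ℂ] L2R :=
  if hk : MemLp k 2 volume then
    LinearMap.mkContinuous
      { toFun := fun φ => (hk.inner_const (𝕜 := ℂ) φ).toLp _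
        map_add' := fun φ ψ => by
          rw [← MemLp.toLp_add]
          exact MemLp.toLp_congr _ _ (Eventually.of_forall fun y => inner_add_right _ _ _)
        map_smul' := fun c φ => by
          rw [RingHom.id_apply, ← MemLp.toLp_const_smul]
          exact MemLp.toLp_congr _ _ (Eventually.of_forall fun y => inner_smul_right _ _ _) }
      ‖hk.toLp k‖ (fun φ => by
        rw [mul_comm]
        refine Lp.norm_le_mul_norm_of_ae_le_mul ?_
        filter_upwards [(hk.inner_const (𝕜 := ℂ) φ).coeFn_toLp, hk.coeFn_toLp] with y h1 h2
        change ‖(hk.inner_const (𝕜 := ℂ) φ).toLp _ y‖ ≤ _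
        rw [h1, h2, mul_comm]
        exact norm_inner_le_norm _ _)
  else 0

theorem coeFn_kernelOp {k : ℝ → L2R} (hk : MemLp k 2 volume) (φ : L2R) :
    kernelOp k φ =ᵐ[volume] fun y => ⟪k y, φ⟫_ℂ := by
  rw [kernelOp, dif_pos hk]
  exact (hk.inner_const (𝕜 := ℂ) φ).coeFn_toLp

theorem kernelOp_eq_of_ae {k : ℝ → L2R} (hk : MemLp k 2 volume) {T : L2R →L[ℂ] L2R}
    (h : ∀ φ, T φ =ᵐ[volume] fun y => ⟪k y, φ⟫_ℂ) : T = kernelOp k := by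
  ext1 φ
  exact Lp.ext ((h φ).trans (coeFn_kernelOp hk φ).symm)

theorem kernelOp_congr {k k' : ℝ → L2R} (h : k =ᵐ[volume] k') : kernelOp k = kernelOp k' := by
  by_cases hk : MemLp k 2 volume
  · refine kernelOp_eq_of_ae (hk.ae_eq h) fun φ => ?_
    filter_upwards [coeFn_kernelOp hk φ, h] with y h1 h2
    rw [h1, h2]
  · have hk' : ¬ MemLp k' 2 volume := fun h' => hk (h'.ae_eq h.symm)
    rw [kernelOp, kernelOp, dif_neg hk, dif_neg hk']

theorem kernelOp_sub {k k' : ℝ → L2R} (hk : MemLp k 2 volume) (hk' : MemLp k' 2 volume) :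
    kernelOp k - kernelOp k' = kernelOp (k - k') := by
  refine kernelOp_eq_of_ae (hk.sub hk') fun φ => ?_
  rw [_root_.sub_apply]
  filter_upwards [coeFn_kernelOp hk φ, coeFn_kernelOp hk' φ,
    Lp.coeFn_sub (kernelOp k φ) (kernelOp k' φ)] with y h1 h2 h3
  rw [h3, Pi.sub_apply, h1, h2, Pi.sub_apply, inner_sub_left]

theorem memLp_comp_clm {k : ℝ → L2R} (hk : MemLp k 2 volume) (P : L2R →L[ℂ] L2R) :
    MemLp (fun y => P (k y)) 2 volume := P.comp_memLp' hk

/-- A self-adjoint operator moves to the other slot of `⟨k y, P φ⟩`: composition on the right acts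
row by row. This makes `f̂(h) ∘ P_h` a pointwise operation on kernels. -/
theorem kernelOp_comp {k : ℝ → L2R} (hk : MemLp k 2 volume) {P : L2R →L[ℂ] L2R}
    (hP : IsSelfAdjoint P) : kernelOp k ∘L P = kernelOp (fun y => P (k y)) := by
  refine kernelOp_eq_of_ae (memLp_comp_clm hk P) fun φ => ?_
  rw [ContinuousLinearMap.comp_apply]
  filter_upwards [coeFn_kernelOp hk (P φ)] with y hy
  rw [hy, ← ContinuousLinearMap.adjoint_inner_left, hP.adjoint_eq]

/-- The kernel of `ρ_h(x) ∘ T`. -/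
theorem memLp_schrodinger_kernel (h : ℝ) (x : Heis) {k : ℝ → L2R} (hk : MemLp k 2 volume) :
    MemLp (fun y => (starRingEnd ℂ) (phase h x y) • k (y + h * x.p)) 2 volume := by
  have h1 : MemLp (fun y => k (y + h * x.p)) 2 volume :=
    hk.comp_measurePreserving (measurePreserving_add_right volume (h * x.p))
  have hm : Measurable (fun y : ℝ => (starRingEnd ℂ) (phase h x y)) := by
    refine Complex.continuous_conj.measurable.comp ?_
    unfold phase
    fun_prop
  refine h1.of_le (hm.aestronglyMeasurable.smul h1.1) (Eventually.of_forall fun y => ?_)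
  rw [norm_smul, RCLike.norm_conj, norm_phase, one_mul]

theorem schrodinger_comp_kernelOp (h : ℝ) (x : Heis) {k : ℝ → L2R} (hk : MemLp k 2 volume) :
    (schrodinger h x).toContinuousLinearMap ∘L kernelOp k
      = kernelOp (fun y => (starRingEnd ℂ) (phase h x y) • k (y + h * x.p)) := by
  refine kernelOp_eq_of_ae (memLp_schrodinger_kernel h x hk) fun φ => ?_
  have h1 := (memLp_schrodinger h x (kernelOp k φ)).coeFn_toLp
  have h2 := (measurePreserving_add_right volume (h * x.p)).quasiMeasurePreserving.ae_eq_comp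
      (coeFn_kernelOp hk φ)
  filter_upwards [h1, h2] with y h1 h2
  refine h1.trans ?_
  simp only [Function.comp_apply] at h2
  rw [h2, inner_smul_left, Complex.conj_conj]

theorem exists_basis : ∃ b : HilbertBasis basisSet ℂ L2R, ⇑b = ((↑) : basisSet → L2R) :=
  (exists_hilbertBasis ℂ L2R).choose_spec

instance : Countable basisSet := by
  obtain ⟨b, hb⟩ := exists_basis
  exact (Orthonormal.countable_set (hb ▸ b.orthonormal)).to_subtype

theorem tsum_enorm_inner_basis (v : L2R) :
    ∑' e : basisSet, ‖⟪v, (e : L2R)⟫_ℂ‖ₑ ^ 2 = ‖v‖ₑ ^ 2 := by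
  obtain ⟨b, hb⟩ := exists_basis
  have h := b.hasSum_inner_mul_inner v v
  rw [hb] at h
  have h2 := Complex.reCLM.hasSum h
  have h3 : HasSum (fun e : basisSet => ‖⟪v, (e : L2R)⟫_ℂ‖ ^ 2) (‖v‖ ^ 2) := by
    convert h2 using 1
    · funext e
      simp only [Complex.reCLM_apply]
      rw [← inner_conj_symm (e : L2R) v, Complex.mul_conj, Complex.ofReal_re,
        Complex.normSq_eq_norm_sq]
    · exact (inner_self_eq_norm_sq (𝕜 := ℂ) v).symm
  have h4 := ENNReal.ofReal_tsum_of_nonneg (fun e => by positivity) h3.summable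
  rw [h3.tsum_eq] at h4
  rw [← ofReal_norm, ← ENNReal.ofReal_pow (norm_nonneg _), h4]
  refine tsum_congr fun e => ?_
  rw [← ofReal_norm, ← ENNReal.ofReal_pow (norm_nonneg _)]

/-- Tonelli, and then Parseval for each row `k y`. -/
theorem hsNormSq_kernelOp {k : ℝ → L2R} (hk : MemLp k 2 volume) :
    hsNormSq (kernelOp k) = ∫⁻ y, ‖k y‖ₑ ^ 2 := by
  have h1 : ∀ e : basisSet, ‖kernelOp k e‖ₑ ^ 2 = ∫⁻ y, ‖⟪k y, (e : L2R)⟫_ℂ‖ₑ ^ 2 := by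
    intro e
    rw [enorm_sq_eq_lintegral]
    refine lintegral_congr_ae ?_
    filter_upwards [coeFn_kernelOp hk (e : L2R)] with y hy
    rw [hy]
  rw [hsNormSq]
  simp_rw [h1]
  rw [← lintegral_tsum fun e =>
    ((hk.1.inner aestronglyMeasurable_const).enorm.pow_const 2)]
  simp_rw [tsum_enorm_inner_basis]

theorem hsNormSq_smul (c : ℂ) (T : L2R →L[ℂ] L2R) :
    hsNormSq (c • T) = ‖c‖ₑ ^ 2 * hsNormSq T := by
  simp only [hsNormSq, _root_.smul_apply, enorm_smul, mul_pow, ENNReal.tsum_mul_left]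

/-- A substitute for the triangle inequality that needs no square roots; it suffices for passing to
limits. -/
theorem hsNormSq_add_le (S T : L2R →L[ℂ] L2R) :
    hsNormSq (S + T) ≤ 2 * hsNormSq S + 2 * hsNormSq T := by
  simp only [hsNormSq, _root_.add_apply]
  rw [← ENNReal.tsum_mul_left, ← ENNReal.tsum_mul_left, ← ENNReal.tsum_add]
  refine ENNReal.tsum_le_tsum fun e => ?_
  have h2 : ∀ a b : ℝ≥0∞, 2 * a + 2 * b = ENNReal.ofReal 2 * a + ENNReal.ofReal 2 * b := by
    simp
  rw [← ofReal_norm, ← ofReal_norm, ← ofReal_norm, ← ENNReal.ofReal_pow (norm_nonneg _),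
    ← ENNReal.ofReal_pow (norm_nonneg _), ← ENNReal.ofReal_pow (norm_nonneg _), h2,
    ← ENNReal.ofReal_mul (by norm_num), ← ENNReal.ofReal_mul (by norm_num),
    ← ENNReal.ofReal_add (by positivity) (by positivity)]
  refine ENNReal.ofReal_le_ofReal ?_
  have := norm_add_le (S (e : L2R)) (T e)
  nlinarith [sq_nonneg (‖S (e : L2R)‖ - ‖T (e : L2R)‖), norm_nonneg (S (e : L2R) + T e)]

theorem eq_zero_of_hsNormSq {T : L2R →L[ℂ] L2R} (h : hsNormSq T = 0) : T = 0 := by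
  obtain ⟨b, hb⟩ := exists_basis
  have h0 : ∀ e : basisSet, T e = 0 := fun e => by
    have := ENNReal.tsum_eq_zero.1 h e
    simpa using this
  refine ContinuousLinearMap.ext_on (s := Set.range b) ?_ ?_
  · rw [Submodule.dense_iff_topologicalClosure_eq_top]; exact b.dense_span
  · rintro _ ⟨e, rfl⟩
    rw [hb]
    simpa using h0 e

end KernelOp

/-! ### Fields of operators given by kernels -/

section OpField

/-- The field of operators `h ↦ (φ ↦ (y ↦ |h|^{-1/2} ⟨K(h, y), φ⟩))`. -/
def opField (K : ℝ × ℝ → L2R) (h : ℝ) : L2R →L[ℂ] L2R :=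
  (((Real.sqrt |h|)⁻¹ : ℝ) : ℂ) • kernelOp (fun y => K (h, y))

theorem opField_congr {K K' : ℝ × ℝ → L2R} (h : K =ᵐ[volume] K') :
    ∀ᵐ r : ℝ, opField K r = opField K' r := by
  have := Measure.ae_ae_of_ae_prod h
  filter_upwards [this] with r hr
  rw [opField, opField, kernelOp_congr hr]

/-- The square of the factor `|h|^{-1/2}` cancels the Plancherel weight `|h|`, so that kernels live
in an unweighted `L²` space. -/
theorem hsNormSq_opField {K : ℝ × ℝ → L2R} {h : ℝ} (hK : MemLp (fun y => K (h, y)) 2 volume)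
    (h0 : h ≠ 0) : hsNormSq (opField K h) * ‖h‖ₑ = ∫⁻ y, ‖K (h, y)‖ₑ ^ 2 := by
  rw [opField, hsNormSq_smul, hsNormSq_kernelOp hK, mul_right_comm]
  have : ‖(((Real.sqrt |h|)⁻¹ : ℝ) : ℂ)‖ₑ ^ 2 * ‖h‖ₑ = 1 := by
    rw [← ofReal_norm, ← ofReal_norm, ← ENNReal.ofReal_pow (norm_nonneg _),
      ← ENNReal.ofReal_mul (by positivity), Complex.norm_real, Real.norm_eq_abs, sq_abs, inv_pow,
      Real.sq_sqrt (abs_nonneg _), Real.norm_eq_abs, inv_mul_cancel₀ (abs_ne_zero.2 h0),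
      ENNReal.ofReal_one]
  rw [this, one_mul]

theorem ae_ne_zero : ∀ᵐ h : ℝ, h ≠ 0 := by
  simp [ae_iff]

theorem lintegral_hsNormSq_opField {K : ℝ × ℝ → L2R} (hK : MemLp K 2 volume) :
    ∫⁻ h, hsNormSq (opField K h) * ‖h‖ₑ = ∫⁻ z, ‖K z‖ₑ ^ 2 := by
  rw [Measure.volume_eq_prod, lintegral_prod _ (by
    rw [← Measure.volume_eq_prod]; exact hK.1.enorm.pow_const 2)]
  refine lintegral_congr_ae ?_
  filter_upwards [ae_memLp_slice hK, ae_ne_zero] with h h1 h2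
  exact hsNormSq_opField h1 h2

theorem opField_sub {K K' : ℝ × ℝ → L2R} (hK : MemLp K 2 volume) (hK' : MemLp K' 2 volume) :
    ∀ᵐ h : ℝ, opField K h - opField K' h = opField (K - K') h := by
  filter_upwards [ae_memLp_slice hK, ae_memLp_slice hK'] with h h1 h2
  rw [opField, opField, opField, ← smul_sub, kernelOp_sub h1 h2]
  rfl

theorem measurableField_opField {K : ℝ × ℝ → L2R} (hK : MemLp K 2 volume) :
    MeasurableField (opField K) := by
  intro ψ φ
  have hm : AEStronglyMeasurable (fun z : ℝ × ℝ => ⟪ψ z.2, ⟪K z, φ⟫_ℂ⟫_ℂ)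
      ((volume : Measure ℝ).prod volume) :=
    (Lp.aestronglyMeasurable ψ).comp_snd.inner (hK.1.inner aestronglyMeasurable_const)
  have h1 : AEMeasurable (fun h : ℝ => (((Real.sqrt |h|)⁻¹ : ℝ) : ℂ) *
      ∫ y, ⟪ψ y, ⟪K (h, y), φ⟫_ℂ⟫_ℂ) volume := by
    refine AEMeasurable.mul ?_ hm.integral_prod_right'.aemeasurable
    refine Measurable.aemeasurable ?_
    fun_prop
  refine h1.congr ?_
  filter_upwards [ae_memLp_slice hK] with h hh
  rw [opField, _root_.smul_apply, inner_smul_right, L2.inner_def]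
  congr 1
  refine integral_congr_ae ?_
  filter_upwards [coeFn_kernelOp hh φ] with y hy
  rw [hy]

theorem MeasurableField.sub {F G : ℝ → L2R →L[ℂ] L2R} (hF : MeasurableField F)
    (hG : MeasurableField G) : MeasurableField (fun h => F h - G h) := by
  intro ψ φ
  simp only [_root_.sub_apply, inner_sub_right]
  exact (hF ψ φ).sub (hG ψ φ)

theorem MeasurableField.congr {F G : ℝ → L2R →L[ℂ] L2R} (hF : MeasurableField F)
    (h : F =ᵐ[volume] G) : MeasurableField G := fun ψ φ =>
  (hF ψ φ).congr (by filter_upwards [h] with r hr; rw [hr])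

theorem MeasurableField.aemeasurable_hsNormSq {F : ℝ → L2R →L[ℂ] L2R} (hF : MeasurableField F) :
    AEMeasurable (fun h => hsNormSq (F h) * ‖h‖ₑ) volume := by
  refine AEMeasurable.mul (AEMeasurable.tsum fun e => ?_) measurable_enorm.aemeasurable
  exact (aestronglyMeasurable_of_inner fun v => hF v _).enorm.pow_const 2

/-- A field of kernels is determined by its field of operators. -/
theorem ae_eq_of_opField_eq {K K' : ℝ × ℝ → L2R} (hK : MemLp K 2 volume)
    (hK' : MemLp K' 2 volume) (h : ∀ᵐ r : ℝ, opField K r = opField K' r) :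
    K =ᵐ[volume] K' := by
  have h1 := lintegral_hsNormSq_opField (hK.sub hK')
  have h2 : ∫⁻ r, hsNormSq (opField (K - K') r) * ‖r‖ₑ = 0 := by
    rw [lintegral_congr_ae (g := fun _ => 0), lintegral_zero]
    filter_upwards [opField_sub hK hK', h] with r h3 h4
    rw [← h3, h4, sub_self]
    simp [hsNormSq]
  rw [h2] at h1
  have h3 := (lintegral_eq_zero_iff' ((hK.sub hK').1.enorm.pow_const 2)).1 h1.symm
  filter_upwards [h3] with z hz
  have : (K - K') z = 0 := by simpa using hz
  exact sub_eq_zero.1 this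

/-- Applying a measurable field of operators to a field of kernels. -/
theorem aestronglyMeasurable_field_kernel {P : ℝ → L2R →L[ℂ] L2R} (hP : MeasurableField P)
    {K : ℝ × ℝ → L2R} (hK : AEStronglyMeasurable K volume) :
    AEStronglyMeasurable (fun z : ℝ × ℝ => P z.1 (K z)) volume := by
  refine aestronglyMeasurable_field_apply (F := fun z : ℝ × ℝ => P z.1) (fun ψ φ => ?_) hK
  exact (hP ψ φ).comp_quasiMeasurePreserving Measure.quasiMeasurePreserving_fst

theorem memLp_projection_kernel {P : ℝ → L2R →L[ℂ] L2R} (hP : MeasurableField P)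
    (hP' : ∀ᵐ h : ℝ, IsStarProjection (P h)) {K : ℝ × ℝ → L2R} (hK : MemLp K 2 volume) :
    MemLp (fun z : ℝ × ℝ => P z.1 (K z)) 2 volume := by
  refine hK.of_le (aestronglyMeasurable_field_kernel hP hK.1) ?_
  have := (Measure.quasiMeasurePreserving_fst (μ := (volume : Measure ℝ))
    (ν := (volume : Measure ℝ))).ae hP'
  filter_upwards [this] with z hz
  refine ((P z.1).le_opNorm _).trans ?_
  exact mul_le_of_le_one_left (norm_nonneg _) hz.norm_le

theorem opField_comp {P : ℝ → L2R →L[ℂ] L2R} (hP' : ∀ᵐ h : ℝ, IsStarProjection (P h))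
    {K : ℝ × ℝ → L2R} (hK : MemLp K 2 volume) :
    ∀ᵐ h : ℝ, opField K h ∘L P h = opField (fun z => P z.1 (K z)) h := by
  filter_upwards [hP', ae_memLp_slice hK] with h h1 h2
  rw [opField, opField, ContinuousLinearMap.smul_comp, kernelOp_comp h2 h1.isSelfAdjoint]

end OpField

/-! ### The kernel of the group Fourier transform -/

section Kernel

open scoped ComplexConjugate

instance : SigmaFinite (volume : Measure Heis) :=
  inferInstanceAs (SigmaFinite (volume : Measure (ℝ × ℝ × ℝ)))

instance : SecondCountableTopology Heis := inferInstanceAs (SecondCountableTopology (ℝ × ℝ × ℝ))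

theorem Heis.measurePreserving_mk : MeasurePreserving
    (fun z : ℝ × ℝ × ℝ => Heis.mk z.1 z.2.1 z.2.2) volume volume :=
  MeasurePreserving.id (volume : Measure (ℝ × ℝ × ℝ))

theorem Heis.measurableEmbedding_mk : MeasurableEmbedding
    (fun z : ℝ × ℝ × ℝ => Heis.mk z.1 z.2.1 z.2.2) :=
  (MeasurableEmbedding.id : MeasurableEmbedding (id : ℝ × ℝ × ℝ → ℝ × ℝ × ℝ))

theorem lintegral_volume_prod {X Y : Type*} [MeasureSpace X] [MeasureSpace Y]
    [SFinite (volume : Measure Y)] {g : X × Y → ℝ≥0∞} (hg : AEMeasurable g volume) :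
    ∫⁻ z, g z = ∫⁻ x, ∫⁻ y, g (x, y) := lintegral_prod g hg

/-- The substitution `u = y + hp` exchanges the integration variable of the kernel and the group
coordinate `p`; its Jacobian is the source of all powers of `|h|`. -/
theorem lintegral_affine {g : ℝ → ℝ≥0∞} (hg : Measurable g) {h : ℝ} (h0 : h ≠ 0) (y : ℝ) :
    ∫⁻ u, g u = ‖h‖ₑ * ∫⁻ p, g (y + h * p) := by
  have h1 : ∫⁻ u, g u = ∫⁻ u, g (y + u) := (lintegral_add_left_eq_self g y).symm
  have h2 : ∫⁻ u, g (y + u) ∂(ENNReal.ofReal |h| • Measure.map (h * ·) volume)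
      = ‖h‖ₑ * ∫⁻ p, g (y + h * p) := by
    rw [lintegral_smul_measure, lintegral_map (f := fun u => g (y + u))
      (hg.comp (measurable_const_add y)) (measurable_const_mul h), smul_eq_mul,
      ← Real.norm_eq_abs, ofReal_norm]
  rw [Real.smul_map_volume_mul_left h0] at h2
  rw [h1, h2]

theorem integral_affine (g : ℝ → ℂ) {h : ℝ} (h0 : h ≠ 0) (y : ℝ) :
    ∫ u, g u = (|h| : ℝ) * ∫ p, g (y + h * p) := by
  have h1 : ∫ u, g u = ∫ u, g (y + u) := (integral_add_left_eq_self g y).symm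
  have h2 := Measure.integral_comp_mul_left (fun u => g (y + u)) h
  rw [h1, h2, abs_inv, Complex.real_smul, ← mul_assoc, ← Complex.ofReal_mul,
    mul_inv_cancel₀ (abs_ne_zero.2 h0)]
  simp

theorem quasiMeasurePreserving_affine {h : ℝ} (h0 : h ≠ 0) (y : ℝ) :
    Measure.QuasiMeasurePreserving (fun p : ℝ => y + h * p) volume volume := by
  refine ⟨by fun_prop, Measure.AbsolutelyContinuous.mk fun s hs h2 => ?_⟩
  rw [Measure.map_apply (by fun_prop) hs]
  have := lintegral_affine (g := s.indicator 1) (measurable_one.indicator hs) h0 y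
  rw [lintegral_indicator_one hs, h2] at this
  have h3 : ∫⁻ p, s.indicator (1 : ℝ → ℝ≥0∞) (y + h * p)
      = volume ((fun p : ℝ => y + h * p) ⁻¹' s) := by
    rw [← lintegral_indicator_one (hs.preimage (by fun_prop))]
    rfl
  rw [h3] at this
  simpa [h0] using this.symm

theorem memLp_affine {E : Type*} [NormedAddCommGroup E] {g : ℝ → E} (hg : MemLp g 2 volume)
    {h : ℝ} (h0 : h ≠ 0) (y : ℝ) : MemLp (fun p => g (y + h * p)) 2 volume := by
  refine MemLp.ae_eq ((quasiMeasurePreserving_affine h0 y).ae_eq_comp hg.1.ae_eq_mk).symm ?_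
  have hs := hg.1.stronglyMeasurable_mk
  have hg' := hg.ae_eq hg.1.ae_eq_mk
  refine memLp_two_iff.2 ⟨(hs.comp_measurable (by fun_prop)).aestronglyMeasurable, ?_⟩
  have := (memLp_two_iff.1 hg').2
  rw [lintegral_affine (hs.enorm.pow_const 2) h0 y] at this
  exact (ENNReal.mul_lt_top_iff.1 this).elim And.right (by rintro (h | h) <;> simp_all)

/-- The slice `w ↦ conj (f (p, w))`. -/
def dualSlice (f : Heis → ℂ) (p : ℝ) (w : ℝ × ℝ) : ℂ := conj (f (Heis.mk p w.1 w.2))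

/-- The partial Fourier transform of `conj f` in the variables `(q, t)`. -/
def partialFourier (f : Heis → ℂ) (z : ℝ × ℝ × ℝ) : ℂ := planeFourier (dualSlice f z.1) z.2

theorem stronglyMeasurable_partialFourier {f : Heis → ℂ} (hf : StronglyMeasurable f) :
    StronglyMeasurable (partialFourier f) := by
  unfold partialFourier planeFourier
  refine StronglyMeasurable.integral_prod_right (f := fun (z : ℝ × ℝ × ℝ) (w : ℝ × ℝ) =>
    Complex.exp (-(2 * Real.pi * (w.1 * z.2.1 + w.2 * z.2.2) : ℝ) * Complex.I) *
      dualSlice f z.1 w) ?_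
  refine StronglyMeasurable.mul ?_ ?_
  · refine Measurable.stronglyMeasurable ?_
    fun_prop
  · refine Complex.continuous_conj.comp_stronglyMeasurable ?_
    exact hf.comp_measurable (Heis.measurePreserving_mk.measurable.comp
      (g := fun z : ℝ × ℝ × ℝ => Heis.mk z.1 z.2.1 z.2.2)
      (f := fun z : (ℝ × ℝ × ℝ) × (ℝ × ℝ) => (z.1.1, z.2.1, z.2.2)) (by fun_prop))

/-- The kernel of the group Fourier transform, normalized by `|h|^{1/2}` and conjugated. -/
def fourierKernel (f : Heis → ℂ) (z : (ℝ × ℝ) × ℝ) : ℂ :=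
  (((Real.sqrt |z.1.1|)⁻¹ : ℝ) : ℂ) *
    partialFourier f ((z.2 - z.1.2) / z.1.1, (z.2 + z.1.2) / 2, z.1.1)

theorem stronglyMeasurable_fourierKernel {f : Heis → ℂ} (hf : StronglyMeasurable f) :
    StronglyMeasurable (fourierKernel f) := by
  refine StronglyMeasurable.mul ?_ ?_
  · refine Measurable.stronglyMeasurable ?_
    fun_prop
  · exact (stronglyMeasurable_partialFourier hf).comp_measurable (by fun_prop)

theorem lintegral_fourierKernel_slice {f : Heis → ℂ} (hf : StronglyMeasurable f) {h : ℝ}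
    (h0 : h ≠ 0) (y : ℝ) : ∫⁻ u, ‖fourierKernel f ((h, y), u)‖ₑ ^ 2
      = ∫⁻ p, ‖partialFourier f (p, y + h * p / 2, h)‖ₑ ^ 2 := by
  rw [lintegral_affine _ h0 y, ← lintegral_const_mul' _ _ enorm_ne_top]
  · refine lintegral_congr fun p => ?_
    have e : ‖h‖ₑ * ‖(((Real.sqrt |h|)⁻¹ : ℝ) : ℂ)‖ₑ ^ 2 = 1 := by
      rw [← ofReal_norm, ← ofReal_norm, ← ENNReal.ofReal_pow (norm_nonneg _),
        ← ENNReal.ofReal_mul (by positivity), Complex.norm_real, Real.norm_eq_abs,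
        Real.norm_eq_abs, sq_abs, inv_pow,
        Real.sq_sqrt (abs_nonneg _), mul_inv_cancel₀ (abs_ne_zero.2 h0), ENNReal.ofReal_one]
    simp only [fourierKernel]
    rw [enorm_mul, mul_pow, ← mul_assoc, e, one_mul]
    congr 4
    · field_simp; ring
    · congr 1; ring
  · exact ((stronglyMeasurable_fourierKernel hf).comp_measurable (by fun_prop)).enorm.pow_const 2

/-- The three coordinates of `partialFourier` are recovered by `u = y + hp`, which absorbs the
factor `|h|^{-1}`, followed by the shift of `y` by `hp/2`. -/
theorem lintegral_fourierKernel {f : Heis → ℂ} (hf : StronglyMeasurable f) :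
    ∫⁻ z, ‖fourierKernel f z‖ₑ ^ 2 = ∫⁻ p, ∫⁻ w, ‖partialFourier f (p, w)‖ₑ ^ 2 := by
  have hm := (stronglyMeasurable_partialFourier hf).enorm.pow_const 2
  calc ∫⁻ z, ‖fourierKernel f z‖ₑ ^ 2
      = ∫⁻ w : ℝ × ℝ, ∫⁻ u, ‖fourierKernel f (w, u)‖ₑ ^ 2 := by
        exact lintegral_volume_prod
          ((stronglyMeasurable_fourierKernel hf).enorm.pow_const 2).aemeasurable
    _ = ∫⁻ h, ∫⁻ y, ∫⁻ u, ‖fourierKernel f ((h, y), u)‖ₑ ^ 2 := by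
        exact lintegral_volume_prod ((stronglyMeasurable_fourierKernel
          hf).enorm.pow_const 2).lintegral_prod_right'.aemeasurable
    _ = ∫⁻ h, ∫⁻ y, ∫⁻ p, ‖partialFourier f (p, y + h * p / 2, h)‖ₑ ^ 2 := by
        refine lintegral_congr_ae ?_
        filter_upwards [ae_ne_zero] with h h0
        simp_rw [lintegral_fourierKernel_slice hf h0]
    _ = ∫⁻ h, ∫⁻ p, ∫⁻ y, ‖partialFourier f (p, y, h)‖ₑ ^ 2 := by
        refine lintegral_congr fun h => ?_
        rw [lintegral_lintegral_swap]
        · refine lintegral_congr fun p => ?_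
          exact lintegral_add_right_eq_self (fun y => ‖partialFourier f (p, y, h)‖ₑ ^ 2) _
        · exact (hm.comp (g := fun z => ‖partialFourier f z‖ₑ ^ 2) (f := fun z : ℝ × ℝ =>
            (z.2, z.1 + h * z.2 / 2, h)) (by fun_prop)).aemeasurable
    _ = ∫⁻ p, ∫⁻ h, ∫⁻ y, ‖partialFourier f (p, y, h)‖ₑ ^ 2 := by
        rw [lintegral_lintegral_swap]
        refine (Measurable.lintegral_prod_right' (f := fun z : (ℝ × ℝ) × ℝ =>
          ‖partialFourier f (z.1.2, z.2, z.1.1)‖ₑ ^ 2) ?_).aemeasurable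
        exact hm.comp (by fun_prop)
    _ = ∫⁻ p, ∫⁻ w, ‖partialFourier f (p, w)‖ₑ ^ 2 := by
        refine lintegral_congr fun p => ?_
        exact (lintegral_prod_symm (fun w => ‖partialFourier f (p, w)‖ₑ ^ 2)
          (hm.comp measurable_prodMk_left).aemeasurable).symm

theorem integrable_dualSlice {f : Heis → ℂ} (hf : Integrable f) :
    ∀ᵐ p : ℝ, Integrable (dualSlice f p) := by
  have h1 : Integrable (fun z : ℝ × ℝ × ℝ => f (Heis.mk z.1 z.2.1 z.2.2)) :=
    Heis.measurePreserving_mk.integrable_comp_of_integrable hf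
  filter_upwards [h1.prod_right_ae] with p hp
  exact Complex.conjLIE.toContinuousLinearEquiv.toContinuousLinearMap.integrable_comp hp

theorem memLp_comp_mk {f : Heis → ℂ} (hf : MemLp f 2 volume) :
    MemLp (fun z : ℝ × ℝ × ℝ => f (Heis.mk z.1 z.2.1 z.2.2)) 2 volume :=
  hf.comp_measurePreserving Heis.measurePreserving_mk

theorem memLp_dualSlice {f : Heis → ℂ} (hf : MemLp f 2 volume) :
    ∀ᵐ p : ℝ, MemLp (dualSlice f p) 2 volume := by
  filter_upwards [ae_memLp_slice (memLp_comp_mk hf)] with p hp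
  exact hp.star

/-- The Plancherel formula on `L¹ ∩ L²`, in terms of kernels. -/
theorem lintegral_fourierKernel_eq {f : Heis → ℂ} (hf : StronglyMeasurable f)
    (hf₁ : Integrable f) (hf₂ : MemLp f 2 volume) :
    ∫⁻ z, ‖fourierKernel f z‖ₑ ^ 2 = ∫⁻ x, ‖f x‖ₑ ^ 2 := by
  rw [lintegral_fourierKernel hf, ← Heis.measurePreserving_mk.lintegral_comp_emb
    Heis.measurableEmbedding_mk, lintegral_volume_prod
      ((memLp_comp_mk hf₂).1.enorm.pow_const 2)]
  refine lintegral_congr_ae ?_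
  filter_upwards [integrable_dualSlice hf₁, memLp_dualSlice hf₂] with p h1 h2
  simp only [partialFourier]
  -- Plancherel in `(q, t)` for almost every fixed `p`.
  rw [lintegral_planeFourier h1 h2]
  refine lintegral_congr fun w => ?_
  simp [dualSlice]

theorem memLp_fourierKernel {f : Heis → ℂ} (hf : StronglyMeasurable f)
    (hf₁ : Integrable f) (hf₂ : MemLp f 2 volume) : MemLp (fourierKernel f) 2 volume :=
  memLp_two_iff.2 ⟨(stronglyMeasurable_fourierKernel hf).aestronglyMeasurable, by
    rw [lintegral_fourierKernel_eq hf hf₁ hf₂]; exact (memLp_two_iff.1 hf₂).2⟩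

end Kernel

/-! ### The group Fourier transform as an integral operator -/

section KernelFormula

open scoped ComplexConjugate

theorem measurePreserving_shear (h : ℝ) :
    MeasurePreserving (fun z : Heis × ℝ => (z.1, z.2 + h * z.1.p)) volume volume := by
  refine MeasurePreserving.skew_product (f := fun x : Heis => x)
    (g := fun (x : Heis) (y : ℝ) => y + h * x.p) (MeasurePreserving.id volume) ?_ ?_
  · have := Heis.measurable_p
    unfold Function.uncurry
    fun_prop
  · exact Eventually.of_forall fun x => (measurePreserving_add_right volume (h * x.p)).map_eq

theorem L2R.integrable_norm_sq (φ : L2R) : Integrable (fun y => ‖φ y‖ ^ 2) volume :=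
  (memLp_two_iff_integrable_sq_norm (Lp.aestronglyMeasurable φ)).1 (Lp.memLp φ)

/-- The bound `|ψ||φ| ≤ |ψ|² + |φ|²` splits the integrand, and the shear `y ↦ y + hp` turns the
second part into a product. This licenses the Fubini exchange in `fourierOp_eq_opField`. -/
theorem integrable_coeff_kernel (h : ℝ) {f : Heis → ℂ} (hf : Integrable f) (ψ φ : L2R) :
    Integrable (fun z : Heis × ℝ => ⟪ψ z.2, f z.1 * (phase h z.1 z.2 * φ (z.2 + h * z.1.p))⟫_ℂ)
      (volume.prod volume) := by
  have i1 : Integrable (fun z : Heis × ℝ => ‖f z.1‖ * ‖ψ z.2‖ ^ 2) (volume.prod volume) :=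
    hf.norm.mul_prod (L2R.integrable_norm_sq ψ)
  have i2 : Integrable (fun z : Heis × ℝ => ‖f z.1‖ * ‖φ (z.2 + h * z.1.p)‖ ^ 2)
      (volume.prod volume) :=
    (measurePreserving_shear h).integrable_comp_of_integrable
      (hf.norm.mul_prod (L2R.integrable_norm_sq φ))
  refine (i1.add i2).mono' ?_ (Eventually.of_forall fun z => ?_)
  · refine (Lp.aestronglyMeasurable ψ).comp_snd.inner (hf.1.comp_fst.mul ?_)
    refine ((measurable_phase h).stronglyMeasurable.mul
      ((Lp.stronglyMeasurable φ).comp_measurable ?_)).aestronglyMeasurable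
    have := Heis.measurable_p
    fun_prop
  · refine (norm_inner_le_norm _ _).trans ?_
    rw [norm_mul, norm_mul, norm_phase, one_mul, Pi.add_apply, ← mul_add, mul_left_comm]
    refine mul_le_mul_of_nonneg_left ?_ (norm_nonneg _)
    nlinarith [sq_nonneg (‖ψ z.2‖ - ‖φ (z.2 + h * z.1.p)‖), norm_nonneg (ψ z.2),
      norm_nonneg (φ (z.2 + h * z.1.p))]

theorem fourierKernel_affine (f : Heis → ℂ) {h : ℝ} (h0 : h ≠ 0) (y p : ℝ) :
    fourierKernel f ((h, y), y + h * p) = (((Real.sqrt |h|)⁻¹ : ℝ) : ℂ) *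
      partialFourier f (p, y + h * p / 2, h) := by
  simp only [fourierKernel]
  congr 3
  · field_simp; ring
  · congr 1; ring

/-- The phase `e^{2πiht} e^{2πiqy} e^{πihpq}` is the character of `(q, t)` with frequency `(y +
hp/2, h)`; with `u = y + hp` the first entry is the midpoint `(u + y)/2` in `fourierKernel`. -/
theorem conj_partialFourier (f : Heis → ℂ) (h y p : ℝ) :
    conj (partialFourier f (p, y + h * p / 2, h))
      = ∫ w : ℝ × ℝ, f (Heis.mk p w.1 w.2) * phase h (Heis.mk p w.1 w.2) y := by
  rw [partialFourier, planeFourier, ← integral_conj]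
  refine integral_congr_ae (Eventually.of_forall fun w => ?_)
  simp only [map_mul, dualSlice, Complex.conj_conj, ← Complex.exp_conj, phase, ← Complex.exp_add,
    Complex.conj_I, map_neg, Complex.conj_ofReal]
  rw [mul_comm]
  congr 2
  simp only [Heis.p, Heis.q, Heis.t, Heis.mk]
  push_cast
  ring

theorem inner_slice_fourierKernel {f : Heis → ℂ} {h : ℝ} (h0 : h ≠ 0) {y : ℝ}
    (hs : MemLp (fun u => fourierKernel f ((h, y), u)) 2 volume) (φ : L2R)
    (hi : Integrable (fun x : Heis => f x * (phase h x y * φ (y + h * x.p)))) :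
    ∫ x : Heis, f x * (phase h x y * φ (y + h * x.p))
      = (((Real.sqrt |h|)⁻¹ : ℝ) : ℂ) * ⟪slice (fourierKernel f) (h, y), φ⟫_ℂ := by
  have e1 : ⟪slice (fourierKernel f) (h, y), φ⟫_ℂ
      = ∫ u, conj (fourierKernel f ((h, y), u)) * φ u := by
    rw [slice_eq hs, L2.inner_def]
    refine integral_congr_ae ?_
    filter_upwards [hs.coeFn_toLp] with u hu
    rw [hu, RCLike.inner_apply']
  have hi' : Integrable (fun z : ℝ × ℝ × ℝ => f (Heis.mk z.1 z.2.1 z.2.2) *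
      (phase h (Heis.mk z.1 z.2.1 z.2.2) y * φ (y + h * z.1))) :=
    Heis.measurePreserving_mk.integrable_comp_of_integrable hi
  rw [← Heis.measurePreserving_mk.integral_comp Heis.measurableEmbedding_mk]
  have e2 := integral_prod _ hi'
  refine e2.trans ?_
  rw [e1, integral_affine (fun u => conj (fourierKernel f ((h, y), u)) * φ u) h0 y, ← mul_assoc, ← integral_const_mul]
  refine integral_congr_ae (Eventually.of_forall fun p => ?_)
  simp only
  rw [fourierKernel_affine f h0, map_mul, conj_partialFourier, Complex.conj_ofReal]
  -- The Jacobian `|h|` is used up by two factors `|h|^{-1/2}`, one in `fourierKernel` and one in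
  -- `opField`.
  have e3 : (((Real.sqrt |h|)⁻¹ : ℝ) : ℂ) * (|h| : ℝ) * (((Real.sqrt |h|)⁻¹ : ℝ) : ℂ) = 1 := by
    rw [← Complex.ofReal_mul, ← Complex.ofReal_mul]
    have : Real.sqrt |h| ≠ 0 := (Real.sqrt_pos.2 (abs_pos.2 h0)).ne'
    have h2 : (Real.sqrt |h|)⁻¹ * |h| * (Real.sqrt |h|)⁻¹ = 1 := by
      field_simp
      rw [Real.sq_sqrt (abs_nonneg _)]
    rw [h2, Complex.ofReal_one]
  rw [← mul_assoc, ← mul_assoc, e3, one_mul, ← integral_mul_const]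
  refine integral_congr_ae (Eventually.of_forall fun w => ?_)
  simp only [mul_assoc]

/-- The group Fourier transform of `f ∈ L¹ ∩ L²` is given by its kernel. -/
theorem fourierOp_eq_opField {f : Heis → ℂ} (hf : StronglyMeasurable f)
    (hf₁ : Integrable f) (hf₂ : MemLp f 2 volume) :
    ∀ᵐ h : ℝ, fourierOp h f hf₁ = opField (slice (fourierKernel f)) h := by
  have hk := memLp_fourierKernel hf hf₁ hf₂
  filter_upwards [ae_ne_zero, Measure.ae_ae_of_ae_prod (ae_memLp_slice hk),
    ae_memLp_slice (memLp_slice hk)] with h h0 hs hK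
  ext1 φ
  refine ext_inner_left ℂ fun ψ => ?_
  rw [inner_fourierOp, opField, _root_.smul_apply, inner_smul_right, L2.inner_def]
  have e1 : ∀ x : Heis, f x * ⟪ψ, schrodinger h x φ⟫_ℂ
      = ∫ y, ⟪ψ y, f x * (phase h x y * φ (y + h * x.p))⟫_ℂ := by
    intro x
    rw [L2.inner_def, ← integral_const_mul]
    refine integral_congr_ae ?_
    filter_upwards [(memLp_schrodinger h x φ).coeFn_toLp] with y hy
    change f x * ⟪ψ y, (memLp_schrodinger h x φ).toLp _ y⟫_ℂ = _
    rw [hy]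
    simp only [RCLike.inner_apply']
    ring
  simp_rw [e1]
  have hI := integrable_coeff_kernel h hf₁ ψ φ
  rw [integral_integral_swap hI, ← integral_const_mul]
  refine integral_congr_ae ?_
  filter_upwards [hs, coeFn_kernelOp hK φ, hI.prod_left_ae] with y h1 h2 h3
  rw [h2]
  -- Fubini gives integrability in `x` only after multiplication by the conjugate of `ψ y`, which
  -- can be divided out where it is nonzero.
  by_cases hψ : ψ y = 0
  · simp [hψ]
  · have h4 : Integrable (fun x : Heis => f x * (phase h x y * φ (y + h * x.p))) := by
      refine (h3.const_mul (conj (ψ y))⁻¹).congr (Eventually.of_forall fun x => ?_)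
      simp only [RCLike.inner_apply']
      rw [inv_mul_cancel_left₀]
      simpa using hψ
    simp only [RCLike.inner_apply']
    rw [integral_const_mul, inner_slice_fourierKernel h0 h1 φ h4]
    ring

end KernelFormula

/-! ### The antilinear isometry from `L²(ℍ)` to fields of kernels -/

section KernelMap

open scoped ComplexConjugate

/-- The Hilbert space of square-integrable fields of kernels. -/
abbrev KernelSpace : Type := Lp L2R 2 (volume : Measure (ℝ × ℝ))

theorem dense_integrable {X : Type*} [MeasurableSpace X] (μ : Measure X) :
    Dense {f : Lp ℂ 2 μ | Integrable f μ} := by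
  refine (Lp.simpleFunc.denseRange (E := ℂ) (μ := μ) (p := 2) (by norm_num)).mono ?_
  rintro _ ⟨s, rfl⟩
  have h1 : Integrable (Lp.simpleFunc.toSimpleFunc s) μ :=
    (SimpleFunc.memLp_iff_integrable (p := 2) (by norm_num) (by norm_num)).1
      (Lp.simpleFunc.memLp s)
  exact h1.congr (Lp.simpleFunc.toSimpleFunc_eq_toFun s)

/-- The dense subspace `L¹ ∩ L²` of `L²(ℍ)`. -/
def integrableL2 : Submodule ℂ L2H where
  carrier := {f | Integrable f volume}
  zero_mem' := (integrable_zero Heis ℂ volume).congr (Lp.coeFn_zero _ _ _).symm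
  add_mem' {f g} hf hg := by
    have h : Integrable (⇑f + ⇑g) volume := Integrable.add hf hg
    exact h.congr (Lp.coeFn_add f g).symm
  smul_mem' c f hf := by
    have h : Integrable (c • ⇑f) volume := Integrable.smul c hf
    exact h.congr (Lp.coeFn_smul c f).symm

theorem integrable_coe (f : integrableL2) : Integrable (f : L2H) volume := f.2

theorem fourierOp_add (h : ℝ) (f g : integrableL2) :
    fourierOp h ((f + g : integrableL2) : L2H) (integrable_coe (f + g))
      = fourierOp h (f : L2H) (integrable_coe f) + fourierOp h (g : L2H) (integrable_coe g) := by
  ext1 φ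
  refine ext_inner_left ℂ fun ψ => ?_
  rw [_root_.add_apply, inner_add_right, inner_fourierOp, inner_fourierOp, inner_fourierOp,
    ← integral_add (integrable_schrodinger_coeff h (integrable_coe f) ψ φ)
      (integrable_schrodinger_coeff h (integrable_coe g) ψ φ)]
  refine integral_congr_ae ?_
  filter_upwards [Lp.coeFn_add (f : L2H) (g : L2H)] with x hx
  rw [Submodule.coe_add, hx, Pi.add_apply, add_mul]

theorem fourierOp_smul (h : ℝ) (c : ℂ) (f : integrableL2) :
    fourierOp h ((c • f : integrableL2) : L2H) (integrable_coe (c • f)) = c • fourierOp h (f : L2H) (integrable_coe f) := by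
  ext1 φ
  refine ext_inner_left ℂ fun ψ => ?_
  rw [_root_.smul_apply, inner_smul_right, inner_fourierOp, inner_fourierOp,
    ← integral_const_mul]
  refine integral_congr_ae ?_
  filter_upwards [Lp.coeFn_smul c (f : L2H)] with x hx
  rw [Submodule.coe_smul, hx, Pi.smul_apply, smul_eq_mul, mul_assoc]

theorem memLp_kernel (f : integrableL2) :
    MemLp (slice (fourierKernel (f : L2H))) 2 (volume : Measure (ℝ × ℝ)) :=
  memLp_slice (memLp_fourierKernel (Lp.stronglyMeasurable (f : L2H)) (integrable_coe f) (Lp.memLp (f : L2H)))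

/-- The field of kernels of an element of `L¹ ∩ L²`. -/
def kernelAux (f : integrableL2) : KernelSpace := (memLp_kernel f).toLp _

theorem opField_kernelAux (f : integrableL2) :
    ∀ᵐ h : ℝ, opField (kernelAux f) h = fourierOp h (f : L2H) (integrable_coe f) := by
  filter_upwards [opField_congr (memLp_kernel f).coeFn_toLp,
    fourierOp_eq_opField (Lp.stronglyMeasurable (f : L2H)) (integrable_coe f) (Lp.memLp (f : L2H))] with h h1 h2
  rw [h2]
  exact h1

theorem norm_kernelAux (f : integrableL2) : ‖kernelAux f‖ = ‖f‖ := by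
  have : ‖kernelAux f‖ₑ ^ 2 = ‖(f : L2H)‖ₑ ^ 2 := by
    rw [kernelAux, enorm_toLp_sq, enorm_sq_eq_lintegral]
    refine (lintegral_slice (memLp_fourierKernel (Lp.stronglyMeasurable (f : L2H)) (integrable_coe f)
      (Lp.memLp (f : L2H)))).trans ?_
    exact lintegral_fourierKernel_eq (Lp.stronglyMeasurable (f : L2H)) (integrable_coe f) (Lp.memLp (f : L2H))
  have h2 : ‖kernelAux f‖ₑ = ‖(f : L2H)‖ₑ := (ENNReal.pow_right_strictMono two_ne_zero).injective this
  rwa [enorm_eq_iff_norm_eq] at h2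

theorem kernelOp_smul {k : ℝ → L2R} (hk : MemLp k 2 volume) (c : ℂ) :
    kernelOp (conj c • k) = c • kernelOp k := by
  symm
  refine kernelOp_eq_of_ae (hk.const_smul _) fun φ => ?_
  rw [_root_.smul_apply]
  filter_upwards [coeFn_kernelOp hk φ, Lp.coeFn_smul c (kernelOp k φ)] with y h1 h2
  rw [h2, Pi.smul_apply, h1, Pi.smul_apply, inner_smul_left, Complex.conj_conj, smul_eq_mul]

/-- Additivity comes from that of `fourierOp`, because a field of kernels is determined by its
operators. The form as a difference matches `opField_sub`. -/
theorem kernelAux_sub (f g : integrableL2) : kernelAux (f + g) - kernelAux g = kernelAux f := by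
  refine Lp.ext (ae_eq_of_opField_eq (Lp.memLp _) (Lp.memLp _) ?_)
  filter_upwards [opField_congr (Lp.coeFn_sub (kernelAux (f + g)) (kernelAux g)),
    opField_sub (Lp.memLp (kernelAux (f + g))) (Lp.memLp (kernelAux g)),
    opField_kernelAux (f + g), opField_kernelAux f, opField_kernelAux g] with h h1 h2 h3 h4 h5
  rw [h1, ← h2, h3, h4, h5, fourierOp_add, add_sub_cancel_right]

/-- The conjugate appears because the kernel occupies the antilinear slot of the inner product. -/
theorem kernelAux_smul (c : ℂ) (f : integrableL2) :
    kernelAux (c • f) = conj c • kernelAux f := by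
  refine Lp.ext (ae_eq_of_opField_eq (Lp.memLp _) (Lp.memLp _) ?_)
  filter_upwards [opField_congr (Lp.coeFn_smul (conj c) (kernelAux f)),
    opField_kernelAux (c • f), opField_kernelAux f,
    ae_memLp_slice (Lp.memLp (kernelAux f))] with h h1 h2 h3 h4
  rw [h1, h2, fourierOp_smul, ← h3, opField, opField]
  rw [smul_comm, ← kernelOp_smul h4]
  rfl

/-- The antilinear map `f ↦ K_f` on `L¹ ∩ L²`. -/
def kernelAuxₗ : integrableL2 →ₛₗ[starRingEnd ℂ] KernelSpace where
  toFun := kernelAux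
  map_add' f g := sub_eq_iff_eq_add.1 (kernelAux_sub f g)
  map_smul' c f := kernelAux_smul c f

theorem denseRange_integrableL2 : DenseRange integrableL2.subtype := by
  refine (dense_integrable (volume : Measure Heis)).mono ?_
  intro f hf
  exact ⟨⟨f, hf⟩, rfl⟩

/-- The antilinear isometry `f ↦ K_f` that realizes the Plancherel transform. -/
def kernel : L2H →SL[starRingEnd ℂ] KernelSpace := kernelAuxₗ.extendOfNorm integrableL2.subtype

theorem kernel_coe (f : integrableL2) : kernel (f : L2H) = kernelAux f :=
  LinearMap.extendOfNorm_eq denseRange_integrableL2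
    ⟨1, fun f => by rw [one_mul]; exact (norm_kernelAux f).le⟩ f

theorem norm_kernel (f : L2H) : ‖kernel f‖ = ‖f‖ := by
  refine denseRange_integrableL2.induction_on (p := fun f => ‖kernel f‖ = ‖f‖) f ?_ fun f => ?_
  · exact isClosed_eq kernel.continuous.norm continuous_norm
  · change ‖kernel (f : L2H)‖ = ‖(f : L2H)‖
    rw [kernel_coe, norm_kernelAux]
    rfl

theorem kernel_smul (c : ℂ) (f : L2H) : kernel (c • f) = conj c • kernel f := by
  rw [map_smulₛₗ]

/-- Polarization; antilinearity turns `I` into `-I`, which exchanges the two arguments. -/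
theorem inner_kernel (f g : L2H) : ⟪kernel f, kernel g⟫_ℂ = ⟪g, f⟫_ℂ := by
  have h1 : kernel f - RCLike.I (K := ℂ) • kernel g = kernel (f + RCLike.I (K := ℂ) • g) := by
    rw [map_add, kernel_smul, RCLike.conj_I, neg_smul, sub_eq_add_neg]
  have h2 : kernel f + RCLike.I (K := ℂ) • kernel g = kernel (f - RCLike.I (K := ℂ) • g) := by
    rw [map_sub, kernel_smul, RCLike.conj_I, neg_smul, sub_neg_eq_add]
  rw [← inner_conj_symm g f, inner_eq_sum_norm_sq_div_four (𝕜 := ℂ) (kernel f),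
    inner_eq_sum_norm_sq_div_four (𝕜 := ℂ) f, h1, h2, ← map_add, ← map_sub, norm_kernel,
    norm_kernel, norm_kernel, norm_kernel]
  have h4 : conj (4 : ℂ) = 4 := Complex.conj_ofReal 4
  simp only [map_div₀, map_add, map_sub, map_mul, map_pow, RCLike.conj_I, RCLike.conj_ofReal, h4]
  ring

theorem kernel_injective : Function.Injective kernel := by
  intro f g h
  rw [← sub_eq_zero, ← norm_eq_zero, ← norm_kernel, map_sub, h, sub_self, norm_zero]

theorem opField_kernel (f : L2H) (hf : Integrable f) :
    ∀ᵐ h : ℝ, opField (kernel f) h = fourierOp h f hf := by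
  have := opField_kernelAux ⟨f, hf⟩
  rwa [← kernel_coe] at this

end KernelMap

/-! ### Surjectivity of the kernel map -/

section Surjective

open scoped ComplexConjugate

theorem fourierOp_congr (h : ℝ) {f g : Heis → ℂ} (hf : Integrable f) (hg : Integrable g)
    (hfg : f =ᵐ[volume] g) : fourierOp h f hf = fourierOp h g hg := by
  ext1 φ
  refine ext_inner_left ℂ fun ψ => ?_
  rw [inner_fourierOp, inner_fourierOp]
  refine integral_congr_ae ?_
  filter_upwards [hfg] with x hx
  rw [hx]

theorem kernel_toLp {f : Heis → ℂ} (hf : StronglyMeasurable f) (hf₁ : Integrable f)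
    (hf₂ : MemLp f 2 volume) : kernel (hf₂.toLp f) =ᵐ[volume] slice (fourierKernel f) := by
  have hi : Integrable (hf₂.toLp f) := hf₁.congr hf₂.coeFn_toLp.symm
  refine ae_eq_of_opField_eq (Lp.memLp _) (memLp_slice (memLp_fourierKernel hf hf₁ hf₂)) ?_
  filter_upwards [opField_kernel _ hi, fourierOp_eq_opField hf hf₁ hf₂] with h h1 h2
  rw [h1, ← h2]
  exact fourierOp_congr h _ _ hf₂.coeFn_toLp

theorem measurePreserving_planeShear (p : ℝ) :
    MeasurePreserving (fun w : ℝ × ℝ => (w.1, w.2 + p * w.1 / 2)) volume volume := by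
  refine MeasurePreserving.skew_product (f := fun q : ℝ => q)
    (g := fun q t : ℝ => t + p * q / 2) (MeasurePreserving.id volume) ?_ ?_
  · unfold Function.uncurry
    fun_prop
  · exact Eventually.of_forall fun q => (measurePreserving_add_right volume (p * q / 2)).map_eq

theorem measurePreserving_polarize :
    MeasurePreserving (fun x : Heis => (x.p, x.q, x.t + x.p * x.q / 2)) volume volume := by
  change MeasurePreserving (fun z : ℝ × ℝ × ℝ => (z.1, z.2.1, z.2.2 + z.1 * z.2.1 / 2))
    volume volume
  refine MeasurePreserving.skew_product (f := fun p : ℝ => p)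
    (g := fun (p : ℝ) (w : ℝ × ℝ) => (w.1, w.2 + p * w.1 / 2)) (MeasurePreserving.id volume) ?_ ?_
  · unfold Function.uncurry
    fun_prop
  · exact Eventually.of_forall fun p => (measurePreserving_planeShear p).map_eq

/-- The functions `(p, q, t) ↦ conj (d(p) b(q, t + pq/2))`. -/
def tensorFun (d : ℝ → ℂ) (b : ℝ × ℝ → ℂ) (x : Heis) : ℂ :=
  conj (d x.p * b (x.q, x.t + x.p * x.q / 2))

theorem stronglyMeasurable_tensorFun {d : ℝ → ℂ} {b : ℝ × ℝ → ℂ} (hd : StronglyMeasurable d)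
    (hb : StronglyMeasurable b) : StronglyMeasurable (tensorFun d b) := by
  refine Complex.continuous_conj.comp_stronglyMeasurable ?_
  have h := measurePreserving_polarize.measurable
  exact (hd.comp_measurable (measurable_fst.comp h)).mul
    (hb.comp_measurable (measurable_snd.comp h))

theorem integrable_tensorFun {d : ℝ → ℂ} {b : ℝ × ℝ → ℂ} (hd : Integrable d)
    (hb : Integrable b) : Integrable (tensorFun d b) :=
  Complex.conjLIE.toContinuousLinearEquiv.toContinuousLinearMap.integrable_comp
    (measurePreserving_polarize.integrable_comp_of_integrable (hd.mul_prod hb))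

theorem MemLp.mul_prod_two {d : ℝ → ℂ} {b : ℝ × ℝ → ℂ} (hd : MemLp d 2 volume)
    (hb : MemLp b 2 volume) : MemLp (fun z : ℝ × ℝ × ℝ => d z.1 * b z.2) 2 volume := by
  refine memLp_two_iff.2 ⟨hd.1.comp_fst.mul hb.1.comp_snd, ?_⟩
  simp only [enorm_mul, mul_pow]
  have := lintegral_prod_mul (μ := (volume : Measure ℝ)) (ν := (volume : Measure (ℝ × ℝ)))
    (hd.1.enorm.pow_const 2) (hb.1.enorm.pow_const 2)
  refine this.trans_lt ?_
  exact ENNReal.mul_lt_top (memLp_two_iff.1 hd).2 (memLp_two_iff.1 hb).2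

theorem memLp_tensorFun {d : ℝ → ℂ} {b : ℝ × ℝ → ℂ} (hd : MemLp d 2 volume)
    (hb : MemLp b 2 volume) : MemLp (tensorFun d b) 2 volume :=
  ((MemLp.mul_prod_two hd hb).comp_measurePreserving measurePreserving_polarize).star

/-- The shear `t + pq/2` in `tensorFun` becomes the frequency shift `v - hp/2`. At `v = (u + y)/2`
and `hp = u - y` this equals `y`, so the kernel separates into a function of `(h, y)` and a dilate
of `d`. -/
theorem partialFourier_tensorFun (d : ℝ → ℂ) (b : ℝ × ℝ → ℂ) (p v h : ℝ) :
    partialFourier (tensorFun d b) (p, v, h) = d p * planeFourier b (v - h * p / 2, h) := by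
  have hmp := measurePreserving_planeShear p
  have hemb : MeasurableEmbedding (fun w : ℝ × ℝ => (w.1, w.2 + p * w.1 / 2)) := by
    refine (MeasurableEquiv.measurableEmbedding
      { toFun := fun w : ℝ × ℝ => (w.1, w.2 + p * w.1 / 2)
        invFun := fun w : ℝ × ℝ => (w.1, w.2 - p * w.1 / 2)
        left_inv := fun w => by simp
        right_inv := fun w => by simp
        measurable_toFun := hmp.measurable
        measurable_invFun := by
          change Measurable (fun w : ℝ × ℝ => (w.1, w.2 - p * w.1 / 2))
          fun_prop })
  rw [partialFourier, planeFourier, planeFourier]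
  conv_rhs => rw [← hmp.integral_comp hemb, ← integral_const_mul]
  refine integral_congr_ae (Eventually.of_forall fun w => ?_)
  simp only [dualSlice, tensorFun, Complex.conj_conj, Heis.mk, Heis.p, Heis.q, Heis.t]
  rw [mul_left_comm]
  congr 3
  push_cast
  ring

/-- The field of dilates `u ↦ |h|^{-1/2} d((u - y) / h)`. -/
def dilate (d : L2R) (z : (ℝ × ℝ) × ℝ) : ℂ :=
  (((Real.sqrt |z.1.1|)⁻¹ : ℝ) : ℂ) * d ((z.2 - z.1.2) / z.1.1)

theorem stronglyMeasurable_dilate (d : L2R) : StronglyMeasurable (dilate d) := by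
  refine StronglyMeasurable.mul ?_ ?_
  · refine Measurable.stronglyMeasurable ?_
    fun_prop
  · exact (Lp.stronglyMeasurable d).comp_measurable (by fun_prop)

theorem dilate_affine (d : L2R) {h : ℝ} (h0 : h ≠ 0) (y p : ℝ) :
    dilate d ((h, y), y + h * p) = (((Real.sqrt |h|)⁻¹ : ℝ) : ℂ) * d p := by
  simp only [dilate]
  congr 2
  field_simp
  ring

theorem lintegral_dilate (d : L2R) {h : ℝ} (h0 : h ≠ 0) (y : ℝ) :
    ∫⁻ u, ‖dilate d ((h, y), u)‖ₑ ^ 2 = ‖d‖ₑ ^ 2 := by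
  rw [lintegral_affine _ h0 y, ← lintegral_const_mul' _ _ enorm_ne_top, enorm_sq_eq_lintegral]
  · refine lintegral_congr fun p => ?_
    have e : ‖h‖ₑ * ‖(((Real.sqrt |h|)⁻¹ : ℝ) : ℂ)‖ₑ ^ 2 = 1 := by
      rw [← ofReal_norm, ← ofReal_norm, ← ENNReal.ofReal_pow (norm_nonneg _),
        ← ENNReal.ofReal_mul (by positivity), Complex.norm_real, Real.norm_eq_abs,
        Real.norm_eq_abs, sq_abs, inv_pow,
        Real.sq_sqrt (abs_nonneg _), mul_inv_cancel₀ (abs_ne_zero.2 h0), ENNReal.ofReal_one]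
    rw [dilate_affine d h0, enorm_mul, mul_pow, ← mul_assoc, e, one_mul]
  · exact ((stronglyMeasurable_dilate d).comp_measurable (by fun_prop)).enorm.pow_const 2

theorem memLp_dilate (d : L2R) {h : ℝ} (h0 : h ≠ 0) (y : ℝ) :
    MemLp (fun u => dilate d ((h, y), u)) 2 volume :=
  memLp_two_iff.2 ⟨((stronglyMeasurable_dilate d).comp_measurable
    (by fun_prop)).aestronglyMeasurable, by rw [lintegral_dilate d h0]; finiteness⟩

theorem ae_fst_ne_zero : ∀ᵐ z : ℝ × ℝ, z.1 ≠ 0 :=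
  Measure.quasiMeasurePreserving_fst.ae ae_ne_zero

theorem aestronglyMeasurable_slice_dilate (d : L2R) :
    AEStronglyMeasurable (slice (dilate d)) (volume : Measure (ℝ × ℝ)) := by
  refine aestronglyMeasurable_slice (stronglyMeasurable_dilate d).aestronglyMeasurable ?_
  filter_upwards [ae_fst_ne_zero] with z hz
  exact memLp_dilate d hz z.2

theorem norm_slice_dilate (d : L2R) {h : ℝ} (h0 : h ≠ 0) (y : ℝ) :
    ‖slice (dilate d) (h, y)‖ = ‖d‖ := by
  have : ‖slice (dilate d) (h, y)‖ₑ ^ 2 = ‖d‖ₑ ^ 2 := by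
    rw [slice_eq (memLp_dilate d h0 y), enorm_toLp_sq, lintegral_dilate d h0]
  have h2 := (ENNReal.pow_right_strictMono two_ne_zero).injective this
  rwa [enorm_eq_iff_norm_eq] at h2

theorem slice_fourierKernel_tensorFun (d : L2R) (b : ℝ × ℝ → ℂ) {h : ℝ} (h0 : h ≠ 0) (y : ℝ) :
    slice (fourierKernel (tensorFun d b)) (h, y)
      = planeFourier b (y, h) • slice (dilate d) (h, y) := by
  have e : (fun u => fourierKernel (tensorFun d b) ((h, y), u))
      = planeFourier b (y, h) • fun u => dilate d ((h, y), u) := by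
    funext u
    simp only [fourierKernel, partialFourier_tensorFun, Pi.smul_apply, smul_eq_mul, dilate]
    have : (u + y) / 2 - h * ((u - y) / h) / 2 = y := by field_simp; ring
    rw [this]
    ring
  have hm := memLp_dilate d h0 y
  have hm' : MemLp (fun u => fourierKernel (tensorFun d b) ((h, y), u)) 2 volume := by
    rw [e]; exact hm.const_smul _
  rw [slice_eq hm, slice_eq hm', ← MemLp.toLp_const_smul]
  exact MemLp.toLp_congr _ _ (Eventually.of_forall fun u => congrFun e u)

theorem inner_slice_dilate (d k : L2R) {h : ℝ} (h0 : h ≠ 0) (y : ℝ) :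
    ⟪slice (dilate d) (h, y), k⟫_ℂ = ((Real.sqrt |h| : ℝ) : ℂ) *
      ⟪d, (memLp_affine (Lp.memLp k) h0 y).toLp _⟫_ℂ := by
  have hm := memLp_dilate d h0 y
  have e1 : ⟪slice (dilate d) (h, y), k⟫_ℂ = ∫ u, conj (dilate d ((h, y), u)) * k u := by
    rw [slice_eq hm, L2.inner_def]
    refine integral_congr_ae ?_
    filter_upwards [hm.coeFn_toLp] with u hu
    rw [hu, RCLike.inner_apply']
  rw [e1, integral_affine _ h0 y, L2.inner_def, ← integral_const_mul, ← integral_const_mul]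
  refine integral_congr_ae ?_
  filter_upwards [(memLp_affine (Lp.memLp k) h0 y).coeFn_toLp] with p hp
  rw [hp, dilate_affine d h0, RCLike.inner_apply', map_mul, Complex.conj_ofReal, ← mul_assoc,
    ← mul_assoc, ← mul_assoc, ← Complex.ofReal_mul]
  congr 3
  have : Real.sqrt |h| ≠ 0 := (Real.sqrt_pos.2 (abs_pos.2 h0)).ne'
  field_simp
  rw [Real.sq_sqrt (abs_nonneg _)]

theorem eq_zero_of_affine_eq_zero {k : L2R} {h : ℝ} (h0 : h ≠ 0) {y : ℝ}
    (hk : (memLp_affine (Lp.memLp k) h0 y).toLp _ = 0) : k = 0 := by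
  have h1 : ‖k‖ₑ ^ 2 = 0 := by
    rw [enorm_sq_eq_lintegral, lintegral_affine
      ((Lp.stronglyMeasurable k).enorm.pow_const 2) h0 y,
      ← enorm_toLp_sq (memLp_affine (Lp.memLp k) h0 y), hk]
    simp
  simpa using h1

/-- Testing with `tensorFun d b` and varying `b` gives `⟨dilate d (h, y), K(h, y)⟩ = 0` a.e., since
Fourier transforms are total in the plane. With `d` in a countable dense set one null set serves all
`d`, and for fixed `h ≠ 0` and `y` the dilates of a dense set are total. -/
theorem eq_zero_of_orthogonal_range {K : KernelSpace} (hK : ∀ f, ⟪kernel f, K⟫_ℂ = 0) : K = 0 := by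
  obtain ⟨D, hD, hDc, hDd⟩ := (dense_integrable (volume : Measure ℝ)).exists_countable_dense_subset
  have key : ∀ d ∈ D, ∀ᵐ z : ℝ × ℝ, ⟪slice (dilate d) z, K z⟫_ℂ = 0 := by
    intro d hd
    have hd₁ : Integrable d := hD hd
    set c : ℝ × ℝ → ℂ := fun w => conj ⟪slice (dilate d) w.swap, K w.swap⟫_ℂ with hc
    have hm : MemLp (fun z => conj ⟪slice (dilate d) z, K z⟫_ℂ) 2 (volume : Measure (ℝ × ℝ)) := by
      refine MemLp.star ?_
      refine ((Lp.memLp K).const_smul (‖d‖ : ℂ)).of_le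
        ((aestronglyMeasurable_slice_dilate d).inner (Lp.aestronglyMeasurable K)) ?_
      filter_upwards [ae_fst_ne_zero] with z hz
      refine (norm_inner_le_norm _ _).trans ?_
      have := norm_slice_dilate d hz z.2
      rw [Prod.mk.eta] at this
      rw [this, Pi.smul_apply, norm_smul]
      simp
    have hmc : MemLp c 2 volume :=
      hm.comp_measurePreserving (Measure.measurePreserving_swap)
    have h0 : c =ᵐ[volume] 0 := by
      refine ae_eq_zero_of_integral_planeFourier_mul hmc fun b hb hb₁ hb₂ => ?_
      have hs := stronglyMeasurable_tensorFun (Lp.stronglyMeasurable d) hb.stronglyMeasurable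
      have h1 := hK ((memLp_tensorFun (Lp.memLp d) hb₂).toLp _)
      have h2 := kernel_toLp hs (integrable_tensorFun hd₁ hb₁) (memLp_tensorFun (Lp.memLp d) hb₂)
      have h3 : ∫ z : ℝ × ℝ, conj (planeFourier b z.swap * c z.swap) = 0 := by
        rw [← h1, L2.inner_def]
        refine integral_congr_ae ?_
        filter_upwards [h2, ae_fst_ne_zero] with z hz hz0
        have h4 := slice_fourierKernel_tensorFun d b hz0 z.2
        rw [Prod.mk.eta] at h4
        rw [hz, h4, inner_smul_left, map_mul]
        simp [hc, Prod.swap]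
      rw [integral_conj, map_eq_zero] at h3
      rw [← h3]
      exact (Measure.measurePreserving_swap (μ := (volume : Measure ℝ))
        (ν := (volume : Measure ℝ))).integral_comp
          (MeasurableEquiv.prodComm).measurableEmbedding (fun w => planeFourier b w * c w) |>.symm
    have h1 := (Measure.measurePreserving_swap (μ := (volume : Measure ℝ))
      (ν := (volume : Measure ℝ))).quasiMeasurePreserving.ae_eq_comp h0
    filter_upwards [h1] with z hz
    exact inner_eq_zero_symm.1 (by simpa [hc] using hz)
  have key2 := (ae_ball_iff hDc).2 key
  refine Lp.ext ?_
  filter_upwards [key2, ae_fst_ne_zero, Lp.coeFn_zero L2R 2 (volume : Measure (ℝ × ℝ))]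
    with z hz hz0 hz1
  rw [hz1]
  refine eq_zero_of_affine_eq_zero hz0 (y := z.2) ?_
  refine hDd.eq_zero_of_inner_right (𝕜 := ℂ) fun v hv => ?_
  have := hz v hv
  have h5 := inner_slice_dilate v (K z) hz0 z.2
  rw [Prod.mk.eta, this] at h5
  have hs : ((Real.sqrt |z.1| : ℝ) : ℂ) ≠ 0 := by
    simpa using (Real.sqrt_pos.2 (abs_pos.2 hz0)).ne'
  exact (mul_eq_zero.1 h5.symm).resolve_left hs

/-- The range of an isometry of complete spaces is closed, and here its orthogonal complement is
zero. -/
theorem kernel_surjective : Function.Surjective kernel := by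
  have hcl : IsClosed (Set.range kernel) := by
    have : Isometry kernel := AddMonoidHomClass.isometry_of_norm _ norm_kernel
    exact this.isClosedEmbedding.isClosed_range
  let M : Submodule ℂ KernelSpace := LinearMap.range kernel.toLinearMap
  have hM : IsClosed (M : Set KernelSpace) := hcl
  have : CompleteSpace M := hM.completeSpace_coe
  have hbot : Mᗮ = ⊥ := by
    rw [Submodule.eq_bot_iff]
    intro K hK
    exact eq_zero_of_orthogonal_range fun f =>
      (Submodule.mem_orthogonal _ _).1 hK _ ⟨f, rfl⟩
  have htop : M = ⊤ := (Submodule.orthogonal_eq_bot_iff).1 hbot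
  intro K
  have : K ∈ M := htop ▸ Submodule.mem_top
  exact this

/-- Every square-integrable field of kernels comes from an element of `L²(ℍ)`. -/
theorem exists_kernel_ae_eq {K : ℝ × ℝ → L2R} (hK : MemLp K 2 volume) :
    ∃ f : L2H, kernel f =ᵐ[volume] K := by
  obtain ⟨f, hf⟩ := kernel_surjective (hK.toLp K)
  exact ⟨f, hf ▸ hK.coeFn_toLp⟩

end Surjective

/-! ### The Plancherel transform in terms of kernels -/

section Plancherel

open scoped ComplexConjugate

theorem lintegral_opField_kernel_sub (f g : L2H) :
    ∫⁻ h, hsNormSq (opField (kernel f) h - opField (kernel g) h) * ‖h‖ₑ = ‖f - g‖ₑ ^ 2 := by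
  have h1 : ∫⁻ h, hsNormSq (opField (kernel f) h - opField (kernel g) h) * ‖h‖ₑ
      = ∫⁻ h, hsNormSq (opField (kernel (f - g)) h) * ‖h‖ₑ := by
    refine lintegral_congr_ae ?_
    filter_upwards [opField_sub (Lp.memLp (kernel f)) (Lp.memLp (kernel g)),
      opField_congr (Lp.coeFn_sub (kernel f) (kernel g))] with h h2 h3
    rw [h2, map_sub, h3]
  rw [h1, lintegral_hsNormSq_opField (Lp.memLp _), ← enorm_sq_eq_lintegral]
  congr 1
  rw [enorm_eq_iff_norm_eq, norm_kernel]

theorem isPlancherelTransform_opField (f : L2H) : IsPlancherelTransform f (opField (kernel f)) := by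
  refine ⟨measurableField_opField (Lp.memLp _), ?_⟩
  obtain ⟨g, hg, hlim⟩ := mem_closure_iff_seq_limit.1 (dense_integrable (volume : Measure Heis) f)
  refine ⟨g, hg, hlim, ?_⟩
  have h1 : ∀ n, ∫⁻ h : ℝ, hsNormSq (fourierOp h (g n) (hg n) - opField (kernel f) h) * ‖h‖ₑ
      = ‖g n - f‖ₑ ^ 2 := by
    intro n
    rw [← lintegral_opField_kernel_sub]
    refine lintegral_congr_ae ?_
    filter_upwards [opField_kernel (g n) (hg n)] with h h2
    rw [h2]
  simp_rw [h1]
  have h2 : Tendsto (fun n => ‖g n - f‖ₑ) atTop (𝓝 0) := by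
    have h3 : Tendsto (fun n => g n - f) atTop (𝓝 0) := by simpa using hlim.sub_const f
    simpa [Function.comp_def] using (continuous_enorm.tendsto (0 : L2H)).comp h3
  simpa [Function.comp_def] using ((ENNReal.continuous_pow 2).tendsto 0).comp h2

/-- Uniqueness of the transform: its squared distance to the field of `kernel f` is at most `2‖f -
gₙ‖²` plus twice the approximation error, and both tend to zero. Afterwards the limit definition can
be replaced by kernels. -/
theorem IsPlancherelTransform.ae_eq {f : L2H} {F : ℝ → L2R →L[ℂ] L2R}
    (hF : IsPlancherelTransform f F) : F =ᵐ[volume] opField (kernel f) := by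
  obtain ⟨hm, g, hg, hlim, hT⟩ := hF
  have hm2 := measurableField_opField (Lp.memLp (kernel f))
  have hle : ∀ n, ∫⁻ h : ℝ, hsNormSq (opField (kernel f) h - F h) * ‖h‖ₑ
      ≤ 2 * ‖f - g n‖ₑ ^ 2 +
        2 * ∫⁻ h : ℝ, hsNormSq (fourierOp h (g n) (hg n) - F h) * ‖h‖ₑ := by
    intro n
    rw [← lintegral_opField_kernel_sub, ← lintegral_const_mul' _ _ (by norm_num),
      ← lintegral_const_mul' _ _ (by norm_num), ← lintegral_add_left']
    · refine lintegral_mono_ae ?_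
      filter_upwards [opField_kernel (g n) (hg n)] with h h2
      rw [h2, ← mul_assoc, ← mul_assoc, ← add_mul]
      gcongr
      refine le_trans (le_of_eq ?_) (hsNormSq_add_le _ _)
      congr 1
      abel
    · exact ((hm2.sub (measurableField_opField
        (Lp.memLp (kernel (g n))))).aemeasurable_hsNormSq).const_mul _
  have h2 : Tendsto (fun n => ‖f - g n‖ₑ) atTop (𝓝 0) := by
    have h3 : Tendsto (fun n => f - g n) atTop (𝓝 0) := by simpa using hlim.const_sub f
    simpa [Function.comp_def] using (continuous_enorm.tendsto (0 : L2H)).comp h3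
  have h4 : Tendsto (fun n => 2 * ‖f - g n‖ₑ ^ 2 +
        2 * ∫⁻ h : ℝ, hsNormSq (fourierOp h (g n) (hg n) - F h) * ‖h‖ₑ) atTop (𝓝 0) := by
    have := (ENNReal.Tendsto.const_mul (a := 2) (((ENNReal.continuous_pow 2).tendsto 0).comp h2) (Or.inr (by norm_num))).add
      (ENNReal.Tendsto.const_mul (a := 2) hT (Or.inr (by norm_num)))
    simpa [Function.comp_def] using this
  have h5 : ∫⁻ h : ℝ, hsNormSq (opField (kernel f) h - F h) * ‖h‖ₑ = 0 :=
    le_antisymm (ge_of_tendsto' h4 hle) bot_le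
  rw [lintegral_eq_zero_iff' (hm2.sub hm).aemeasurable_hsNormSq] at h5
  filter_upwards [h5, ae_ne_zero] with h h6 h7
  simp only [Pi.zero_apply, mul_eq_zero, enorm_eq_zero, h7, or_false] at h6
  exact (sub_eq_zero.1 (eq_zero_of_hsNormSq h6)).symm

theorem IsPlancherelTransform.congr {f : L2H} {F G : ℝ → L2R →L[ℂ] L2R}
    (hF : IsPlancherelTransform f F) (h : F =ᵐ[volume] G) : IsPlancherelTransform f G := by
  obtain ⟨hm, g, hg, hlim, hT⟩ := hF
  refine ⟨hm.congr h, g, hg, hlim, ?_⟩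
  refine hT.congr fun n => lintegral_congr_ae ?_
  filter_upwards [h] with r hr
  rw [hr]

/-! ### Left translations in terms of kernels -/

theorem schrodinger_mul (h : ℝ) (x x' : Heis) (φ : L2R) :
    schrodinger h (x * x') φ = schrodinger h x (schrodinger h x' φ) := by
  refine Lp.ext ?_
  have h1 := (memLp_schrodinger h (x * x') φ).coeFn_toLp
  have h2 := (memLp_schrodinger h x (schrodinger h x' φ)).coeFn_toLp
  have h3 := (measurePreserving_add_right volume (h * x.p)).quasiMeasurePreserving.ae_eq_comp
    (memLp_schrodinger h x' φ).coeFn_toLp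
  filter_upwards [h1, h2, h3] with y h1 h2 h3
  refine h1.trans (Eq.trans ?_ h2.symm)
  change _ = phase h x y * ((memLp_schrodinger h x' φ).toLp _ (y + h * x.p))
  simp only [Function.comp_apply] at h3
  rw [h3, ← mul_assoc]
  have e : y + h * (x * x').p = y + h * x.p + h * x'.p := by rw [Heis.mul_p]; ring
  rw [e]
  congr 1
  simp only [phase, ← Complex.exp_add, Heis.mul_p, Heis.mul_q, Heis.mul_t]
  congr 1
  push_cast
  ring

theorem schrodinger_one (h : ℝ) (φ : L2R) : schrodinger h 1 φ = φ := by
  refine Lp.ext ?_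
  filter_upwards [(memLp_schrodinger h 1 φ).coeFn_toLp] with y hy
  refine hy.trans ?_
  simp [phase]

theorem inner_schrodinger_right (h : ℝ) (x : Heis) (ψ φ : L2R) :
    ⟪ψ, schrodinger h x φ⟫_ℂ = ⟪schrodinger h x⁻¹ ψ, φ⟫_ℂ := by
  rw [← (schrodinger h x).inner_map_map (schrodinger h x⁻¹ ψ), ← schrodinger_mul, mul_inv_cancel,
    schrodinger_one]

theorem coeFn_leftReg (x : Heis) (f : L2H) : leftReg x f =ᵐ[volume] fun y => f (x⁻¹ * y) :=
  Lp.coeFn_compMeasurePreserving f (Heis.measurePreserving_mul_left x⁻¹)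

theorem integrable_leftReg (x : Heis) {f : L2H} (hf : Integrable f) : Integrable (leftReg x f) :=
  ((Heis.measurePreserving_mul_left x⁻¹).integrable_comp_of_integrable hf).congr
    (coeFn_leftReg x f).symm

theorem Heis.measurableEmbedding_mul_left (a : Heis) :
    MeasurableEmbedding (fun x : Heis => a * x) :=
  MeasurableEquiv.measurableEmbedding
    { toFun := fun x : Heis => a * x
      invFun := fun x : Heis => a⁻¹ * x
      left_inv := fun x => inv_mul_cancel_left a x
      right_inv := fun x => mul_inv_cancel_left a x
      measurable_toFun := (Heis.measurePreserving_mul_left a).measurable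
      measurable_invFun := (Heis.measurePreserving_mul_left a⁻¹).measurable }

theorem fourierOp_leftReg (h : ℝ) (x : Heis) {f : L2H} (hf : Integrable f) :
    fourierOp h (leftReg x f) (integrable_leftReg x hf)
      = (schrodinger h x).toContinuousLinearMap ∘L fourierOp h f hf := by
  ext1 φ
  refine ext_inner_left ℂ fun ψ => ?_
  change _ = ⟪ψ, schrodinger h x (fourierOp h f hf φ)⟫_ℂ
  rw [inner_schrodinger_right, inner_fourierOp, inner_fourierOp,
    ← (Heis.measurePreserving_mul_left x).integral_comp (Heis.measurableEmbedding_mul_left x)]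
  refine integral_congr_ae ?_
  filter_upwards [(Heis.measurePreserving_mul_left x).quasiMeasurePreserving.ae_eq_comp
    (coeFn_leftReg x f)] with y hy
  simp only [Function.comp_apply, inv_mul_cancel_left] at hy
  rw [hy, schrodinger_mul, inner_schrodinger_right]

theorem measurePreserving_fieldShear (p : ℝ) :
    MeasurePreserving (fun z : ℝ × ℝ => (z.1, z.2 + z.1 * p)) volume volume := by
  refine MeasurePreserving.skew_product (f := fun h : ℝ => h)
    (g := fun h y : ℝ => y + h * p) (MeasurePreserving.id volume) ?_ ?_
  · unfold Function.uncurry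
    fun_prop
  · exact Eventually.of_forall fun h => (measurePreserving_add_right volume (h * p)).map_eq

/-- The action of `x` on fields of kernels. -/
def translate (x : Heis) (K : ℝ × ℝ → L2R) (z : ℝ × ℝ) : L2R :=
  conj (phase z.1 x z.2) • K (z.1, z.2 + z.1 * x.p)

theorem measurable_conj_phase (x : Heis) :
    Measurable (fun z : ℝ × ℝ => conj (phase z.1 x z.2)) := by
  refine Complex.continuous_conj.measurable.comp ?_
  unfold phase
  fun_prop

theorem norm_translate (x : Heis) (K : ℝ × ℝ → L2R) (z : ℝ × ℝ) :
    ‖translate x K z‖ = ‖K (z.1, z.2 + z.1 * x.p)‖ := by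
  rw [translate, norm_smul, RCLike.norm_conj, norm_phase, one_mul]

theorem memLp_translate (x : Heis) {K : ℝ × ℝ → L2R} (hK : MemLp K 2 volume) :
    MemLp (translate x K) 2 volume := by
  have h1 := hK.comp_measurePreserving (measurePreserving_fieldShear x.p)
  refine h1.of_le ((measurable_conj_phase x).aestronglyMeasurable.smul h1.1)
    (Eventually.of_forall fun z => ?_)
  rw [norm_translate]
  rfl

/-- The action of `x` on the space of fields of kernels. -/
def translateLp (x : Heis) (K : KernelSpace) : KernelSpace := (memLp_translate x (Lp.memLp K)).toLp _

theorem isometry_translateLp (x : Heis) : Isometry (translateLp x) := by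
  refine Isometry.of_dist_eq fun K K' => ?_
  rw [dist_eq_norm, dist_eq_norm, Lp.norm_def, Lp.norm_def]
  congr 1
  rw [← eLpNorm_comp_measurePreserving (Lp.aestronglyMeasurable (K - K'))
      (measurePreserving_fieldShear x.p)]
  refine eLpNorm_congr_norm_ae ?_
  filter_upwards [(memLp_translate x (Lp.memLp K)).coeFn_toLp,
    (memLp_translate x (Lp.memLp K')).coeFn_toLp, Lp.coeFn_sub (translateLp x K) (translateLp x K'),
    (measurePreserving_fieldShear x.p).quasiMeasurePreserving.ae_eq_comp (Lp.coeFn_sub K K')]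
    with z h1 h2 h3 h4
  rw [h3, h4, Pi.sub_apply]
  change ‖(memLp_translate x (Lp.memLp K)).toLp _ z - (memLp_translate x (Lp.memLp K')).toLp _ z‖
    = _
  rw [h1, h2, translate, translate, ← smul_sub, norm_smul, RCLike.norm_conj, norm_phase, one_mul]
  rfl

theorem kernel_leftReg_of_integrable (x : Heis) {f : L2H} (hf : Integrable f) :
    kernel (leftReg x f) =ᵐ[volume] translate x (kernel f) := by
  refine ae_eq_of_opField_eq (Lp.memLp _) (memLp_translate x (Lp.memLp _)) ?_
  filter_upwards [opField_kernel _ (integrable_leftReg x hf), opField_kernel f hf,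
    ae_memLp_slice (Lp.memLp (kernel f))] with h h1 h2 h3
  rw [h1, fourierOp_leftReg h x hf, ← h2, opField, opField, ContinuousLinearMap.comp_smul,
    schrodinger_comp_kernelOp h x h3]
  rfl

/-- Both sides are continuous in `f`, so the integrable case suffices; there `ρ_h(λ(x)f) = ρ_h(x)
ρ_h(f)` by invariance of the measure. -/
theorem kernel_leftReg (x : Heis) (f : L2H) :
    kernel (leftReg x f) =ᵐ[volume] translate x (kernel f) := by
  have key : kernel (leftReg x f) = translateLp x (kernel f) := by
    refine denseRange_integrableL2.induction_on
      (p := fun f => kernel (leftReg x f) = translateLp x (kernel f)) f ?_ fun g => ?_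
    · exact isClosed_eq (kernel.continuous.comp (leftReg x).continuous)
        ((isometry_translateLp x).continuous.comp kernel.continuous)
    · refine Lp.ext ((kernel_leftReg_of_integrable x (integrable_coe g)).trans ?_)
      exact (memLp_translate x (Lp.memLp _)).coeFn_toLp.symm
  rw [key]
  exact (memLp_translate x (Lp.memLp _)).coeFn_toLp

/-- The matrix coefficients of the left regular representation. -/
theorem inner_leftReg (x : Heis) (f g : L2H) :
    ⟪leftReg x f, g⟫_ℂ = ∫ z : ℝ × ℝ, conj (phase z.1 x z.2) *
      ⟪kernel g z, kernel f (z.1, z.2 + z.1 * x.p)⟫_ℂ := by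
  rw [← inner_kernel, L2.inner_def]
  refine integral_congr_ae ?_
  filter_upwards [kernel_leftReg x f] with z hz
  rw [hz, translate, inner_smul_right]

end Plancherel

/-! ### Orthogonality relations -/

section Orthogonality

open scoped ComplexConjugate

theorem integrable_inner_of_memLp {X E : Type*} [MeasurableSpace X] {μ : Measure X}
    [NormedAddCommGroup E] [InnerProductSpace ℂ E] {f g : X → E} (hf : MemLp f 2 μ)
    (hg : MemLp g 2 μ) : Integrable (fun x => ⟪f x, g x⟫_ℂ) μ := by
  refine (L2.integrable_inner (𝕜 := ℂ) (hf.toLp f) (hg.toLp g)).congr ?_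
  filter_upwards [hf.coeFn_toLp, hg.coeFn_toLp] with x h1 h2
  rw [h1, h2]

/-- The overlap `⟨K_g(h, y), K_f(h, y + hp)⟩` of two fields of kernels. -/
def overlap (f g : L2H) (p : ℝ) (z : ℝ × ℝ) : ℂ :=
  ⟪kernel g z, kernel f (z.1, z.2 + z.1 * p)⟫_ℂ

theorem stronglyMeasurable_overlap (f g : L2H) :
    StronglyMeasurable (fun a : ℝ × (ℝ × ℝ) => overlap f g a.1 a.2) :=
  ((Lp.stronglyMeasurable (kernel g)).comp_measurable measurable_snd).inner
    ((Lp.stronglyMeasurable (kernel f)).comp_measurable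
      (g := fun a : ℝ × (ℝ × ℝ) => (a.2.1, a.2.2 + a.2.1 * a.1)) (by fun_prop))

theorem integrable_overlap (f g : L2H) (p : ℝ) : Integrable (overlap f g p) :=
  integrable_inner_of_memLp (Lp.memLp (kernel g))
    ((Lp.memLp (kernel f)).comp_measurePreserving (measurePreserving_fieldShear p))

theorem measurableEmbedding_fieldShear (p : ℝ) :
    MeasurableEmbedding (fun z : ℝ × ℝ => (z.1, z.2 + z.1 * p)) :=
  MeasurableEquiv.measurableEmbedding
    { toFun := fun z : ℝ × ℝ => (z.1, z.2 + z.1 * p)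
      invFun := fun z : ℝ × ℝ => (z.1, z.2 - z.1 * p)
      left_inv := fun z => by simp
      right_inv := fun z => by simp
      measurable_toFun := (measurePreserving_fieldShear p).measurable
      measurable_invFun := by
        change Measurable (fun z : ℝ × ℝ => (z.1, z.2 - z.1 * p))
        fun_prop }

/-- The shear by `-p/2` absorbs the factor `e^{πihpq}` of the phase; what remains is a pure
character of `(h, y)` with frequency `(t, q)`. -/
theorem inner_leftReg_eq_planeFourier (f g : L2H) (p q t : ℝ) :
    ⟪leftReg (Heis.mk p q t) f, g⟫_ℂ
      = planeFourier (fun z => overlap f g p (z.1, z.2 + z.1 * (-p / 2))) (t, q) := by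
  rw [inner_leftReg, ← (measurePreserving_fieldShear (-p / 2)).integral_comp
    (measurableEmbedding_fieldShear _), planeFourier]
  refine integral_congr_ae (Eventually.of_forall fun z => ?_)
  simp only [overlap, Heis.mk, Heis.p, Heis.q, Heis.t, phase]
  congr 1
  rw [← Complex.exp_add, ← Complex.exp_add, ← Complex.exp_conj]
  congr 1
  simp only [map_add, map_mul, Complex.conj_I, Complex.conj_ofReal, map_ofNat]
  push_cast
  ring

theorem stronglyMeasurable_coeff (f g : L2H) :
    StronglyMeasurable (fun x : Heis => ⟪leftReg x f, g⟫_ℂ) := by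
  simp_rw [inner_leftReg]
  refine StronglyMeasurable.integral_prod_right (f := fun (x : Heis) (z : ℝ × ℝ) =>
    conj (phase z.1 x z.2) * ⟪kernel g z, kernel f (z.1, z.2 + z.1 * x.p)⟫_ℂ) ?_
  have hp := Heis.measurable_p
  have hq := Heis.measurable_q
  have ht := Heis.measurable_t
  refine StronglyMeasurable.mul ?_ ?_
  · refine Measurable.stronglyMeasurable (Complex.continuous_conj.measurable.comp ?_)
    unfold phase
    fun_prop
  · exact ((Lp.stronglyMeasurable (kernel g)).comp_measurable measurable_snd).inner
      ((Lp.stronglyMeasurable (kernel f)).comp_measurable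
        (g := fun a : Heis × (ℝ × ℝ) => (a.2.1, a.2.2 + a.2.1 * a.1.p)) (by fun_prop))

theorem ae_of_ae_affine {Q : ℝ → Prop} {h : ℝ} (h0 : h ≠ 0) {y : ℝ}
    (hQ : ∀ᵐ p : ℝ, Q (y + h * p)) : ∀ᵐ u : ℝ, Q u := by
  filter_upwards [(quasiMeasurePreserving_affine (inv_ne_zero h0) (-y / h)).ae hQ] with u hu
  have : y + h * (-y / h + h⁻¹ * u) = u := by field_simp; ring
  rwa [this] at hu

/-- If `g` is orthogonal to all translates of `f`, then the kernels of `f` and `g` are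
orthogonal fibrewise. -/
theorem ae_inner_kernel_eq_zero {f g : L2H} (h : ∀ x, ⟪leftReg x f, g⟫_ℂ = 0) :
    ∀ᵐ z : ℝ × ℝ, ∀ᵐ u : ℝ, ⟪kernel g z, kernel f (z.1, u)⟫_ℂ = 0 := by
  have h1 : ∀ p : ℝ, ∀ᵐ z : ℝ × ℝ, overlap f g p z = 0 := by
    intro p
    have h2 := ae_eq_zero_of_planeFourier_eq_zero
      ((measurePreserving_fieldShear (-p / 2)).integrable_comp_of_integrable
        (integrable_overlap f g p)) (fun w => by
          have := h (Heis.mk p w.2 w.1)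
          rwa [inner_leftReg_eq_planeFourier] at this)
    have h3 := (measurePreserving_fieldShear (p / 2)).quasiMeasurePreserving.ae_eq_comp h2
    filter_upwards [h3] with z hz
    simp only [Function.comp_apply, Pi.zero_apply] at hz
    rw [← hz]
    congr 1
    refine Prod.ext rfl ?_
    simp only
    ring
  have h2 : ∀ᵐ z : ℝ × ℝ, ∀ᵐ p : ℝ, overlap f g p z = 0 := by
    -- The null set of `z` depends on `p`; Fubini exchanges the two quantifiers.
    rw [← Measure.ae_ae_comm]
    · exact Eventually.of_forall h1
    · exact measurableSet_eq_fun (stronglyMeasurable_overlap f g).measurable measurable_const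
  filter_upwards [h2, ae_fst_ne_zero] with z hz hz0
  exact ae_of_ae_affine hz0 hz

/-- The norm estimate that corresponds to the orthogonality relations of the Schrödinger
representations. -/
theorem lintegral_coeff_le (f g : L2H) :
    ∫⁻ x : Heis, ‖⟪leftReg x f, g⟫_ℂ‖ₑ ^ 2
      ≤ ∫⁻ z : ℝ × ℝ, ‖z.1‖ₑ⁻¹ * ∫⁻ u : ℝ, ‖⟪kernel g z, kernel f (z.1, u)⟫_ℂ‖ₑ ^ 2 := by
  have hm := stronglyMeasurable_coeff f g
  calc ∫⁻ x : Heis, ‖⟪leftReg x f, g⟫_ℂ‖ₑ ^ 2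
      = ∫⁻ p : ℝ, ∫⁻ w : ℝ × ℝ, ‖⟪leftReg (Heis.mk p w.1 w.2) f, g⟫_ℂ‖ₑ ^ 2 := by
        rw [← Heis.measurePreserving_mk.lintegral_comp_emb Heis.measurableEmbedding_mk]
        exact lintegral_volume_prod ((hm.comp_measurable
          Heis.measurePreserving_mk.measurable).enorm.pow_const 2).aemeasurable
    _ ≤ ∫⁻ p : ℝ, ∫⁻ z : ℝ × ℝ, ‖overlap f g p z‖ₑ ^ 2 := by
        refine lintegral_mono fun p => ?_
        rw [← (measurePreserving_fieldShear (-p / 2)).lintegral_comp_emb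
          (measurableEmbedding_fieldShear _) (fun z => ‖overlap f g p z‖ₑ ^ 2)]
        have hi : Integrable (fun z : ℝ × ℝ => overlap f g p (z.1, z.2 + z.1 * (-p / 2))) :=
          (measurePreserving_fieldShear (-p / 2)).integrable_comp_of_integrable
          (integrable_overlap f g p)
        -- The overlap is known to be integrable but perhaps not square-integrable. Without
        -- finiteness the bound is trivial, which is why only an inequality is asserted.
        by_cases hfin : ∫⁻ z : ℝ × ℝ, ‖overlap f g p (z.1, z.2 + z.1 * (-p / 2))‖ₑ ^ 2 < ∞
        · have hL : MemLp (fun z : ℝ × ℝ => overlap f g p (z.1, z.2 + z.1 * (-p / 2))) 2 volume :=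
            memLp_two_iff.2 ⟨hi.1, hfin⟩
          rw [← lintegral_planeFourier hi hL]
          refine le_of_eq (Eq.trans (lintegral_congr fun w => ?_) ((Measure.measurePreserving_swap
            (μ := (volume : Measure ℝ)) (ν := (volume : Measure ℝ))).lintegral_comp_emb
            (MeasurableEquiv.prodComm).measurableEmbedding (fun w => ‖planeFourier (fun z =>
              overlap f g p (z.1, z.2 + z.1 * (-p / 2))) w‖ₑ ^ 2)))
          rw [inner_leftReg_eq_planeFourier]
          rfl
        · rw [not_lt_top_iff.1 hfin]
          exact le_top
    _ = ∫⁻ z : ℝ × ℝ, ∫⁻ p : ℝ, ‖overlap f g p z‖ₑ ^ 2 := by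
        rw [lintegral_lintegral_swap]
        exact ((stronglyMeasurable_overlap f g).enorm.pow_const 2).aemeasurable
    _ = ∫⁻ z : ℝ × ℝ, ‖z.1‖ₑ⁻¹ * ∫⁻ u : ℝ, ‖⟪kernel g z, kernel f (z.1, u)⟫_ℂ‖ₑ ^ 2 := by
        refine lintegral_congr_ae ?_
        filter_upwards [ae_fst_ne_zero] with z hz
        rw [lintegral_affine (g := fun u => ‖⟪kernel g z, kernel f (z.1, u)⟫_ℂ‖ₑ ^ 2) _ hz z.2,
          ← mul_assoc, ENNReal.inv_mul_cancel (by simpa using hz)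
          enorm_ne_top, one_mul]
        · rfl
        · exact ((stronglyMeasurable_const.inner ((Lp.stronglyMeasurable
            (kernel f)).comp_measurable (by fun_prop))).enorm.pow_const 2)

end Orthogonality

/-! ### The field of projections of an invariant subspace -/

section ProjectionField

open scoped ComplexConjugate

instance : SecondCountableTopology L2H := inferInstance

theorem proj_mem (H : ClosedSubmodule ℂ L2H) (f : L2H) : proj H f ∈ H := by
  have : CompleteSpace H.toSubmodule := H.isClosed.completeSpace_coe
  exact H.toSubmodule.starProjection_apply_mem f

theorem inner_sub_proj (H : ClosedSubmodule ℂ L2H) (f : L2H) {g : L2H} (hg : g ∈ H) :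
    ⟪g, f - proj H f⟫_ℂ = 0 := by
  have : CompleteSpace H.toSubmodule := H.isClosed.completeSpace_coe
  have := H.toSubmodule.sub_starProjection_mem_orthogonal f
  exact (Submodule.mem_orthogonal _ _).1 this g hg

theorem proj_eq_self (H : ClosedSubmodule ℂ L2H) {f : L2H} (hf : f ∈ H) : proj H f = f := by
  have : CompleteSpace H.toSubmodule := H.isClosed.completeSpace_coe
  exact Submodule.starProjection_eq_self_iff.2 hf

theorem ae_projection_of_ae {P : ℝ → L2R →L[ℂ] L2R} (hP : ∀ᵐ h : ℝ, IsStarProjection (P h)) :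
    ∀ᵐ z : ℝ × ℝ, IsStarProjection (P z.1) :=
  Measure.quasiMeasurePreserving_fst.ae hP

/-- The kernels of the projection of `f` onto `H`. -/
theorem IsProjectionField.kernel_proj {H : ClosedSubmodule ℂ L2H} {P : ℝ → L2R →L[ℂ] L2R}
    (hP : IsProjectionField H P) (f : L2H) :
    kernel (proj H f) =ᵐ[volume] fun z => P z.1 (kernel f z) := by
  have h1 := (hP.decomp f _ (isPlancherelTransform_opField f)).ae_eq
  refine ae_eq_of_opField_eq (Lp.memLp _)
    (memLp_projection_kernel hP.measurable hP.isProj (Lp.memLp _)) ?_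
  filter_upwards [h1, opField_comp hP.isProj (Lp.memLp (kernel f))] with h h2 h3
  rw [← h2, h3]

theorem IsProjectionField.kernel_of_mem {H : ClosedSubmodule ℂ L2H} {P : ℝ → L2R →L[ℂ] L2R}
    (hP : IsProjectionField H P) {f : L2H} (hf : f ∈ H) :
    ∀ᵐ z : ℝ × ℝ, P z.1 (kernel f z) = kernel f z := by
  have := hP.kernel_proj f
  rw [proj_eq_self H hf] at this
  filter_upwards [this] with z hz using hz.symm

/-- With `IsProjectionField.kernel_of_mem` this describes `H` as the set of `f` whose kernels lie
fibrewise in the range of `P`; elements of `H` can thus be built by prescribing kernels. -/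
theorem IsProjectionField.mem_of_kernel {H : ClosedSubmodule ℂ L2H} {P : ℝ → L2R →L[ℂ] L2R}
    (hP : IsProjectionField H P) {f : L2H}
    (hf : ∀ᵐ z : ℝ × ℝ, P z.1 (kernel f z) = kernel f z) : f ∈ H := by
  have h1 : kernel (proj H f) = kernel f := Lp.ext ((hP.kernel_proj f).trans hf)
  rw [← kernel_injective h1]
  exact proj_mem H f

/-- The projections onto the closed spans of a measurable sequence of vector fields form a
measurable field. -/
theorem measurableField_closedSpan {v : ℕ → ℝ → L2R} (hv : ∀ n, StronglyMeasurable (v n)) :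
    MeasurableField (fun h => (closedSpan (fun n => v n h)).starProjection) := by
  intro ψ φ
  refine aemeasurable_of_tendsto_metrizable_ae atTop (f := fun (N : ℕ) h =>
    ⟪ψ, ∑ n ∈ Finset.range N, ⟪InnerProductSpace.gramSchmidtNormed ℂ (fun n => v n h) n, φ⟫_ℂ •
      InnerProductSpace.gramSchmidtNormed ℂ (fun n => v n h) n⟫_ℂ) (fun N => ?_)
      (Eventually.of_forall fun h => ?_)
  · refine (stronglyMeasurable_const.inner (Finset.stronglyMeasurable_fun_sum _ fun n _ =>
      ?_)).measurable.aemeasurable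
    have := stronglyMeasurable_gramSchmidtNormed hv n
    exact (StronglyMeasurable.inner (𝕜 := ℂ) this stronglyMeasurable_const).smul this
  · exact Tendsto.inner (𝕜 := ℂ) tendsto_const_nhds
      (hasSum_gramSchmidtNormed (fun n => v n h) φ).tendsto_sum_nat

theorem starProjection_closedSpan_eq_zero {v : ℕ → L2R} {u : L2R} (h : ∀ n, ⟪v n, u⟫_ℂ = 0) :
    (closedSpan v).starProjection u = 0 := by
  rw [Submodule.starProjection_apply_eq_zero_iff, Submodule.orthogonal_closure,
    Submodule.mem_orthogonal]
  intro z hz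
  induction hz using Submodule.span_induction with
  | mem z hz => obtain ⟨n, rfl⟩ := hz; exact h n
  | zero => simp
  | add a b _ _ ha hb => rw [inner_add_left, ha, hb, add_zero]
  | smul c a _ ha => rw [inner_smul_left, ha, mul_zero]

theorem inner_sub_starProjection_closedSpan (v : ℕ → L2R) (u : L2R) (n : ℕ) :
    ⟪v n, u - (closedSpan v).starProjection u⟫_ℂ = 0 :=
  (Submodule.mem_orthogonal _ _).1 ((closedSpan v).sub_starProjection_mem_orthogonal u) _
    (Submodule.le_topologicalClosure _ (Submodule.subset_span ⟨n, rfl⟩))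

theorem eq_zero_of_inner_denseSeq {u : L2R}
    (h : ∀ m, ⟪TopologicalSpace.denseSeq L2R m, u⟫_ℂ = 0) : u = 0 := by
  exact (TopologicalSpace.denseRange_denseSeq L2R).eq_zero_of_inner_right (𝕜 := ℂ) h

/-- The span of the rows of the kernels of a sequence, as a field of subspaces. -/
theorem exists_rowProjection (f : ℕ → L2H) : ∃ P : ℝ → L2R →L[ℂ] L2R, MeasurableField P ∧
    (∀ h, IsStarProjection (P h)) ∧
    (∀ n, ∀ᵐ z : ℝ × ℝ, P z.1 (kernel (f n) z) = kernel (f n) z) ∧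
    (∀ᵐ h : ℝ, ∀ u : L2R, (∀ n, opField (kernel (f n)) h u = 0) → P h u = 0) := by
  let T : ℕ → ℝ → L2R →L[ℂ] L2R := fun n => opField (kernel (f n))
  let d := TopologicalSpace.denseSeq L2R
  have hT : ∀ n, MeasurableField (T n) := fun n => measurableField_opField (Lp.memLp _)
  -- The rows span the range of the adjoint operators, which the images of a dense sequence already
  -- exhaust up to closure. The pair (operator, vector) is coded by one index.
  have ha : ∀ k : ℕ, AEStronglyMeasurable (fun h =>
      ContinuousLinearMap.adjoint (T k.unpair.1 h) (d k.unpair.2)) volume := by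
    intro k
    refine aestronglyMeasurable_of_inner fun v => ?_
    simp only [ContinuousLinearMap.adjoint_inner_right]
    have := Complex.continuous_conj.measurable.comp_aemeasurable (hT k.unpair.1 (d k.unpair.2) v)
    refine this.congr (Eventually.of_forall fun h => ?_)
    exact inner_conj_symm _ _
  let v : ℕ → ℝ → L2R := fun k => (ha k).mk _
  have hv : ∀ k, StronglyMeasurable (v k) := fun k => (ha k).stronglyMeasurable_mk
  have hav : ∀ᵐ h : ℝ, ∀ n m, v (Nat.pair n m) h = ContinuousLinearMap.adjoint (T n h) (d m) := by
    have : ∀ᵐ h : ℝ, ∀ k : ℕ, v k h =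
        ContinuousLinearMap.adjoint (T k.unpair.1 h) (d k.unpair.2) :=
      ae_all_iff.2 fun k => (ha k).ae_eq_mk.symm
    filter_upwards [this] with h hh n m
    simpa using hh (Nat.pair n m)
  let P : ℝ → L2R →L[ℂ] L2R := fun h => (closedSpan (fun k => v k h)).starProjection
  have hPm : MeasurableField P := measurableField_closedSpan hv
  have hPp : ∀ h, IsStarProjection (P h) := fun h => isStarProjection_starProjection
  refine ⟨P, hPm, hPp, fun n => ?_, ?_⟩
  · refine ae_eq_of_opField_eq (memLp_projection_kernel hPm (Eventually.of_forall hPp)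
      (Lp.memLp (kernel (f n)))) (Lp.memLp _) ?_
    filter_upwards [hav, opField_comp (Eventually.of_forall hPp) (Lp.memLp (kernel (f n)))]
      with h h1 h2
    rw [← h2]
    ext1 φ
    symm
    rw [← sub_eq_zero, ContinuousLinearMap.comp_apply, ← map_sub]
    refine eq_zero_of_inner_denseSeq fun m => ?_
    rw [← ContinuousLinearMap.adjoint_inner_left]
    have := inner_sub_starProjection_closedSpan (fun k => v k h) φ (Nat.pair n m)
    rwa [h1] at this
  · filter_upwards [hav] with h h1 u hu
    refine starProjection_closedSpan_eq_zero fun k => ?_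
    have h2 := h1 k.unpair.1 k.unpair.2
    rw [Nat.pair_unpair] at h2
    rw [h2, ContinuousLinearMap.adjoint_inner_left]
    change ⟪_, opField (kernel (f k.unpair.1)) h u⟫_ℂ = 0
    rw [hu, inner_zero_right]

/-- Only the vanishing of `P` on kernels of `H`'s orthogonal complement uses invariance. That
kernels of elements of `H` are fixed follows by a duality argument from the dense sequence. -/
theorem exists_isProjectionField (H : ClosedSubmodule ℂ L2H)
    (hH : LeftInvariant H.toSubmodule) : ∃ P : ℝ → L2R →L[ℂ] L2R, IsProjectionField H P := by
  obtain ⟨s, hs⟩ := TopologicalSpace.exists_dense_seq H.toSubmodule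
  obtain ⟨P, hPm, hPp, hrow, hker⟩ := exists_rowProjection fun n => (s n : L2H)
  have hPp' : ∀ᵐ h : ℝ, IsStarProjection (P h) := Eventually.of_forall hPp
  -- the orthogonal complement of `H` is killed by `P`
  have hperp : ∀ g : L2H, (∀ f ∈ H, ⟪f, g⟫_ℂ = 0) → ∀ᵐ z : ℝ × ℝ, P z.1 (kernel g z) = 0 := by
    intro g hg
    have h1 : ∀ n, ∀ᵐ z : ℝ × ℝ, ∀ᵐ u : ℝ,
        ⟪kernel g z, kernel (s n : L2H) (z.1, u)⟫_ℂ = 0 := fun n =>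
      ae_inner_kernel_eq_zero fun x => hg _ (hH x _ (s n).2)
    have h2 : ∀ᵐ z : ℝ × ℝ, ∀ n, MemLp (fun y => kernel (s n : L2H) (z.1, y)) 2 volume :=
      ae_all_iff.2 fun n => Measure.quasiMeasurePreserving_fst.ae (ae_memLp_slice (Lp.memLp _))
    filter_upwards [ae_all_iff.2 h1, h2, Measure.quasiMeasurePreserving_fst.ae hker]
      with z h3 h4 h5
    refine h5 _ fun n => ?_
    rw [opField, _root_.smul_apply]
    have : kernelOp (fun y => kernel (s n : L2H) (z.1, y)) (kernel g z) = 0 := by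
      refine Lp.ext ?_
      filter_upwards [coeFn_kernelOp (h4 n) (kernel g z), h3 n,
        Lp.coeFn_zero ℂ 2 (volume : Measure ℝ)] with y h6 h7 h8
      rw [h6, h8, ← inner_conj_symm, h7]
      simp
    rw [this, smul_zero]
  have hmem : ∀ f ∈ H, ∀ᵐ z : ℝ × ℝ, P z.1 (kernel f z) = kernel f z := by
    intro f hf
    have hK := memLp_projection_kernel hPm hPp' (Lp.memLp (kernel f))
    -- The part of `kernel f` outside the range of `P` is the kernel of some `g`. It is orthogonal
    -- to the dense sequence, hence to `H` and to `f`, and therefore to itself.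
    obtain ⟨g, hg⟩ := exists_kernel_ae_eq ((Lp.memLp (kernel f)).sub hK)
    have hgn : ∀ n, ⟪(s n : L2H), g⟫_ℂ = 0 := by
      intro n
      rw [← inner_kernel, L2.inner_def, ← integral_zero (ℝ × ℝ) ℂ]
      refine integral_congr_ae ?_
      filter_upwards [hg, hrow n] with z h1 h2
      rw [h1, ← h2, ← ContinuousLinearMap.adjoint_inner_left, (hPp z.1).isSelfAdjoint.adjoint_eq]
      have h3 : P z.1 (P z.1 (kernel f z)) = P z.1 (kernel f z) := by
        have := congrArg (fun A : L2R →L[ℂ] L2R => A (kernel f z)) (hPp z.1).isIdempotentElem.eq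
        exact this
      rw [Pi.sub_apply, map_sub, h3, sub_self, inner_zero_left]
    have hgH : ∀ f' ∈ H, ⟪f', g⟫_ℂ = 0 := by
      intro f' hf'
      refine hs.induction_on (p := fun x : H.toSubmodule => ⟪(x : L2H), g⟫_ℂ = 0) ⟨f', hf'⟩ ?_ hgn
      exact isClosed_eq (continuous_subtype_val.inner continuous_const) continuous_const
    have h1 : ⟪kernel g, kernel f⟫_ℂ = 0 := by rw [inner_kernel]; exact hgH f hf
    have h2 : ⟪kernel g, kernel f⟫_ℂ = ⟪kernel g, kernel g⟫_ℂ := by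
      rw [L2.inner_def, L2.inner_def]
      refine integral_congr_ae ?_
      filter_upwards [hg, hperp g hgH] with z h3 h4
      have h5 : ⟪kernel g z, P z.1 (kernel f z)⟫_ℂ = 0 := by
        rw [← ContinuousLinearMap.adjoint_inner_left, (hPp z.1).isSelfAdjoint.adjoint_eq, h4,
          inner_zero_left]
      have h6 : kernel f z = kernel g z + P z.1 (kernel f z) := by
        rw [h3, Pi.sub_apply, sub_add_cancel]
      conv_lhs => rw [h6, inner_add_right, h5, add_zero]
    have h3 : kernel g = 0 := by
      rw [h1] at h2
      exact inner_self_eq_zero.1 h2.symm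
    rw [h3] at hg
    filter_upwards [hg, Lp.coeFn_zero L2R 2 (volume : Measure (ℝ × ℝ))] with z h4 h5
    rw [h5, Pi.sub_apply] at h4
    exact (sub_eq_zero.1 h4.symm).symm
  refine ⟨P, hPm, hPp', fun f F hF => ?_⟩
  refine (isPlancherelTransform_opField (proj H f)).congr ?_
  have h1 : kernel (proj H f) =ᵐ[volume] fun z => P z.1 (kernel f z) := by
    have h2 := hmem _ (proj_mem H f)
    have h3 := hperp (f - proj H f) fun g hg => inner_sub_proj H f hg
    rw [map_sub] at h3
    filter_upwards [h2, h3, Lp.coeFn_sub (kernel f) (kernel (proj H f))] with z h4 h5 h6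
    rw [h6, Pi.sub_apply, map_sub, sub_eq_zero] at h5
    rw [h5, h4]
  filter_upwards [hF.ae_eq, opField_congr h1, opField_comp hPp' (Lp.memLp (kernel f))]
    with h h2 h3 h4
  rw [h2, h4, h3]

end ProjectionField

/-! ### Lattices -/

section Lattices

@[simp] theorem Heis.mk_p (p q t : ℝ) : (Heis.mk p q t).p = p := rfl
@[simp] theorem Heis.mk_q (p q t : ℝ) : (Heis.mk p q t).q = q := rfl
@[simp] theorem Heis.mk_t (p q t : ℝ) : (Heis.mk p q t).t = t := rfl

theorem Heis.measurePreserving_mul_right (a : Heis) :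
    MeasurePreserving (fun x : Heis => x * a) volume volume := by
  have h3 : ∀ y : ℝ, MeasurePreserving (fun z : ℝ × ℝ =>
      (z.1 + a.q, z.2 + a.t + (y * a.q - z.1 * a.p) / 2)) volume volume := by
    intro y
    refine MeasurePreserving.skew_product (f := fun u : ℝ => u + a.q)
      (g := fun (u v : ℝ) => v + a.t + (y * a.q - u * a.p) / 2)
      (measurePreserving_add_right volume a.q) (by unfold Function.uncurry; fun_prop) ?_
    refine Eventually.of_forall fun u => ?_
    simp only [add_assoc]
    exact (measurePreserving_add_right volume _).map_eq
  exact MeasurePreserving.skew_product (f := fun u : ℝ => u + a.p)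
      (g := fun (y : ℝ) (z : ℝ × ℝ) => (z.1 + a.q, z.2 + a.t + (y * a.q - z.1 * a.p) / 2))
      (measurePreserving_add_right volume a.p) (by unfold Function.uncurry; fun_prop)
      (Eventually.of_forall fun y => (h3 y).map_eq)

theorem Heis.measurableEmbedding_mul_right (a : Heis) :
    MeasurableEmbedding (fun x : Heis => x * a) :=
  MeasurableEquiv.measurableEmbedding
    { toFun := fun x : Heis => x * a
      invFun := fun x : Heis => x * a⁻¹
      left_inv := fun x => mul_inv_cancel_right x a
      right_inv := fun x => inv_mul_cancel_right x a
      measurable_toFun := (Heis.measurePreserving_mul_right a).measurable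
      measurable_invFun := (Heis.measurePreserving_mul_right a⁻¹).measurable }

theorem IsLattice.countable {Γ : Subgroup Heis} (hΓ : IsLattice Γ) : Countable Γ := by
  have := hΓ.discrete
  exact countable_of_Lindelof_of_discrete

variable {Γ : Subgroup Heis} {A : Set Heis}

theorem tsum_indicator_eq_one {x : Heis} (hA : ∃! γ : Γ, x * γ ∈ A) :
    ∑' γ : Γ, A.indicator (fun _ => (1 : ℝ≥0∞)) (x * γ) = 1 := by
  obtain ⟨γ, hγ, huniq⟩ := hA
  rw [tsum_eq_single γ]
  · rw [Set.indicator_of_mem hγ]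
  · intro γ' hne
    exact Set.indicator_of_notMem (fun h => hne (huniq γ' h)) _

/-- Integration over the group as integration over a fundamental domain. -/
theorem lintegral_eq_setLIntegral_tsum [Countable Γ] (hAm : MeasurableSet A)
    (hA : ∀ x : Heis, ∃! γ : Γ, x * γ ∈ A) {F : Heis → ℝ≥0∞} (hF : Measurable F) :
    ∫⁻ x, F x = ∫⁻ x in A, ∑' γ : Γ, F (x * γ) := by
  have hI : Measurable (A.indicator fun _ => (1 : ℝ≥0∞)) := measurable_const.indicator hAm
  have hr : ∀ a : Heis, Measurable (fun x : Heis => x * a) := fun a =>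
    (Heis.measurePreserving_mul_right a).measurable
  -- Unfolding: insert the partition of unity by translates of `A`, move each translate to `A`, and
  -- exchange `γ` with its inverse.
  calc ∫⁻ x, F x = ∫⁻ x, ∑' γ : Γ, A.indicator (fun _ => (1 : ℝ≥0∞)) (x * γ) * F x := by
        refine lintegral_congr fun x => ?_
        rw [ENNReal.tsum_mul_right, tsum_indicator_eq_one (hA x), one_mul]
    _ = ∑' γ : Γ, ∫⁻ x, A.indicator (fun _ => (1 : ℝ≥0∞)) (x * γ) * F x :=
        lintegral_tsum fun γ => ((hI.comp (hr γ)).mul hF).aemeasurable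
    _ = ∑' γ : Γ, ∫⁻ x, A.indicator (fun _ => (1 : ℝ≥0∞)) x * F (x * ((γ⁻¹ : Γ) : Heis)) := by
        refine tsum_congr fun γ => ?_
        rw [← (Heis.measurePreserving_mul_right ((γ⁻¹ : Γ) : Heis)).lintegral_comp_emb
          (Heis.measurableEmbedding_mul_right _)]
        refine lintegral_congr fun x => ?_
        rw [Subgroup.coe_inv, inv_mul_cancel_right]
    _ = ∑' γ : Γ, ∫⁻ x, A.indicator (fun _ => (1 : ℝ≥0∞)) x * F (x * γ) :=
        (Equiv.inv Γ).tsum_eq fun γ : Γ =>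
          ∫⁻ x, A.indicator (fun _ => (1 : ℝ≥0∞)) x * F (x * γ)
    _ = ∫⁻ x, ∑' γ : Γ, A.indicator (fun _ => (1 : ℝ≥0∞)) x * F (x * γ) :=
        (lintegral_tsum fun γ : Γ => (hI.mul (hF.comp (hr γ))).aemeasurable).symm
    _ = ∫⁻ x in A, ∑' γ : Γ, F (x * γ) := by
        rw [← lintegral_indicator hAm]
        refine lintegral_congr fun x => ?_
        rw [ENNReal.tsum_mul_left]
        by_cases hx : x ∈ A <;> simp [hx]

theorem volume_heis_univ : volume (Set.univ : Set Heis) = ∞ := by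
  change (volume : Measure (ℝ × ℝ × ℝ)) Set.univ = ∞
  rw [Measure.volume_eq_prod, ← Set.univ_prod_univ, Measure.prod_prod, Measure.volume_eq_prod,
    ← Set.univ_prod_univ, Measure.prod_prod]
  simp

/-- By unfolding, a null fundamental domain would make the whole group null. -/
theorem volume_fundamentalDomain_ne_zero [Countable Γ] (hAm : MeasurableSet A)
    (hA : ∀ x : Heis, ∃! γ : Γ, x * γ ∈ A) : volume A ≠ 0 := by
  intro h0
  have h := lintegral_eq_setLIntegral_tsum hAm hA (F := fun _ => 1) measurable_const
  rw [lintegral_const, volume_heis_univ, Measure.restrict_eq_zero.2 h0] at h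
  simp at h

/-- No nonzero linear form in `(p, q)` vanishes on a lattice. -/
theorem IsLattice.eq_zero_of_form {a b : ℝ} (hΓ : IsLattice Γ)
    (h : ∀ γ ∈ Γ, a * γ.p + b * γ.q = 0) : a = 0 ∧ b = 0 := by
  have := hΓ.countable
  obtain ⟨A, hAm, hA, hfin⟩ := hΓ.finite_covolume
  by_contra hab
  have hpos : 0 < a ^ 2 + b ^ 2 := by
    rw [not_and_or] at hab
    rcases hab with h0 | h0 <;> positivity
  have hp := Heis.measurable_p
  have hq := Heis.measurable_q
  let ℓ : Heis → ℝ := fun x => a * x.p + b * x.q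
  have hℓ : Measurable ℓ := by fun_prop
  have hmul : ∀ x y, ℓ (x * y) = ℓ x + ℓ y := fun x y => by
    simp only [ℓ, Heis.mul_p, Heis.mul_q]; ring
  -- Infinitely many disjoint strips of equal measure cannot exhaust `A`, whose measure is positive
  -- and finite. They have equal measure because left translation by `s` with `ℓ s = n` moves `A` to
  -- another fundamental domain, while `ℓ` is unchanged by `Γ`.
  have hstrip : ∀ n : ℤ, volume (A ∩ ℓ ⁻¹' Set.Ico (n : ℝ) (n + 1))
      = volume (A ∩ ℓ ⁻¹' Set.Ico (0 : ℝ) 1) := by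
    intro n
    let s : Heis := Heis.mk (n * a / (a ^ 2 + b ^ 2)) (n * b / (a ^ 2 + b ^ 2)) 0
    have hs : ℓ s = n := by
      simp only [ℓ, s, Heis.mk_p, Heis.mk_q]
      field_simp
    have hsm : Measurable (fun x : Heis => s * x) := (Heis.measurePreserving_mul_left s).measurable
    have hsA : MeasurableSet {x : Heis | s * x ∈ A} := hAm.preimage hsm
    have hB : MeasurableSet (ℓ ⁻¹' Set.Ico (0 : ℝ) 1) := hℓ measurableSet_Ico
    have h1 : volume (A ∩ ℓ ⁻¹' Set.Ico (n : ℝ) (n + 1))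
        = volume ({x : Heis | s * x ∈ A} ∩ ℓ ⁻¹' Set.Ico (0 : ℝ) 1) := by
      rw [← (Heis.measurePreserving_mul_left s).measure_preimage
        (hAm.inter (hℓ measurableSet_Ico)).nullMeasurableSet]
      congr 1
      ext x
      simp only [Set.mem_preimage, Set.mem_inter_iff, Set.mem_Ico, Set.mem_ofPred_eq, hmul, hs]
      constructor <;> rintro ⟨h1, h2, h3⟩ <;> exact ⟨h1, by linarith, by linarith⟩
    rw [h1, ← lintegral_indicator_one (hsA.inter hB), lintegral_eq_setLIntegral_tsum hAm hA
      (measurable_one.indicator (hsA.inter hB))]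
    have h2 : ∀ x : Heis, ∑' γ : Γ, ({x : Heis | s * x ∈ A} ∩ ℓ ⁻¹' Set.Ico (0 : ℝ) 1).indicator
        (1 : Heis → ℝ≥0∞) (x * γ) = (ℓ ⁻¹' Set.Ico (0 : ℝ) 1).indicator 1 x := by
      intro x
      have h3 : ∀ γ : Γ, ({x : Heis | s * x ∈ A} ∩ ℓ ⁻¹' Set.Ico (0 : ℝ) 1).indicator
          (1 : Heis → ℝ≥0∞) (x * γ) = A.indicator (fun _ => (1 : ℝ≥0∞)) (s * x * γ) *
            (ℓ ⁻¹' Set.Ico (0 : ℝ) 1).indicator 1 x := by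
        intro γ
        classical
        have h4 : ℓ (x * γ) = ℓ x := by
          rw [hmul]
          exact (congrArg (ℓ x + ·) (h γ γ.2)).trans (add_zero _)
        simp only [Set.indicator_apply, Set.mem_inter_iff, Set.mem_preimage, Set.mem_ofPred_eq, h4,
          mul_assoc, Pi.one_apply]
        by_cases h5 : s * (x * γ) ∈ A <;> by_cases h6 : ℓ x ∈ Set.Ico (0 : ℝ) 1 <;> simp [h5, h6]
      rw [tsum_congr h3, ENNReal.tsum_mul_right, tsum_indicator_eq_one (hA (s * x)), one_mul]
    simp_rw [h2]
    rw [lintegral_indicator_one hB, Measure.restrict_apply hB, Set.inter_comm]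
  have hsum : volume A = ∑' n : ℤ, volume (A ∩ ℓ ⁻¹' Set.Ico (n : ℝ) (n + 1)) := by
    rw [← measure_iUnion]
    · rw [← Set.inter_iUnion, ← Set.preimage_iUnion, iUnion_Ico_intCast, Set.preimage_univ,
        Set.inter_univ]
    · intro m n hmn
      exact ((Set.pairwise_disjoint_Ico_intCast ℝ hmn).preimage ℓ).mono Set.inter_subset_right
        Set.inter_subset_right
    · exact fun n => hAm.inter (hℓ measurableSet_Ico)
  simp_rw [hstrip] at hsum
  by_cases h0 : volume (A ∩ ℓ ⁻¹' Set.Ico (0 : ℝ) 1) = 0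
  · rw [h0, tsum_zero] at hsum
    exact volume_fundamentalDomain_ne_zero hAm hA hsum
  · rw [ENNReal.tsum_const_eq_top_of_ne_zero h0] at hsum
    exact hfin.ne hsum

/-- A lattice contains nontrivial central elements. -/
theorem IsLattice.exists_central (hΓ : IsLattice Γ) : ∃ α : ℝ, 0 < α ∧ Heis.mk 0 0 α ∈ Γ := by
  have key : ∃ α : ℝ, α ≠ 0 ∧ Heis.mk 0 0 α ∈ Γ := by
    by_contra! hno
    -- The commutator of `γ` and `γ'` is central, with third coordinate exactly this symplectic
    -- form.
    have hcomm : ∀ γ ∈ Γ, ∀ γ' ∈ Γ, γ.p * γ'.q - γ.q * γ'.p = 0 := by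
      intro γ hγ γ' hγ'
      by_contra h0
      refine hno _ h0 ?_
      have := Γ.mul_mem (Γ.mul_mem hγ hγ') (Γ.mul_mem (Γ.inv_mem hγ) (Γ.inv_mem hγ'))
      convert this using 1
      refine Heis.ext' ?_ ?_ ?_
      · simp only [Heis.mk_p, Heis.mul_p, Heis.inv_p]; ring
      · simp only [Heis.mk_q, Heis.mul_q, Heis.inv_q]; ring
      · simp only [Heis.mul_t, Heis.mul_p, Heis.mul_q, Heis.inv_p, Heis.inv_q, Heis.inv_t]
        rw [Heis.mk_t]
        ring
    -- For fixed `γ` the symplectic form is a linear form that vanishes on the lattice, hence zero.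
    have hz : ∀ γ ∈ Γ, γ.p = 0 ∧ γ.q = 0 := by
      intro γ hγ
      have := hΓ.eq_zero_of_form (a := -γ.q) (b := γ.p) fun γ' hγ' => by
        linarith [hcomm γ hγ γ' hγ']
      exact ⟨this.2, by linarith [this.1]⟩
    have := hΓ.eq_zero_of_form (a := 1) (b := 0) fun γ hγ => by simp [(hz γ hγ).1]
    exact one_ne_zero this.1
  obtain ⟨α, h0, hα⟩ := key
  rcases lt_or_gt_of_ne h0 with h | h
  · refine ⟨-α, by linarith, ?_⟩
    have := Γ.inv_mem hα
    convert this using 1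
    refine Heis.ext' ?_ ?_ ?_ <;> simp
  · exact ⟨α, h, hα⟩

end Lattices

/-! ### Tight frames over lattices force bandlimitation -/

section Necessity

open scoped ComplexConjugate

/-- Parseval's identity for a function supported in a period. -/
theorem tsum_enorm_integral_exp_mul {a T : ℝ} (hT : 0 < T) {g : ℝ → ℂ} (hg : MemLp g 2 volume)
    (hsupp : ∀ x, x ∉ Set.Ioc a (a + T) → g x = 0) :
    ∑' k : ℤ, ‖∫ x : ℝ, Complex.exp (-(2 * Real.pi * Complex.I * k * x / T)) * g x‖ₑ ^ 2
      = ENNReal.ofReal T * ∫⁻ x, ‖g x‖ₑ ^ 2 := by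
  have hab : a < a + T := by linarith
  have hs := hasSum_sq_fourierCoeffOn hab (hg.restrict _)
  have h1 : ∀ k : ℤ, ‖∫ x : ℝ, Complex.exp (-(2 * Real.pi * Complex.I * k * x / T)) * g x‖ ^ 2
      = T ^ 2 * ‖fourierCoeffOn hab g k‖ ^ 2 := by
    intro k
    have h2 : (∫ x : ℝ, Complex.exp (-(2 * Real.pi * Complex.I * k * x / T)) * g x)
        = ∫ x in a..(a + T), fourier (-k) (x : AddCircle (a + T - a)) • g x := by
      rw [intervalIntegral.integral_of_le hab.le, setIntegral_eq_integral_of_forall_compl_eq_zero]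
      · refine integral_congr_ae (Eventually.of_forall fun x => ?_)
        simp only [fourier_coe_apply, smul_eq_mul]
        congr 2
        push_cast
        rw [add_sub_cancel_left]
        ring
      · intro x hx
        rw [hsupp x hx, smul_zero]
    rw [fourierCoeffOn_eq_integral, ← h2, norm_smul, add_sub_cancel_left, Real.norm_eq_abs,
      abs_of_pos (by positivity)]
    field_simp
  have h2 : HasSum (fun k : ℤ =>
      ‖∫ x : ℝ, Complex.exp (-(2 * Real.pi * Complex.I * k * x / T)) * g x‖ ^ 2)
      (T * ∫ x, ‖g x‖ ^ 2) := by
    simp_rw [h1]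
    have h3 := hs.mul_left (T ^ 2)
    rw [add_sub_cancel_left, intervalIntegral.integral_of_le hab.le,
      setIntegral_eq_integral_of_forall_compl_eq_zero fun x hx => by simp [hsupp x hx],
      smul_eq_mul] at h3
    have h4 : T ^ 2 * (T⁻¹ * ∫ x, ‖g x‖ ^ 2) = T * ∫ x, ‖g x‖ ^ 2 := by field_simp
    rwa [h4] at h3
  have h3 := ENNReal.ofReal_tsum_of_nonneg (fun k => by positivity) h2.summable
  rw [h2.tsum_eq, ENNReal.ofReal_mul hT.le, ofReal_integral_eq_lintegral_ofReal
    ((memLp_two_iff_integrable_sq_norm hg.1).1 hg) (Eventually.of_forall fun x => by positivity)] at h3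
  simpa only [ENNReal.ofReal_pow (norm_nonneg _), ofReal_norm] using h3.symm

theorem leftReg_mul (x y : Heis) (f : L2H) : leftReg (x * y) f = leftReg x (leftReg y f) := by
  refine Lp.ext ?_
  filter_upwards [coeFn_leftReg (x * y) f, coeFn_leftReg x (leftReg y f),
    (Heis.measurePreserving_mul_left x⁻¹).quasiMeasurePreserving.ae_eq_comp
      (coeFn_leftReg y f)] with z h1 h2 h3
  simp only [Function.comp_apply] at h3
  rw [h1, h2, h3, mul_inv_rev, mul_assoc]

theorem inner_leftReg_mul (x y : Heis) (f g : L2H) :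
    ⟪leftReg (x * y) f, g⟫_ℂ = ⟪leftReg y f, leftReg x⁻¹ g⟫_ℂ := by
  rw [← (leftReg x⁻¹).inner_map_map, ← leftReg_mul, inv_mul_cancel_left]

theorem tsum_enorm_sq_of_hasSum {ι : Type*} {u : ι → ℂ} {s : ℝ}
    (h : HasSum (fun i => ‖u i‖ ^ 2) s) : ∑' i, ‖u i‖ₑ ^ 2 = ENNReal.ofReal s := by
  rw [← h.tsum_eq, ENNReal.ofReal_tsum_of_nonneg (fun i => by positivity) h.summable]
  simp only [ENNReal.ofReal_pow (norm_nonneg _), ofReal_norm]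

variable {H : ClosedSubmodule ℂ L2H} {Γ : Subgroup Heis} {Φ : L2H} {c : ℝ}

/-- A tight frame over a lattice is a continuous tight frame over the group. -/
theorem lintegral_coeff_of_frame [Countable Γ] (hH : LeftInvariant H.toSubmodule) {A : Set Heis}
    (hAm : MeasurableSet A) (hA : ∀ x : Heis, ∃! γ : Γ, x * γ ∈ A)
    (hfr : ∀ f ∈ H, ∑' γ : Γ, ‖⟪leftReg (γ : Heis) Φ, f⟫_ℂ‖ₑ ^ 2 = ENNReal.ofReal c * ‖f‖ₑ ^ 2)
    {f : L2H} (hf : f ∈ H) :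
    ∫⁻ x : Heis, ‖⟪leftReg x Φ, f⟫_ℂ‖ₑ ^ 2 = volume A * ENNReal.ofReal c * ‖f‖ₑ ^ 2 := by
  rw [lintegral_eq_setLIntegral_tsum hAm hA
    ((stronglyMeasurable_coeff Φ f).enorm.pow_const 2)]
  -- Since `⟨λ(xγ)Φ, f⟩ = ⟨λ(γ)Φ, λ(x⁻¹)f⟩` and `H` is invariant, the inner sum does not depend on
  -- `x`.
  have h1 : ∀ x : Heis, ∑' γ : Γ, ‖⟪leftReg (x * γ) Φ, f⟫_ℂ‖ₑ ^ 2
      = ENNReal.ofReal c * ‖f‖ₑ ^ 2 := by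
    intro x
    simp_rw [inner_leftReg_mul]
    rw [hfr _ (hH x⁻¹ f hf), enorm_eq_iff_norm_eq.2 ((leftReg x⁻¹).norm_map f)]
  simp_rw [h1]
  rw [setLIntegral_const]
  ring

/-- The squared `L²` norms of the slices of a field of kernels. -/
def sliceNormSq (f : L2H) (h : ℝ) : ℝ≥0∞ := ∫⁻ y : ℝ, ‖kernel f (h, y)‖ₑ ^ 2

theorem measurable_kernel_sq (f : L2H) : Measurable (fun z => ‖kernel f z‖ₑ ^ 2) :=
  (Lp.stronglyMeasurable (kernel f)).enorm.pow_const 2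

theorem measurable_sliceNormSq (f : L2H) : Measurable (sliceNormSq f) :=
  (measurable_kernel_sq f).lintegral_prod_right'

theorem ae_sliceNormSq_lt_top (f : L2H) : ∀ᵐ h : ℝ, sliceNormSq f h < ∞ := by
  refine ae_lt_top (measurable_sliceNormSq f) ?_
  have := (memLp_two_iff.1 (Lp.memLp (kernel f))).2
  rw [lintegral_volume_prod (measurable_kernel_sq f).aemeasurable] at this
  exact this.ne

theorem enorm_sq_eq_lintegral_kernel (f : L2H) : ‖f‖ₑ ^ 2 = ∫⁻ z, ‖kernel f z‖ₑ ^ 2 := by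
  rw [← enorm_sq_eq_lintegral, enorm_eq_iff_norm_eq.2 (norm_kernel f)]

/-- The lower bound for the slices of a generator of a continuous tight frame. -/
theorem ae_lower_bound {P : ℝ → L2R →L[ℂ] L2R} (hP : IsProjectionField H P) {κ : ℝ≥0∞}
    (hκ : κ ≠ ∞)
    (hfr : ∀ f ∈ H, κ * ‖f‖ₑ ^ 2 ≤ ∫⁻ x : Heis, ‖⟪leftReg x Φ, f⟫_ℂ‖ₑ ^ 2) :
    ∀ᵐ h : ℝ, P h ≠ 0 → κ * ‖h‖ₑ ≤ sliceNormSq Φ h := by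
  have hΘ := measurable_sliceNormSq Φ
  have key : ∀ φ : L2R, ∀ᵐ h : ℝ, κ * ‖P h φ‖ₑ ^ 2
      ≤ ‖h‖ₑ⁻¹ * (‖P h φ‖ₑ ^ 2 * sliceNormSq Φ h) := by
    intro φ
    have hPφ : AEStronglyMeasurable (fun h => P h φ) volume :=
      aestronglyMeasurable_of_inner fun v => hP.measurable v φ
    have hPm : AEMeasurable (fun h => ‖P h φ‖ₑ ^ 2) volume := hPφ.enorm.pow_const 2
    refine ae_le_of_forall_setLIntegral_le_of_sigmaFinite₀ (hPm.const_mul _) fun S hS hSfin => ?_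
    -- The test vector has kernel `P_h φ` on `S × [0, 1]`. The unit length in `y` turns integrals
    -- over `B` into integrals over `S`, and `S` is arbitrary.
    let B : Set (ℝ × ℝ) := S ×ˢ Set.Icc (0 : ℝ) 1
    have hB : MeasurableSet B := hS.prod measurableSet_Icc
    have hBfin : volume B ≠ ∞ := by
      rw [Measure.volume_eq_prod, Measure.prod_prod]
      simpa using hSfin.ne
    have hK := memLp_projection_kernel hP.measurable hP.isProj
      (memLp_indicator_const 2 hB φ (Or.inr hBfin))
    obtain ⟨f, hf⟩ := exists_kernel_ae_eq hK
    have hfH : f ∈ H := by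
      refine hP.mem_of_kernel ?_
      filter_upwards [hf, ae_projection_of_ae hP.isProj] with z h1 h2
      rw [h1]
      exact congrArg (fun A : L2R →L[ℂ] L2R => A (B.indicator (fun _ => φ) z)) h2.isIdempotentElem.eq
    have hfz : ∀ᵐ z : ℝ × ℝ, kernel f z = B.indicator (fun z => P z.1 φ) z := by
      filter_upwards [hf] with z h1
      rw [h1]
      by_cases hz : z ∈ B <;> simp [hz]
    have hint : ∀ G : ℝ → ℝ≥0∞, AEMeasurable G volume →
        ∫⁻ z : ℝ × ℝ, B.indicator (fun z => G z.1) z = ∫⁻ h in S, G h := by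
      intro G hG
      have hGz : AEMeasurable (fun z : ℝ × ℝ => G z.1) volume :=
        hG.comp_quasiMeasurePreserving Measure.quasiMeasurePreserving_fst
      rw [lintegral_volume_prod (hGz.indicator hB), ← lintegral_indicator hS]
      refine lintegral_congr fun h => ?_
      have : ∀ y, B.indicator (fun z : ℝ × ℝ => G z.1) (h, y)
          = (Set.Icc (0 : ℝ) 1).indicator (fun _ => S.indicator G h) y := by
        intro y
        by_cases h1 : h ∈ S <;> by_cases h2 : y ∈ Set.Icc (0 : ℝ) 1 <;>
          simp [B, h1, h2, -Set.mem_Icc]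
      simp_rw [this]
      rw [lintegral_indicator_const measurableSet_Icc]
      simp
    have hnorm : ‖f‖ₑ ^ 2 = ∫⁻ h in S, ‖P h φ‖ₑ ^ 2 := by
      rw [enorm_sq_eq_lintegral_kernel, ← hint _ hPm]
      refine lintegral_congr_ae ?_
      filter_upwards [hfz] with z hz
      rw [hz]
      by_cases h1 : z ∈ B <;> simp [h1]
    rw [lintegral_const_mul' _ _ hκ, ← hnorm]
    refine (hfr f hfH).trans ((lintegral_coeff_le Φ f).trans ?_)
    rw [← hint (fun h => ‖h‖ₑ⁻¹ * (‖P h φ‖ₑ ^ 2 * sliceNormSq Φ h)) (measurable_enorm.inv.aemeasurable.mul (hPm.mul hΘ.aemeasurable))]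
    refine lintegral_mono_ae ?_
    filter_upwards [hfz] with z hz
    rw [hz]
    by_cases h1 : z ∈ B
    · rw [Set.indicator_of_mem h1, Set.indicator_of_mem h1, sliceNormSq]
      refine mul_le_mul_right ?_ _
      rw [← lintegral_const_mul' _ _ (by simp)]
      refine lintegral_mono fun u => ?_
      rw [← mul_pow]
      refine pow_le_pow_left' ?_ 2
      rw [← ofReal_norm, ← ofReal_norm, ← ofReal_norm, ← ENNReal.ofReal_mul (norm_nonneg _)]
      exact ENNReal.ofReal_le_ofReal (norm_inner_le_norm _ _)
    · simp [h1]
  -- The null set depends on `φ`, so `φ` runs through a dense sequence; if `P h ≠ 0`, some member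
  -- has nonzero image, and its norm can be cancelled.
  filter_upwards [ae_all_iff.2 fun n => key (TopologicalSpace.denseSeq L2R n), ae_ne_zero]
    with h h1 h0 hPh
  obtain ⟨n, hn⟩ : ∃ n, P h (TopologicalSpace.denseSeq L2R n) ≠ 0 := by
    by_contra! hall
    refine hPh ?_
    ext1 φ
    exact (TopologicalSpace.denseRange_denseSeq L2R).induction_on (p := fun φ => P h φ = 0) φ
      (isClosed_eq (P h).continuous continuous_const) hall
  have h2 := h1 n
  have hne : ‖P h (TopologicalSpace.denseSeq L2R n)‖ₑ ^ 2 ≠ 0 := by simpa using hn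
  have hnt : ‖P h (TopologicalSpace.denseSeq L2R n)‖ₑ ^ 2 ≠ ∞ := by simp
  rw [mul_left_comm, mul_comm κ, ENNReal.mul_le_mul_iff_right hne hnt, mul_comm,
    ← div_eq_mul_inv, ENNReal.le_div_iff_mul_le (Or.inl (by simpa using h0)) (Or.inl (by simp))] at h2
  exact h2

end Necessity

/-! ### Central translates and the upper bound for the generator -/

section CentralTranslates

open scoped ComplexConjugate

variable {H : ClosedSubmodule ℂ L2H} {Γ : Subgroup Heis} {Φ : L2H} {c : ℝ}

theorem conj_phase_central (h t y : ℝ) :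
    conj (phase h (Heis.mk 0 0 t) y) = Complex.exp (-(2 * Real.pi * Complex.I * h * t)) := by
  simp only [phase, Heis.mk_p, Heis.mk_q, Heis.mk_t]
  rw [← Complex.exp_add, ← Complex.exp_add, ← Complex.exp_conj]
  congr 1
  simp only [map_add, map_mul, Complex.conj_I, Complex.conj_ofReal, map_ofNat]
  push_cast
  ring

/-- The coefficients of a frequency cut-off of `Φ` with respect to the central translates
of `Φ`. -/
theorem inner_leftReg_central {S : Set ℝ} (hS : MeasurableSet S) {f : L2H}
    (hf : kernel f =ᵐ[volume] (Prod.fst ⁻¹' S).indicator (kernel Φ)) (t : ℝ) :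
    ⟪leftReg (Heis.mk 0 0 t) Φ, f⟫_ℂ = ∫ h : ℝ, Complex.exp (-(2 * Real.pi * Complex.I * h * t)) *
      S.indicator (fun h => ((sliceNormSq Φ h).toReal : ℂ)) h := by
  have hΦ := Lp.memLp (kernel Φ)
  have hL := hΦ.indicator (hS.preimage (measurable_fst (β := ℝ)))
  have hi : Integrable (fun z : ℝ × ℝ => Complex.exp (-(2 * Real.pi * Complex.I * z.1 * t)) *
      ⟪(Prod.fst ⁻¹' S).indicator (kernel Φ) z, kernel Φ z⟫_ℂ) := by
    refine (integrable_inner_of_memLp hL hΦ).bdd_mul (c := 1) (by fun_prop)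
      (Eventually.of_forall fun z => ?_)
    simp [Complex.norm_exp]
  have h1 : ⟪leftReg (Heis.mk 0 0 t) Φ, f⟫_ℂ
      = ∫ z : ℝ × ℝ, Complex.exp (-(2 * Real.pi * Complex.I * z.1 * t)) *
      ⟪(Prod.fst ⁻¹' S).indicator (kernel Φ) z, kernel Φ z⟫_ℂ := by
    rw [inner_leftReg]
    refine integral_congr_ae ?_
    filter_upwards [hf] with z hz
    rw [hz, conj_phase_central, Heis.mk_p, mul_zero, add_zero]
  refine h1.trans ((integral_prod _ hi).trans ?_)
  refine integral_congr_ae (Eventually.of_forall fun h => ?_)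
  simp only
  rw [integral_const_mul]
  congr 1
  by_cases hh : h ∈ S
  · rw [Set.indicator_of_mem hh, sliceNormSq]
    have h2 : ∀ y, ⟪(Prod.fst ⁻¹' S).indicator (kernel Φ) (h, y), kernel Φ (h, y)⟫_ℂ
        = ((‖kernel Φ (h, y)‖ ^ 2 : ℝ) : ℂ) := by
      intro y
      rw [Set.indicator_of_mem (by exact hh), inner_self_eq_norm_sq_to_K]
      push_cast
      rfl
    have h3 : StronglyMeasurable (fun y => ‖kernel Φ (h, y)‖ ^ 2) :=
      ((Lp.stronglyMeasurable (kernel Φ)).comp_measurable measurable_prodMk_left).norm.pow 2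
    simp_rw [h2]
    rw [integral_complex_ofReal, integral_eq_lintegral_of_nonneg_ae
      (Eventually.of_forall fun y => by positivity) h3.aestronglyMeasurable]
    simp only [ENNReal.ofReal_pow (norm_nonneg _), ofReal_norm]
  · rw [Set.indicator_of_notMem hh]
    have h2 : ∀ y, ⟪(Prod.fst ⁻¹' S).indicator (kernel Φ) (h, y), kernel Φ (h, y)⟫_ℂ = 0 := by
      intro y
      rw [Set.indicator_of_notMem (by exact hh), inner_zero_left]
    simp_rw [h2, integral_zero]

/-- For the cut-off of `Φ` to frequencies in `S`, the coefficients at `(0, 0, kα)` are Fourier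
coefficients of `Θ` restricted to `S`, with `Θ = sliceNormSq Φ`. Parseval on one period computes
their sum, which is only part of the full frame sum. The bound `M` keeps `Θ` square-integrable on
`S`. -/
theorem sq_lintegral_slice_le {P : ℝ → L2R →L[ℂ] L2R} (hP : IsProjectionField H P) (hΦ : Φ ∈ H)
    {α : ℝ} (hα : 0 < α) (hαΓ : Heis.mk 0 0 α ∈ Γ)
    (hfr : ∀ f ∈ H, ∑' γ : Γ, ‖⟪leftReg (γ : Heis) Φ, f⟫_ℂ‖ₑ ^ 2 = ENNReal.ofReal c * ‖f‖ₑ ^ 2)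
    {S : Set ℝ} (hS : MeasurableSet S) {a : ℝ} (hSa : S ⊆ Set.Ioc a (a + α⁻¹)) {M : ℝ≥0∞}
    (hM : M ≠ ∞) (hSM : ∀ h ∈ S, sliceNormSq Φ h ≤ M) :
    ∫⁻ h in S, sliceNormSq Φ h ^ 2
      ≤ ENNReal.ofReal α * ENNReal.ofReal c * ∫⁻ h in S, sliceNormSq Φ h := by
  have hΘ := measurable_sliceNormSq Φ
  have hT : (0 : ℝ) < α⁻¹ := inv_pos.2 hα
  obtain ⟨f, hf⟩ := exists_kernel_ae_eq
    ((Lp.memLp (kernel Φ)).indicator (hS.preimage (measurable_fst (β := ℝ))))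
  have hfH : f ∈ H := by
    refine hP.mem_of_kernel ?_
    filter_upwards [hf, hP.kernel_of_mem hΦ] with z h1 h2
    rw [h1]
    by_cases hz : z ∈ (Prod.fst ⁻¹' S : Set (ℝ × ℝ))
    · rw [Set.indicator_of_mem hz, h2]
    · rw [Set.indicator_of_notMem hz, map_zero]
  have hnorm : ‖f‖ₑ ^ 2 = ∫⁻ h in S, sliceNormSq Φ h := by
    rw [enorm_sq_eq_lintegral_kernel, ← lintegral_indicator hS, lintegral_congr_ae (g :=
      fun z => (Prod.fst ⁻¹' S).indicator (fun z => ‖kernel Φ z‖ₑ ^ 2) z)]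
    · rw [lintegral_volume_prod ((measurable_kernel_sq Φ).indicator
        (hS.preimage measurable_fst)).aemeasurable]
      refine lintegral_congr fun h => ?_
      by_cases hh : h ∈ S
      · rw [Set.indicator_of_mem hh, sliceNormSq]
        exact lintegral_congr fun y => Set.indicator_of_mem (by exact hh) _
      · rw [Set.indicator_of_notMem hh, ← lintegral_zero (μ := (volume : Measure ℝ))]
        exact lintegral_congr fun y => Set.indicator_of_notMem (by exact hh) _
    · filter_upwards [hf] with z hz
      rw [hz]
      by_cases h1 : z ∈ (Prod.fst ⁻¹' S : Set (ℝ × ℝ))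
      · rw [Set.indicator_of_mem h1, Set.indicator_of_mem h1]
      · rw [Set.indicator_of_notMem h1, Set.indicator_of_notMem h1]; simp
  let g : ℝ → ℂ := S.indicator (fun h => ((sliceNormSq Φ h).toReal : ℂ))
  have hSfin : volume S ≠ ∞ := measure_ne_top_of_subset hSa (by simp)
  have hg : MemLp g 2 volume := by
    refine (memLp_indicator_const 2 hS (M.toReal : ℂ) (Or.inr hSfin)).of_le
      ((Complex.measurable_ofReal.comp hΘ.ennreal_toReal).indicator hS).aestronglyMeasurable
      (Eventually.of_forall fun h => ?_)
    by_cases hh : h ∈ S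
    · simp only [g, Set.indicator_of_mem hh, Complex.norm_real, Real.norm_eq_abs,
        ENNReal.abs_toReal]
      exact ENNReal.toReal_mono hM (hSM h hh)
    · simp [g, hh]
  have hpars := tsum_enorm_integral_exp_mul hT hg (a := a) fun h hh =>
    Set.indicator_of_notMem (fun h' => hh (hSa h')) _
  have hgsq : ∫⁻ h, ‖g h‖ₑ ^ 2 = ∫⁻ h in S, sliceNormSq Φ h ^ 2 := by
    rw [← lintegral_indicator hS]
    refine lintegral_congr fun h => ?_
    by_cases hh : h ∈ S
    · have : sliceNormSq Φ h ≠ ∞ := ne_top_of_le_ne_top hM (hSM h hh)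
      simp only [g]
      rw [Set.indicator_of_mem hh, Set.indicator_of_mem hh, ← ofReal_norm, Complex.norm_real,
        Real.norm_eq_abs, ENNReal.abs_toReal, ENNReal.ofReal_toReal this]
    · simp [g, hh]
  have hmem : ∀ k : ℤ, Heis.mk 0 0 (k * α) ∈ Γ := by
    intro k
    have h1 : ∀ n : ℕ, Heis.mk 0 0 (n * α) ∈ Γ := by
      intro n
      induction n with
      | zero => convert Γ.one_mem using 1; exact Heis.ext' (by simp) (by simp) (by simp)
      | succ n ih =>
        convert Γ.mul_mem ih hαΓ using 1
        exact Heis.ext' (by simp) (by simp) (by simp; ring)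
    rcases Int.eq_nat_or_neg k with ⟨n, rfl | rfl⟩
    · exact_mod_cast h1 n
    · convert Γ.inv_mem (h1 n) using 1
      exact Heis.ext' (by simp) (by simp) (by simp)
  let ι : ℤ → Γ := fun k => ⟨_, hmem k⟩
  have hι : Function.Injective ι := by
    intro k l hkl
    have := congrArg (fun γ : Γ => (γ : Heis).t) hkl
    simp only [ι, Heis.mk_t] at this
    exact_mod_cast mul_right_cancel₀ hα.ne' this
  have hle := ENNReal.tsum_comp_le_tsum_of_injective hι
    (fun γ : Γ => ‖⟪leftReg (γ : Heis) Φ, f⟫_ℂ‖ₑ ^ 2)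
  rw [hfr f hfH, hnorm] at hle
  have heq : ∀ k : ℤ, ⟪leftReg (ι k : Heis) Φ, f⟫_ℂ
      = ∫ x : ℝ, Complex.exp (-(2 * Real.pi * Complex.I * k * x / (α⁻¹ : ℝ))) * g x := by
    intro k
    rw [inner_leftReg_central hS hf]
    refine integral_congr_ae (Eventually.of_forall fun h => ?_)
    simp only [g]
    congr 3
    push_cast
    field_simp
  simp_rw [heq] at hle
  rw [hpars, hgsq] at hle
  calc ∫⁻ h in S, sliceNormSq Φ h ^ 2
      = ENNReal.ofReal α * (ENNReal.ofReal α⁻¹ * ∫⁻ h in S, sliceNormSq Φ h ^ 2) := by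
        rw [← mul_assoc, ← ENNReal.ofReal_mul hα.le, mul_inv_cancel₀ hα.ne', ENNReal.ofReal_one,
          one_mul]
    _ ≤ _ := by rw [mul_assoc]; gcongr

/-- The upper bound for the slices of a generator of a tight frame over a lattice. -/
theorem ae_upper_bound {P : ℝ → L2R →L[ℂ] L2R} (hP : IsProjectionField H P) (hΦ : Φ ∈ H)
    {α : ℝ} (hα : 0 < α) (hαΓ : Heis.mk 0 0 α ∈ Γ)
    (hfr : ∀ f ∈ H, ∑' γ : Γ, ‖⟪leftReg (γ : Heis) Φ, f⟫_ℂ‖ₑ ^ 2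
      = ENNReal.ofReal c * ‖f‖ₑ ^ 2) :
    ∀ᵐ h : ℝ, sliceNormSq Φ h ≤ ENNReal.ofReal α * ENNReal.ofReal c := by
  have hΘ := measurable_sliceNormSq Φ
  set D : ℝ≥0∞ := ENNReal.ofReal α * ENNReal.ofReal c with hD
  have hDt : D ≠ ∞ := ENNReal.mul_ne_top ENNReal.ofReal_ne_top ENNReal.ofReal_ne_top
  -- On a level set in one period where `D < Θ ≤ M`, one has `DΘ ≤ Θ²` pointwise, while the
  -- integrals satisfy the reverse inequality. Equality then holds a.e., which contradicts `D < Θ`.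
  have key : ∀ (j : ℤ) (M : ℕ), ∀ᵐ h : ℝ, ¬ (h ∈ Set.Ioc (j * α⁻¹) (j * α⁻¹ + α⁻¹) ∧
      D < sliceNormSq Φ h ∧ sliceNormSq Φ h ≤ M) := by
    intro j M
    let S : Set ℝ := Set.Ioc (j * α⁻¹) (j * α⁻¹ + α⁻¹) ∩
      (sliceNormSq Φ ⁻¹' (Set.Ioc D M))
    have hS : MeasurableSet S := measurableSet_Ioc.inter (hΘ measurableSet_Ioc)
    have hSfin : volume S ≠ ∞ := measure_ne_top_of_subset Set.inter_subset_left (by simp)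
    have hle := sq_lintegral_slice_le hP hΦ hα hαΓ hfr hS Set.inter_subset_left
      (ENNReal.natCast_ne_top M) (fun h hh => hh.2.2)
    rw [← hD, ← lintegral_const_mul' _ _ hDt] at hle
    have hpt : ∀ᵐ h ∂(volume.restrict S), D * sliceNormSq Φ h ≤ sliceNormSq Φ h ^ 2 := by
      refine (ae_restrict_iff' hS).2 (Eventually.of_forall fun h hh => ?_)
      rw [sq]
      exact mul_le_mul_left hh.2.1.le _
    have hfin : ∫⁻ h in S, D * sliceNormSq Φ h ≠ ∞ := by
      refine ne_top_of_le_ne_top ?_ (setLIntegral_mono (g := fun _ => D * M) measurable_const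
        fun h hh => mul_le_mul_right hh.2.2 _)
      rw [setLIntegral_const]
      exact ENNReal.mul_ne_top (ENNReal.mul_ne_top hDt (by simp)) hSfin
    have heq := ae_eq_of_ae_le_of_lintegral_le hpt hfin (hΘ.pow_const 2).aemeasurable hle
    rw [EventuallyEq, ae_restrict_iff' hS] at heq
    filter_upwards [heq] with h hh hmem
    have h1 := hh ⟨hmem.1, hmem.2⟩
    rw [sq, ENNReal.mul_left_inj (bot_le.trans_lt hmem.2.1).ne'
      (ne_top_of_le_ne_top (by simp) hmem.2.2)] at h1
    exact hmem.2.1.ne h1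
  filter_upwards [ae_all_iff.2 fun j => ae_all_iff.2 (key j), ae_sliceNormSq_lt_top Φ]
    with h h1 h2
  by_contra! h3
  obtain ⟨M, hM⟩ := ENNReal.exists_nat_gt h2.ne
  -- The periods are open on the left and closed on the right, hence the ceiling minus one.
  refine h1 (⌈h * α⌉ - 1) M ⟨⟨?_, ?_⟩, h3, hM.le⟩
  · rw [← div_eq_mul_inv, div_lt_iff₀ hα]
    push_cast
    linarith [Int.ceil_lt_add_one (h * α)]
  · rw [← add_one_mul, ← div_eq_mul_inv, le_div_iff₀ hα]
    push_cast
    linarith [Int.le_ceil (h * α)]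

/-- An invariant subspace with a tight frame over a lattice is bandlimited. -/
theorem bandlimited_of_isTightFrame (hH : LeftInvariant H.toSubmodule)
    {P : ℝ → L2R →L[ℂ] L2R} (hP : IsProjectionField H P) (hΓ : IsLattice Γ) (hΦ : Φ ∈ H)
    (hfr : IsTightFrame H.toSubmodule (fun γ : Γ => leftReg (γ : Heis) Φ)) : Bandlimited P := by
  have := hΓ.countable
  obtain ⟨α, hα, hαΓ⟩ := hΓ.exists_central
  obtain ⟨A, hAm, hA, hfin⟩ := hΓ.finite_covolume
  obtain ⟨-, c, hc, hsum⟩ := hfr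
  have hfr' : ∀ f ∈ H, ∑' γ : Γ, ‖⟪leftReg (γ : Heis) Φ, f⟫_ℂ‖ₑ ^ 2
      = ENNReal.ofReal c * ‖f‖ₑ ^ 2 := by
    intro f hf
    rw [tsum_enorm_sq_of_hasSum (hsum f hf), ENNReal.ofReal_mul hc.le,
      ENNReal.ofReal_pow (norm_nonneg _), ofReal_norm]
  have hκ : volume A * ENNReal.ofReal c ≠ ∞ := ENNReal.mul_ne_top hfin.ne ENNReal.ofReal_ne_top
  have hκ0 : volume A * ENNReal.ofReal c ≠ 0 :=
    mul_ne_zero (volume_fundamentalDomain_ne_zero hAm hA) (by simpa using hc)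
  have hlow := ae_lower_bound hP hκ fun f hf =>
    (lintegral_coeff_of_frame hH hAm hA hfr' hf).ge
  -- The bandwidth is the quotient of the upper bound `αc` by the slope `vol(A) c` of the lower
  -- bound.
  refine ⟨(ENNReal.ofReal α * ENNReal.ofReal c / (volume A * ENNReal.ofReal c)).toReal, ?_⟩
  filter_upwards [hlow, ae_upper_bound hP hΦ hα hαΓ hfr'] with h h1 h2 h3
  have h4 : ‖h‖ₑ ≤ ENNReal.ofReal α * ENNReal.ofReal c / (volume A * ENNReal.ofReal c) := by
    rw [ENNReal.le_div_iff_mul_le (Or.inl hκ0) (Or.inl hκ), mul_comm]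
    exact (h1 h3).trans h2
  have h5 := ENNReal.toReal_mono (ENNReal.div_ne_top
    (ENNReal.mul_ne_top ENNReal.ofReal_ne_top ENNReal.ofReal_ne_top) hκ0) h4
  rwa [toReal_enorm, Real.norm_eq_abs] at h5

end CentralTranslates

/-! ### Measurable orthonormal bases of the fibres -/

section FibreBases

open scoped ComplexConjugate
open InnerProductSpace

/-- Modification of a field of projections on a null set. -/
theorem exists_regular_field {P : ℝ → L2R →L[ℂ] L2R} (hm : MeasurableField P)
    (hp : ∀ᵐ h : ℝ, IsStarProjection (P h)) (hb : BoundedMultiplicity P) (hbl : Bandlimited P) :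
    ∃ (Q : ℝ → L2R →L[ℂ] L2R) (C : ℕ) (R : ℝ), (∀ h, IsStarProjection (Q h)) ∧
      (∀ h, (Q h).toLinearMap.rank ≤ C) ∧ (∀ h, R < |h| → Q h = 0) ∧
      (∀ n, StronglyMeasurable fun h => Q h (TopologicalSpace.denseSeq L2R n)) ∧
      Q =ᵐ[volume] P := by
  classical
  obtain ⟨C, hC⟩ := hb
  obtain ⟨R, hR⟩ := hbl
  have ha : ∀ n, AEStronglyMeasurable (fun h => P h (TopologicalSpace.denseSeq L2R n)) volume :=
    fun n => aestronglyMeasurable_of_inner fun v => hm v _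
  -- All a.e. properties hold on one measurable conull set; outside it the field is set to zero,
  -- which preserves each of them.
  obtain ⟨S, hSae, hS, hgood⟩ := (hp.and (hC.and (hR.and
    (ae_all_iff.2 fun n => (ha n).ae_eq_mk)))).exists_measurable_mem
  refine ⟨fun h => if h ∈ S then P h else 0, C, R, fun h => ?_, fun h => ?_, fun h hh => ?_,
    fun n => ?_, ?_⟩
  · by_cases hs : h ∈ S
    · simpa [hs] using (hgood h hs).1
    · simp [hs]
  · by_cases hs : h ∈ S
    · simpa [hs, multiplicity] using (hgood h hs).2.1
    · simp [hs]
  · by_cases hs : h ∈ S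
    · have := (hgood h hs).2.2.1
      simp only [hs, if_true]
      by_contra h0
      exact (this h0).not_gt hh
    · simp [hs]
  · have h1 : (fun h => (if h ∈ S then P h else 0) (TopologicalSpace.denseSeq L2R n))
        = S.indicator ((ha n).mk _) := by
      funext h
      by_cases hs : h ∈ S
      · simp only [hs, if_true, Set.indicator_of_mem]
        exact (hgood h hs).2.2.2 n
      · simp [hs]
    rw [h1]
    exact (ha n).stronglyMeasurable_mk.indicator hS
  · filter_upwards [hSae] with h hs
    simp [hs]

section Projection

variable {Q : L2R →L[ℂ] L2R}

theorem _root_.IsStarProjection.apply_apply (hQ : IsStarProjection Q) (u : L2R) :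
    Q (Q u) = Q u :=
  congrArg (fun A : L2R →L[ℂ] L2R => A u) hQ.isIdempotentElem.eq

theorem _root_.IsStarProjection.inner_apply_left (hQ : IsStarProjection Q) (u v : L2R) :
    ⟪Q u, v⟫_ℂ = ⟪u, Q v⟫_ℂ := by
  rw [← ContinuousLinearMap.adjoint_inner_left, hQ.isSelfAdjoint.adjoint_eq]

/-- A projection is the projection onto the closed span of the images of a dense sequence. -/
theorem starProjection_closedSpan_image (hQ : IsStarProjection Q) (u : L2R) :
    (closedSpan fun n => Q (TopologicalSpace.denseSeq L2R n)).starProjection u = Q u := by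
  set v : ℕ → L2R := fun n => Q (TopologicalSpace.denseSeq L2R n)
  have h1 : (closedSpan v).starProjection (u - Q u) = 0 := by
    refine starProjection_closedSpan_eq_zero fun n => ?_
    rw [hQ.inner_apply_left, map_sub, hQ.apply_apply, sub_self, inner_zero_right]
  have h2 : Q u ∈ closedSpan v :=
    (TopologicalSpace.denseRange_denseSeq L2R).induction_on (p := fun u => Q u ∈ closedSpan v) u
      ((Submodule.isClosed_topologicalClosure _).preimage Q.continuous)
      fun n => Submodule.le_topologicalClosure _ (Submodule.subset_span ⟨n, rfl⟩)
  rw [map_sub, sub_eq_zero] at h1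
  rw [h1, Submodule.starProjection_eq_self_iff.2 h2]

theorem gramSchmidtNormed_mem_range (Q : L2R →L[ℂ] L2R) (d : ℕ → L2R) (n : ℕ) :
    gramSchmidtNormed ℂ (fun k => Q (d k)) n ∈ LinearMap.range Q.toLinearMap := by
  have h1 : gramSchmidtNormed ℂ (fun k => Q (d k)) n
      ∈ Submodule.span ℂ (Set.range fun k => Q (d k)) := by
    rw [← span_gramSchmidt, ← span_gramSchmidtNormed_range]
    exact Submodule.subset_span ⟨n, rfl⟩
  refine Submodule.span_le.2 ?_ h1
  rintro _ ⟨k, rfl⟩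
  exact ⟨d k, rfl⟩

theorem apply_gramSchmidtNormed (hQ : IsStarProjection Q) (d : ℕ → L2R) (n : ℕ) :
    Q (gramSchmidtNormed ℂ (fun k => Q (d k)) n) = gramSchmidtNormed ℂ (fun k => Q (d k)) n := by
  obtain ⟨u, hu⟩ := gramSchmidtNormed_mem_range Q d n
  rw [← hu]
  exact hQ.apply_apply u

theorem norm_gramSchmidtNormed_le (v : ℕ → L2R) (n : ℕ) : ‖gramSchmidtNormed ℂ v n‖ ≤ 1 := by
  by_cases h : gramSchmidtNormed ℂ v n = 0
  · simp [h]
  · exact ((gramSchmidtNormed_orthonormal' (𝕜 := ℂ) v).1 ⟨n, h⟩).le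

-- The nonzero vectors up to index `n` are linearly independent in the range of `Q`, so there are at
-- most `C` of them, the `n`-th included; the count strictly before `n` is thus below `C`.
open Classical in
theorem count_gramSchmidtNormed_lt {C : ℕ} (hC : Q.toLinearMap.rank ≤ C) (d : ℕ → L2R) {n : ℕ}
    (hn : gramSchmidtNormed ℂ (fun k => Q (d k)) n ≠ 0) :
    Nat.count (fun i => gramSchmidtNormed ℂ (fun k => Q (d k)) i ≠ 0) n < C := by
  set w := gramSchmidtNormed ℂ (fun k => Q (d k)) with hw
  have h1 : Cardinal.mk {i | w i ≠ 0} ≤ C := by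
    refine le_trans ?_ hC
    let b : {i | w i ≠ 0} → LinearMap.range Q.toLinearMap :=
      fun i => ⟨w i, gramSchmidtNormed_mem_range Q d i⟩
    have hb : LinearIndependent ℂ b :=
      LinearIndependent.of_comp (LinearMap.range Q.toLinearMap).subtype
        (gramSchmidtNormed_orthonormal' (𝕜 := ℂ) fun k => Q (d k)).linearIndependent
    have := hb.cardinal_lift_le_rank
    simpa using this
  have h2 : Nat.count (fun i => w i ≠ 0) (n + 1) ≤ C := by
    rw [Nat.count_eq_card_filter_range]
    have h3 : Cardinal.mk (((Finset.range (n + 1)).filter fun i => w i ≠ 0 : Finset ℕ) : Set ℕ)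
        ≤ Cardinal.mk {i | w i ≠ 0} := Cardinal.mk_le_mk_of_subset fun i hi => by
          simpa using (Finset.mem_filter.1 (Finset.mem_coe.1 hi)).2
    have h4 : (((Finset.range (n + 1)).filter fun i => w i ≠ 0).card : Cardinal) ≤ C :=
      Cardinal.mk_coe_finset.symm.le.trans (h3.trans h1)
    exact_mod_cast h4
  rw [Nat.count_succ, if_pos hn] at h2
  exact h2

end Projection

theorem tsum_enorm_inner_gramSchmidtNormed {Q : L2R →L[ℂ] L2R} (hQ : IsStarProjection Q)
    (u : L2R) :
    ∑' n, ‖⟪u, gramSchmidtNormed ℂ (fun k => Q (TopologicalSpace.denseSeq L2R k)) n⟫_ℂ‖ₑ ^ 2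
      = ‖Q u‖ₑ ^ 2 := by
  have h := tsum_enorm_sq_of_hasSum
    (hasSum_sq_gramSchmidtNormed (fun k => Q (TopologicalSpace.denseSeq L2R k)) u)
  rw [starProjection_closedSpan_image hQ, ENNReal.ofReal_pow (norm_nonneg _), ofReal_norm] at h
  rw [← h]
  refine tsum_congr fun n => ?_
  rw [enorm_eq_iff_norm_eq.2 (norm_inner_symm _ _)]

open Classical in
theorem measurable_count {w : ℕ → ℝ → L2R} (hw : ∀ n, StronglyMeasurable (w n)) (n : ℕ) :
    Measurable (fun h => Nat.count (fun i => w i h ≠ 0) n) := by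
  induction n with
  | zero => simp
  | succ n ih =>
    simp_rw [Nat.count_succ]
    exact ih.add (Measurable.ite (hw n).measurableSet_support measurable_const measurable_const)

/-- The nonzero vectors of a Gram-Schmidt sequence, enumerated without gaps. -/
theorem exists_fibre_basis {Q : ℝ → L2R →L[ℂ] L2R} {C : ℕ} (hQ : ∀ h, IsStarProjection (Q h))
    (hC : ∀ h, (Q h).toLinearMap.rank ≤ C)
    (hQm : ∀ n, StronglyMeasurable fun h => Q h (TopologicalSpace.denseSeq L2R n)) :
    ∃ e : ℤ → ℝ → L2R, (∀ j, StronglyMeasurable (e j)) ∧ (∀ j h, ‖e j h‖ ≤ 1) ∧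
      (∀ j h, Q h (e j h) = e j h) ∧ (∀ j h, e j h ≠ 0 → 0 ≤ j ∧ j < C) ∧
      ∀ h u, ∑' j : ℤ, ‖⟪u, e j h⟫_ℂ‖ₑ ^ 2 = ‖Q h u‖ₑ ^ 2 := by
  classical
  let w : ℕ → ℝ → L2R := fun n h =>
    gramSchmidtNormed ℂ (fun k => Q h (TopologicalSpace.denseSeq L2R k)) n
  have hw : ∀ n, StronglyMeasurable (w n) := fun n => stronglyMeasurable_gramSchmidtNormed hQm n
  -- The `n`-th vector receives the label `j` when it is nonzero and exactly `j` nonzero vectors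
  -- precede it; labels outside the range carry the zero vector.
  let good : ℤ → ℕ → ℝ → Prop := fun j n h =>
    w n h ≠ 0 ∧ ((Nat.count (fun i => w i h ≠ 0) n : ℕ) : ℤ) = j
  have huniq : ∀ j h m n, good j m h → good j n h → m = n := by
    intro j h m n hm hn
    refine Nat.count_injective (p := fun i => w i h ≠ 0) hm.1 hn.1 ?_
    exact_mod_cast hm.2.trans hn.2.symm
  let e : ℤ → ℝ → L2R := fun j h => ∑' n, if good j n h then w n h else 0
  have hcase : ∀ j h, (∃ n, good j n h ∧ e j h = w n h) ∨ ((∀ n, ¬ good j n h) ∧ e j h = 0) := by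
    intro j h
    by_cases hex : ∃ n, good j n h
    · obtain ⟨n, hn⟩ := hex
      refine Or.inl ⟨n, hn, ?_⟩
      simp only [e]
      rw [tsum_eq_single n fun m hm => if_neg fun h' => hm (huniq j h m n h' hn), if_pos hn]
    · push Not at hex
      refine Or.inr ⟨hex, ?_⟩
      simp [e, hex]
  have hsum : ∀ j h, HasSum (fun n => if good j n h then w n h else 0) (e j h) := by
    intro j h
    rcases hcase j h with ⟨n, hn, he⟩ | ⟨hno, he⟩
    · rw [he]
      have := hasSum_single (f := fun n => if good j n h then w n h else 0) n
        fun m hm => if_neg fun h' => hm (huniq j h m n h' hn)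
      simpa [hn] using this
    · rw [he]
      simp only [hno, if_false]
      exact hasSum_zero
  have hgood : ∀ j n, MeasurableSet {h | good j n h} := fun j n =>
    (hw n).measurableSet_support.inter
      ((measurable_from_top (f := fun m : ℕ => (m : ℤ))).comp (measurable_count hw n)
        (measurableSet_singleton j))
  refine ⟨e, fun j => ?_, fun j h => ?_, fun j h => ?_, fun j h hne => ?_, fun h u => ?_⟩
  · refine stronglyMeasurable_of_tendsto atTop (f := fun N h => ∑ n ∈ Finset.range N,
      if good j n h then w n h else 0) (fun N => ?_)
      (tendsto_pi_nhds.2 fun h => (hsum j h).tendsto_sum_nat)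
    exact Finset.stronglyMeasurable_fun_sum _ fun n _ =>
      StronglyMeasurable.ite (hgood j n) (hw n) stronglyMeasurable_zero
  · rcases hcase j h with ⟨n, -, he⟩ | ⟨-, he⟩
    · rw [he]; exact norm_gramSchmidtNormed_le _ n
    · simp [he]
  · rcases hcase j h with ⟨n, -, he⟩ | ⟨-, he⟩
    · rw [he]; exact apply_gramSchmidtNormed (hQ h) _ n
    · rw [he, map_zero]
  · rcases hcase j h with ⟨n, hn, -⟩ | ⟨-, he⟩
    · rw [← hn.2]
      exact ⟨Int.natCast_nonneg _, by exact_mod_cast count_gramSchmidtNormed_lt (hC h) _ hn.1⟩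
    · exact absurd he hne
  · have h1 : ∀ j, ‖⟪u, e j h⟫_ℂ‖ₑ ^ 2
        = ∑' n, if good j n h then ‖⟪u, w n h⟫_ℂ‖ₑ ^ 2 else 0 := by
      intro j
      rcases hcase j h with ⟨n, hn, he⟩ | ⟨hno, he⟩
      · rw [he, tsum_eq_single n fun m hm => if_neg fun h' => hm (huniq j h m n h' hn), if_pos hn]
      · simp [he, hno]
    simp_rw [h1]
    rw [ENNReal.tsum_comm, ← tsum_enorm_inner_gramSchmidtNormed (hQ h)]
    refine tsum_congr fun n => ?_
    rw [tsum_eq_single ((Nat.count (fun i => w i h ≠ 0) n : ℕ) : ℤ)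
      fun j hj => if_neg fun h' => hj h'.2.symm]
    by_cases h0 : w n h = 0
    · rw [if_neg fun h' => h'.1 h0]
      change 0 = ‖⟪u, w n h⟫_ℂ‖ₑ ^ 2
      simp [h0]
    · rw [if_pos ⟨h0, rfl⟩]

end FibreBases

/-! ### The standard lattices -/

section StandardLattice

/-- The lattice `{(k, l / N, m / (2N)) : k, l, m ∈ ℤ}`. -/
def standardLattice (N : ℕ) (hN : 0 < N) : Subgroup Heis where
  carrier := Set.range fun a : ℤ × ℤ × ℤ => Heis.mk a.1 (a.2.1 / N) (a.2.2 / (2 * N))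
  mul_mem' := by
    rintro _ _ ⟨a, rfl⟩ ⟨b, rfl⟩
    have : (N : ℝ) ≠ 0 := by positivity
    -- The product adds half of a multiple of `1/N` to the third coordinate, so the central spacing
    -- has to be `1/(2N)`.
    refine ⟨(a.1 + b.1, a.2.1 + b.2.1, a.2.2 + b.2.2 + (a.1 * b.2.1 - a.2.1 * b.1)),
      Heis.ext' ?_ ?_ ?_⟩
    · simp
    · simp only [Heis.mk_q, Heis.mul_q]; push_cast; ring
    · simp only [Heis.mk_t, Heis.mul_t, Heis.mk_p, Heis.mk_q]; push_cast; field_simp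
  one_mem' := ⟨(0, 0, 0), Heis.ext' (by simp) (by simp) (by simp)⟩
  inv_mem' := by
    rintro _ ⟨a, rfl⟩
    refine ⟨(-a.1, -a.2.1, -a.2.2), Heis.ext' ?_ ?_ ?_⟩
    · simp
    · simp only [Heis.mk_q, Heis.inv_q]; push_cast; ring
    · simp only [Heis.mk_t, Heis.inv_t]; push_cast; ring

variable {N : ℕ} (hN : 0 < N)

/-- The coordinates of the elements of the standard lattice. -/
def standardLatticeEquiv : ℤ × ℤ × ℤ ≃ standardLattice N hN :=
  Equiv.ofInjective (fun a : ℤ × ℤ × ℤ => Heis.mk a.1 (a.2.1 / N) (a.2.2 / (2 * N))) (by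
    intro a b hab
    have h0 : (N : ℝ) ≠ 0 := by positivity
    have h1 := congrArg Heis.p hab
    have h2 := congrArg Heis.q hab
    have h3 := congrArg Heis.t hab
    simp only [Heis.mk_p, Heis.mk_q, Heis.mk_t] at h1 h2 h3
    field_simp at h2 h3
    exact Prod.ext (by exact_mod_cast h1) (Prod.ext (by exact_mod_cast h2) (by exact_mod_cast h3)))

theorem coe_standardLatticeEquiv (a : ℤ × ℤ × ℤ) :
    (standardLatticeEquiv hN a : Heis) = Heis.mk a.1 (a.2.1 / N) (a.2.2 / (2 * N)) := rfl

theorem continuous_p : Continuous Heis.p := continuous_fst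
theorem continuous_q : Continuous Heis.q := continuous_fst.comp continuous_snd
theorem continuous_t : Continuous Heis.t := continuous_snd.comp continuous_snd

/-- The integer coordinates are continuous and injective, and their target is discrete. -/
theorem discreteTopology_standardLattice : DiscreteTopology (standardLattice N hN) := by
  have h0 : (N : ℝ) ≠ 0 := by positivity
  let g := (standardLatticeEquiv hN).symm
  have hg : ∀ γ : standardLattice N hN, (γ : Heis) = Heis.mk (g γ).1 ((g γ).2.1 / N) ((g γ).2.2 / (2 * N)) :=
    fun γ => by
      rw [← coe_standardLatticeEquiv hN, Equiv.apply_symm_apply]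
  have hc : Continuous ((↑) : standardLattice N hN → Heis) := continuous_subtype_val
  have hind := Int.isClosedEmbedding_coe_real.isInducing
  have h1 : Continuous fun γ => (g γ).1 := by
    rw [hind.continuous_iff]
    convert continuous_p.comp hc using 1
    funext γ
    rw [Function.comp_apply, Function.comp_apply, hg, Heis.mk_p]
  have h2 : Continuous fun γ => (g γ).2.1 := by
    rw [hind.continuous_iff]
    convert (continuous_q.comp hc).mul_const (N : ℝ) using 1
    funext γ
    rw [Function.comp_apply, Function.comp_apply, hg, Heis.mk_q]
    field_simp
  have h3 : Continuous fun γ => (g γ).2.2 := by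
    rw [hind.continuous_iff]
    convert (continuous_t.comp hc).mul_const (2 * N : ℝ) using 1
    funext γ
    rw [Function.comp_apply, Function.comp_apply, hg, Heis.mk_t]
    field_simp
  exact DiscreteTopology.of_continuous_injective (f := g) (h1.prodMk (h2.prodMk h3)) g.injective

theorem existsUnique_int_add_mem {b : ℝ} (hb : 0 < b) (x : ℝ) :
    ∃! k : ℤ, x + k / b ∈ Set.Ico 0 (1 / b) := by
  refine ⟨-⌊x * b⌋, ?_, fun k hk => ?_⟩
  · simp only
    rw [Set.mem_Ico, lt_div_iff₀ hb, add_mul, div_mul_cancel₀ _ hb.ne']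
    push_cast
    refine ⟨?_, by linarith [Int.lt_floor_add_one (x * b)]⟩
    rw [neg_div, ← sub_eq_add_neg, sub_nonneg, div_le_iff₀ hb]
    exact Int.floor_le _
  · simp only at hk
    rw [Set.mem_Ico, lt_div_iff₀ hb, add_mul, div_mul_cancel₀ _ hb.ne'] at hk
    have h1 : ⌊x * b⌋ = -k := by
      rw [Int.floor_eq_iff]
      push_cast
      have : 0 ≤ (x + k / b) * b := mul_nonneg hk.1 hb.le
      rw [add_mul, div_mul_cancel₀ _ hb.ne'] at this
      constructor <;> linarith
    rw [h1, neg_neg]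

theorem isLattice_standardLattice : IsLattice (standardLattice N hN) := by
  have h0 : (0 : ℝ) < N := by positivity
  refine ⟨discreteTopology_standardLattice hN, ?_⟩
  let A : Set Heis := (Set.Ico (0 : ℝ) 1 ×ˢ Set.Ico (0 : ℝ) (1 / N) ×ˢ
    Set.Ico (0 : ℝ) (1 / (2 * N)) : Set (ℝ × ℝ × ℝ))
  have hA : ∀ x : Heis, x ∈ A ↔ x.p ∈ Set.Ico (0 : ℝ) 1 ∧ x.q ∈ Set.Ico (0 : ℝ) (1 / N) ∧
    x.t ∈ Set.Ico (0 : ℝ) (1 / (2 * N)) := fun x => Iff.rfl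
  refine ⟨A, measurableSet_Ico.prod (measurableSet_Ico.prod measurableSet_Ico), fun x => ?_, ?_⟩
  · rw [(standardLatticeEquiv hN).bijective.existsUnique_iff]
    obtain ⟨k, hk, hk'⟩ := existsUnique_int_add_mem one_pos x.p
    obtain ⟨l, hl, hl'⟩ := existsUnique_int_add_mem h0 x.q
    -- The central coordinate is fixed last, since `k` and `l` enter its shift.
    obtain ⟨m, hm, hm'⟩ := existsUnique_int_add_mem (b := 2 * N) (by positivity)
      (x.t + (x.p * (l / N) - x.q * k) / 2)
    simp only [div_one] at hk hk'
    refine ⟨(k, l, m), ?_, ?_⟩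
    · simp only [hA, coe_standardLatticeEquiv, Heis.mul_p, Heis.mul_q, Heis.mul_t, Heis.mk_p,
        Heis.mk_q, Heis.mk_t]
      refine ⟨hk, hl, ?_⟩
      convert hm using 1
      ring
    · rintro ⟨k₁, l₁, m₁⟩ hmem
      simp only [hA, coe_standardLatticeEquiv, Heis.mul_p, Heis.mul_q, Heis.mul_t, Heis.mk_p,
        Heis.mk_q, Heis.mk_t] at hmem
      obtain rfl := hk' k₁ hmem.1
      obtain rfl := hl' l₁ hmem.2.1
      have := hm' m₁ (by
        convert hmem.2.2 using 1
        ring)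
      rw [this]
  · change (volume : Measure (ℝ × ℝ × ℝ)) A < ∞
    rw [Measure.volume_eq_prod, Measure.prod_prod, Measure.volume_eq_prod, Measure.prod_prod]
    simp only [Real.volume_Ico]
    exact ENNReal.mul_lt_top ENNReal.ofReal_lt_top
      (ENNReal.mul_lt_top ENNReal.ofReal_lt_top ENNReal.ofReal_lt_top)

end StandardLattice

/-! ### Parseval's identity on a rectangle -/

theorem enorm_exp_neg (k : ℤ) (x T : ℝ) :
    ‖Complex.exp (-(2 * Real.pi * Complex.I * k * x / T))‖ₑ = 1 := by
  rw [← ofReal_norm, Complex.norm_exp]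
  have : (-(2 * Real.pi * Complex.I * k * x / T) : ℂ)
      = ((-(2 * Real.pi * k * x / T) : ℝ) : ℂ) * Complex.I := by
    push_cast
    ring
  rw [this, Complex.re_ofReal_mul]
  simp

theorem measurable_exp_neg (k : ℤ) (T : ℝ) :
    Measurable fun x : ℝ => Complex.exp (-(2 * Real.pi * Complex.I * k * x / T)) := by
  fun_prop

/-- One-dimensional Parseval is applied twice: first to the rows in `y`, and then, for each `l`, to
the `l`-th coefficient as a function of `h`. -/
theorem tsum_enorm_integral_exp_mul_prod {a S b T : ℝ} (hS : 0 < S) (hT : 0 < T)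
    {G : ℝ × ℝ → ℂ} (hGm : StronglyMeasurable G) (hG : MemLp G 2 volume)
    (hsupp : ∀ z, G z ≠ 0 → z ∈ Set.Ioc a (a + S) ×ˢ Set.Ioc b (b + T)) :
    ∑' (l : ℤ) (m : ℤ), ‖∫ z : ℝ × ℝ, Complex.exp (-(2 * Real.pi * Complex.I * m * z.1 / S)) *
        (Complex.exp (-(2 * Real.pi * Complex.I * l * z.2 / T)) * G z)‖ₑ ^ 2
      = ENNReal.ofReal S * ENNReal.ofReal T * ∫⁻ z, ‖G z‖ₑ ^ 2 := by
  have hint : Integrable G := by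
    have hfin : volume (Set.Ioc a (a + S) ×ˢ Set.Ioc b (b + T)) ≠ ∞ := by
      rw [Measure.volume_eq_prod, Measure.prod_prod]
      simp only [Real.volume_Ioc]
      exact ENNReal.mul_ne_top ENNReal.ofReal_ne_top ENNReal.ofReal_ne_top
    rw [← integrableOn_iff_integrable_of_support_subset (s := Set.Ioc a (a + S) ×ˢ Set.Ioc b (b + T))
      (fun z hz => hsupp z hz)]
    have : IsFiniteMeasure (volume.restrict (Set.Ioc a (a + S) ×ˢ Set.Ioc b (b + T))) :=
      isFiniteMeasure_restrict.2 hfin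
    exact (hG.restrict _).integrable one_le_two
  let g : ℤ → ℝ → ℂ := fun l h =>
    ∫ y : ℝ, Complex.exp (-(2 * Real.pi * Complex.I * l * y / T)) * G (h, y)
  have hgm : ∀ l, StronglyMeasurable (g l) := fun l =>
    StronglyMeasurable.integral_prod_right (f := fun h y : ℝ =>
      Complex.exp (-(2 * Real.pi * Complex.I * l * y / T)) * G (h, y))
      (((measurable_exp_neg l T).comp measurable_snd).stronglyMeasurable.mul hGm)
  have hrow : ∀ᵐ h : ℝ, ∑' l, ‖g l h‖ₑ ^ 2 = ENNReal.ofReal T * ∫⁻ y, ‖G (h, y)‖ₑ ^ 2 := by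
    filter_upwards [ae_memLp_slice hG] with h hh
    refine tsum_enorm_integral_exp_mul hT hh (a := b) fun y hy => ?_
    by_contra h0
    exact hy (hsupp _ h0).2
  have htotal : ∑' l, ∫⁻ h, ‖g l h‖ₑ ^ 2 = ENNReal.ofReal T * ∫⁻ z, ‖G z‖ₑ ^ 2 := by
    rw [← lintegral_tsum fun l => ((hgm l).enorm.pow_const 2).aemeasurable,
      lintegral_congr_ae hrow, lintegral_const_mul' _ _ ENNReal.ofReal_ne_top,
      lintegral_volume_prod (hGm.enorm.pow_const 2).aemeasurable]
  have hgL : ∀ l, MemLp (g l) 2 volume := by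
    intro l
    refine memLp_two_iff.2 ⟨(hgm l).aestronglyMeasurable, ?_⟩
    refine lt_of_le_of_lt (ENNReal.le_tsum (f := fun l => ∫⁻ h, ‖g l h‖ₑ ^ 2) l) ?_
    rw [htotal]
    exact ENNReal.mul_lt_top ENNReal.ofReal_lt_top (memLp_two_iff.1 hG).2
  have hcol : ∀ l : ℤ, ∑' m : ℤ, ‖∫ z : ℝ × ℝ,
      Complex.exp (-(2 * Real.pi * Complex.I * m * z.1 / S)) *
        (Complex.exp (-(2 * Real.pi * Complex.I * l * z.2 / T)) * G z)‖ₑ ^ 2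
      = ENNReal.ofReal S * ∫⁻ h, ‖g l h‖ₑ ^ 2 := by
    intro l
    rw [← tsum_enorm_integral_exp_mul hS (hgL l) (a := a) fun h hh => ?_]
    · refine tsum_congr fun m => ?_
      congr 2
      refine (integral_prod _ ?_).trans ?_
      · refine hint.mono ?_ (Eventually.of_forall fun z => ?_)
        · exact (((measurable_exp_neg m S).comp measurable_fst).stronglyMeasurable.mul
            (((measurable_exp_neg l T).comp measurable_snd).stronglyMeasurable.mul
              hGm)).aestronglyMeasurable
        · rw [← enorm_le_iff_norm_le, enorm_mul, enorm_mul, enorm_exp_neg, enorm_exp_neg, one_mul,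
            one_mul]
      · refine integral_congr_ae (Eventually.of_forall fun h => ?_)
        simp only [g]
        rw [integral_const_mul]
    · simp only [g]
      rw [← integral_zero ℝ ℂ]
      refine integral_congr_ae (Eventually.of_forall fun y => ?_)
      have : G (h, y) = 0 := by
        by_contra h0
        exact hh (hsupp _ h0).1
      simp only [this, mul_zero]
  simp_rw [hcol]
  rw [ENNReal.tsum_mul_left, htotal, mul_assoc]

/-! ### Tight frames for bandlimited subspaces -/

section Sufficiency

open scoped ComplexConjugate

/-- The field of kernels that takes the value `e j h` for `y ∈ (j|h|, (j+1)|h|]`. -/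
def stepKernel (e : ℤ → ℝ → L2R) (z : ℝ × ℝ) : L2R := e (⌈z.2 / |z.1|⌉ - 1) z.1

theorem stronglyMeasurable_stepKernel {e : ℤ → ℝ → L2R} (he : ∀ j, StronglyMeasurable (e j)) :
    StronglyMeasurable (stepKernel e) := by
  borelize L2R
  have h1 : Measurable (fun a : ℤ × ℝ => e a.1 a.2) :=
    measurable_from_prod_countable_right fun j => (he j).measurable
  have h2 : Measurable (fun z : ℝ × ℝ => (⌈z.2 / |z.1|⌉ - 1, z.1)) := by
    refine Measurable.prodMk ((Int.measurable_ceil.comp ?_).sub_const 1) measurable_fst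
    exact measurable_snd.div (continuous_abs.measurable.comp measurable_fst)
  exact (h1.comp h2).stronglyMeasurable

theorem stepKernel_support {e : ℤ → ℝ → L2R} {C : ℕ} {R N : ℝ}
    (he : ∀ j h, e j h ≠ 0 → 0 ≤ j ∧ j < C) (hR : ∀ j h, R < |h| → e j h = 0)
    (hRN : R < N) (hCN : C * R ≤ N) {z : ℝ × ℝ} (hz : stepKernel e z ≠ 0) :
    z ∈ Set.Ioc (-N) (-N + 2 * N) ×ˢ Set.Ioc 0 (0 + N) := by
  have h1 : |z.1| ≤ R := by
    by_contra! h
    exact hz (hR _ _ h)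
  obtain ⟨h2, h3⟩ := he _ _ hz
  -- At `h = 0` division by zero gives the index `⌈0⌉ - 1 = -1`, where `e` vanishes.
  have h0 : 0 < |z.1| := by
    rw [abs_pos]
    intro h0
    rw [h0] at h2
    simp at h2
  have h4 : 0 < ⌈z.2 / |z.1|⌉ := by omega
  have h5 : ⌈z.2 / |z.1|⌉ ≤ C := by omega
  rw [Int.ceil_pos] at h4
  rw [Int.ceil_le, div_le_iff₀ h0] at h5
  have h6 : 0 < z.2 := by
    have := mul_pos h4 h0
    rwa [div_mul_cancel₀ _ h0.ne'] at this
  have h7 := abs_le.1 h1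
  push_cast at h5
  refine ⟨⟨by linarith, by linarith⟩, ⟨h6, ?_⟩⟩
  calc z.2 ≤ C * |z.1| := h5
    _ ≤ C * R := by gcongr
    _ ≤ 0 + N := by linarith

theorem memLp_stepKernel {e : ℤ → ℝ → L2R} (hem : ∀ j, StronglyMeasurable (e j))
    (he1 : ∀ j h, ‖e j h‖ ≤ 1) {a b c d : ℝ}
    (hsupp : ∀ z, stepKernel e z ≠ 0 → z ∈ Set.Ioc a b ×ˢ Set.Ioc c d) :
    MemLp (stepKernel e) 2 volume := by
  have hfin : volume (Set.Ioc a b ×ˢ Set.Ioc c d) ≠ ∞ := by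
    rw [Measure.volume_eq_prod, Measure.prod_prod]
    simp only [Real.volume_Ioc]
    exact ENNReal.mul_ne_top ENNReal.ofReal_ne_top ENNReal.ofReal_ne_top
  refine (memLp_indicator_const 2 (measurableSet_Ioc.prod measurableSet_Ioc) (1 : ℝ)
    (Or.inr hfin)).of_le (stronglyMeasurable_stepKernel hem).aestronglyMeasurable
    (Eventually.of_forall fun z => ?_)
  by_cases hz : stepKernel e z = 0
  · simp [hz]
  · rw [Set.indicator_of_mem (hsupp z hz)]
    rw [norm_one]
    exact he1 _ _

/-- Along `y + hℤ` the step kernel runs through the whole family `e`. -/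
theorem tsum_stepKernel (e : ℤ → ℝ → L2R) {h : ℝ} (h0 : h ≠ 0) (y : ℝ) (u : L2R) :
    ∑' k : ℤ, ‖⟪u, stepKernel e (h, y + h * k)⟫_ℂ‖ₑ ^ 2 = ∑' j : ℤ, ‖⟪u, e j h⟫_ℂ‖ₑ ^ 2 := by
  rcases lt_or_gt_of_ne h0 with hneg | hpos
  -- For `h < 0` the steps are traversed in reverse order.
  · rw [← (Equiv.subLeft (⌈y / |h|⌉ - 1)).tsum_eq fun j => ‖⟪u, e j h⟫_ℂ‖ₑ ^ 2]
    refine tsum_congr fun k => ?_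
    have : (y + h * k) / |h| = y / |h| - k := by
      rw [abs_of_neg hneg]
      field_simp
      ring
    simp only [stepKernel, this, Int.ceil_sub_intCast, Equiv.subLeft_apply]
    rw [sub_right_comm]
  · rw [← (Equiv.addLeft (⌈y / |h|⌉ - 1)).tsum_eq fun j => ‖⟪u, e j h⟫_ℂ‖ₑ ^ 2]
    refine tsum_congr fun k => ?_
    have : (y + h * k) / |h| = y / |h| + k := by
      rw [abs_of_pos hpos]
      field_simp
    simp only [stepKernel, this, Int.ceil_add_intCast, Equiv.coe_addLeft]
    rw [add_sub_right_comm]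

/-- Shifting `y` by `-hk` frees the step kernel of its translation. The remaining phase is `(m -
kl)h/(2N) + ly/N`, a character of the rectangle of sides `2N` and `N`. -/
theorem inner_leftReg_standardLattice {N : ℕ} (hN : 0 < N) {Φ f : L2H} {K : ℝ × ℝ → L2R}
    (hK : kernel Φ =ᵐ[volume] K) (k l m : ℤ) :
    ⟪leftReg (standardLatticeEquiv hN (k, l, m) : Heis) Φ, f⟫_ℂ
      = ∫ z : ℝ × ℝ, Complex.exp (-(2 * Real.pi * Complex.I * (m - k * l : ℤ) * z.1 /
          (2 * N : ℝ))) * (Complex.exp (-(2 * Real.pi * Complex.I * l * z.2 / (N : ℝ))) *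
        ⟪kernel f (z.1, z.2 + z.1 * (-k)), K z⟫_ℂ) := by
  have h0 : (N : ℂ) ≠ 0 := by exact_mod_cast hN.ne'
  rw [inner_leftReg, ← (measurePreserving_fieldShear (-k)).integral_comp
    (measurableEmbedding_fieldShear _)]
  refine integral_congr_ae ?_
  filter_upwards [hK] with z hz
  simp only [coe_standardLatticeEquiv, Heis.mk_p]
  have h1 : (z.1, z.2 + z.1 * -(k : ℝ) + z.1 * k) = z := Prod.ext rfl (by simp)
  rw [h1, hz, ← mul_assoc]
  congr 1
  rw [phase, ← Complex.exp_add, ← Complex.exp_add, ← Complex.exp_add, ← Complex.exp_conj]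
  congr 1
  simp only [Heis.mk_p, Heis.mk_q, Heis.mk_t, map_add, map_mul, Complex.conj_I,
    Complex.conj_ofReal, map_ofNat]
  push_cast
  field_simp
  ring

theorem hasSum_of_tsum_enorm_sq {ι : Type*} {u : ι → ℂ} {s : ℝ} (hs : 0 ≤ s)
    (h : ∑' i, ‖u i‖ₑ ^ 2 = ENNReal.ofReal s) : HasSum (fun i => ‖u i‖ ^ 2) s := by
  have h1 : ∑' i, ‖u i‖ₑ ^ 2 ≠ ∞ := by rw [h]; exact ENNReal.ofReal_ne_top
  have h2 := ENNReal.hasSum_toReal h1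
  rw [← ENNReal.tsum_toReal_eq (fun i => by simp), h, ENNReal.toReal_ofReal hs] at h2
  simpa using h2

/-- The frame identity for a generator given by a step kernel. -/
theorem tsum_coeff_standardLattice {N : ℕ} (hN : 0 < N) {Q : ℝ → L2R →L[ℂ] L2R}
    {e : ℤ → ℝ → L2R} (hem : ∀ j, StronglyMeasurable (e j)) (he1 : ∀ j h, ‖e j h‖ ≤ 1)
    (hsum : ∀ h u, ∑' j : ℤ, ‖⟪u, e j h⟫_ℂ‖ₑ ^ 2 = ‖Q h u‖ₑ ^ 2)
    (hsupp : ∀ z, stepKernel e z ≠ 0 →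
      z ∈ Set.Ioc (-N : ℝ) (-N + 2 * N) ×ˢ Set.Ioc (0 : ℝ) (0 + N))
    {Φ f : L2H} (hΦ : kernel Φ =ᵐ[volume] stepKernel e)
    (hf : ∀ᵐ z : ℝ × ℝ, Q z.1 (kernel f z) = kernel f z) :
    ∑' γ : standardLattice N hN, ‖⟪leftReg (γ : Heis) Φ, f⟫_ℂ‖ₑ ^ 2
      = ENNReal.ofReal (2 * N) * ENNReal.ofReal N * ‖f‖ₑ ^ 2 := by
  have hN' : (0 : ℝ) < N := by exact_mod_cast hN
  have hKm := stronglyMeasurable_stepKernel hem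
  let G : ℤ → ℝ × ℝ → ℂ := fun k z => ⟪kernel f (z.1, z.2 + z.1 * (-k)), stepKernel e z⟫_ℂ
  have hshear : ∀ k : ℤ, MemLp (fun z : ℝ × ℝ => kernel f (z.1, z.2 + z.1 * (-k))) 2 volume :=
    fun k => (Lp.memLp (kernel f)).comp_measurePreserving (measurePreserving_fieldShear (-k))
  have hGm : ∀ k, StronglyMeasurable (G k) := fun k =>
    ((Lp.stronglyMeasurable (kernel f)).comp_measurable
      (measurePreserving_fieldShear (-k)).measurable).inner hKm
  have hG : ∀ k, MemLp (G k) 2 volume := fun k =>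
    (hshear k).of_le (hGm k).aestronglyMeasurable (Eventually.of_forall fun z =>
      (norm_inner_le_norm _ _).trans (mul_le_of_le_one_right (norm_nonneg _) (he1 _ _)))
  have hGs : ∀ k z, G k z ≠ 0 →
      z ∈ Set.Ioc (-N : ℝ) (-N + 2 * N) ×ˢ Set.Ioc (0 : ℝ) (0 + N) := fun k z hz =>
    hsupp z fun h => hz (by simp only [G]; rw [h, inner_zero_right])
  rw [← (standardLatticeEquiv hN).tsum_eq, ENNReal.tsum_prod']
  have hk : ∀ k : ℤ, ∑' a : ℤ × ℤ, ‖⟪leftReg (standardLatticeEquiv hN (k, a) : Heis) Φ, f⟫_ℂ‖ₑ ^ 2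
      = ENNReal.ofReal (2 * N) * ENNReal.ofReal N * ∫⁻ z, ‖G k z‖ₑ ^ 2 := by
    intro k
    rw [ENNReal.tsum_prod', ← tsum_enorm_integral_exp_mul_prod (a := -N) (b := 0)
      (by positivity) hN' (hGm k) (hG k) (hGs k)]
    refine tsum_congr fun l => ?_
    simp_rw [inner_leftReg_standardLattice hN hΦ k l]
    -- For fixed `k` and `l`, the offset `kl` only permutes the values of `m`.
    exact (Equiv.subRight (k * l)).tsum_eq fun m : ℤ => ‖∫ z : ℝ × ℝ,
      Complex.exp (-(2 * Real.pi * Complex.I * m * z.1 / (2 * N : ℝ))) *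
        (Complex.exp (-(2 * Real.pi * Complex.I * l * z.2 / (N : ℝ))) * G k z)‖ₑ ^ 2
  simp_rw [hk]
  rw [ENNReal.tsum_mul_left, enorm_sq_eq_lintegral_kernel]
  congr 1
  -- Undoing the shear puts the shift back on the step kernel, so that the sum over `k` becomes a
  -- sum over the fibre basis at the fixed vector `kernel f z`.
  have hback : ∀ k : ℤ, ∫⁻ z, ‖G k z‖ₑ ^ 2
      = ∫⁻ z : ℝ × ℝ, ‖⟪kernel f z, stepKernel e (z.1, z.2 + z.1 * k)⟫_ℂ‖ₑ ^ 2 := by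
    intro k
    rw [← (measurePreserving_fieldShear k).lintegral_comp_emb (measurableEmbedding_fieldShear _)]
    refine lintegral_congr fun z => ?_
    have h1 : (z.1, z.2 + z.1 * (k : ℝ) + z.1 * -k) = z := Prod.ext rfl (by simp)
    simp only [G]
    rw [h1]
  simp_rw [hback]
  rw [← lintegral_tsum fun k => ?_]
  · refine lintegral_congr_ae ?_
    filter_upwards [hf, ae_fst_ne_zero] with z hz h0
    rw [tsum_stepKernel e h0, hsum, hz]
  · exact (((Lp.stronglyMeasurable (kernel f)).inner (hKm.comp_measurable
      (measurePreserving_fieldShear k).measurable)).enorm.pow_const 2).aemeasurable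

/-- A bandlimited invariant subspace of bounded multiplicity has a tight frame over a lattice. -/
theorem exists_isTightFrame {H : ClosedSubmodule ℂ L2H} (hH : LeftInvariant H.toSubmodule)
    {P : ℝ → L2R →L[ℂ] L2R} (hP : IsProjectionField H P) (hb : BoundedMultiplicity P)
    (hbl : Bandlimited P) :
    ∃ Γ : Subgroup Heis, IsLattice Γ ∧ ∃ Φ ∈ H,
      IsTightFrame H.toSubmodule (fun γ : Γ => leftReg (γ : Heis) Φ) := by
  obtain ⟨Q, C, R, hQ, hrank, hband, hQm, hQP⟩ :=
    exists_regular_field hP.measurable hP.isProj hb hbl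
  obtain ⟨e, hem, he1, hQe, heC, hsum⟩ := exists_fibre_basis hQ hrank hQm
  -- `N > R` makes the rectangle cover the band, and `N > CR` leaves room for `C` steps of length
  -- `|h| ≤ R`; the `0` ensures `N > 0`.
  obtain ⟨N, hNR⟩ := exists_nat_gt (max (max R (C * R)) 0)
  obtain ⟨h1, h3⟩ := max_lt_iff.1 hNR
  obtain ⟨h1, h2⟩ := max_lt_iff.1 h1
  have hN : 0 < N := by exact_mod_cast h3
  have hQPz : ∀ᵐ z : ℝ × ℝ, Q z.1 = P z.1 := Measure.quasiMeasurePreserving_fst.ae hQP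
  have hsupp : ∀ z, stepKernel e z ≠ 0 →
      z ∈ Set.Ioc (-N : ℝ) (-N + 2 * N) ×ˢ Set.Ioc (0 : ℝ) (0 + N) := fun z hz =>
    stepKernel_support heC (fun j h hh => by rw [← hQe, hband h hh]; rfl) h1 h2.le hz
  obtain ⟨Φ, hΦ⟩ := exists_kernel_ae_eq (memLp_stepKernel hem he1 hsupp)
  have hΦH : Φ ∈ H := by
    refine hP.mem_of_kernel ?_
    filter_upwards [hΦ, hQPz] with z h4 h5
    rw [h4, ← h5]
    exact hQe _ _
  refine ⟨standardLattice N hN, isLattice_standardLattice hN, Φ, hΦH,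
    fun γ => hH _ _ hΦH, 2 * N * N, by positivity, fun f hf => ?_⟩
  refine hasSum_of_tsum_enorm_sq (by positivity) ?_
  rw [tsum_coeff_standardLattice hN hem he1 hsum hsupp hΦ,
    ENNReal.ofReal_mul (p := 2 * N * N) (by positivity),
    ENNReal.ofReal_mul (p := 2 * N) (by positivity), ENNReal.ofReal_pow (norm_nonneg _), ofReal_norm]
  filter_upwards [hP.kernel_of_mem hf, hQPz] with z h4 h5
  rw [h5, h4]

end Sufficiency

end Heisenberg

end

open Heisenberg in
theorem corollary4p2 (H : ClosedSubmodule ℂ L2H) (hH : LeftInvariant H.toSubmodule) :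
    (∃ P : ℝ → L2R →L[ℂ] L2R, IsProjectionField H P) ∧
    ∀ P : ℝ → L2R →L[ℂ] L2R, IsProjectionField H P → BoundedMultiplicity P →
      ((∃ Γ : Subgroup Heis, IsLattice Γ ∧ ∃ Φ ∈ H,
          IsTightFrame H.toSubmodule (fun γ : Γ => leftReg (γ : Heis) Φ)) ↔
        Bandlimited P) := by
  refine ⟨exists_isProjectionField H hH, fun P hP hb => ⟨?_, exists_isTightFrame hH hP hb⟩⟩
  rintro ⟨Γ, hΓ, Φ, hΦ, hfr⟩
  exact bandlimited_of_isTightFrame hH hP hΓ hΦ hfr
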